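/- **Setting.** Let $\mathbf M\in\mathbb R^{n\times p}$ be the matrix described by a turnstile stream: starting from $\mathbf 0$, each update $(\alpha,i,j)$ with $\alpha\in\mathbb R$ adds $\alpha$ to the $(i,j)$ entry. Assume that every row of $\mathbf M$ has nonzero sample variance. Let $\overline{\mathbf x}=\frac1p\mathbf M\mathbf e$, $\mathbf V=\frac1{p-1}(\mathbf M-\overline{\mathbf x}\mathbf e^T)(\mathbf M-\overline{\mathbf x}\mathbf e^T)^T$ and $\mathbf C=\mathbf\Sigma^{-1/2}\mathbf V\mathbf\Sigma^{-1/2}$, where $\mathbf e$ is the all-ones vector of length $p$ and $\mathbf\Sigma$ is the diagonal of $\mathbf V$; $\mathbf C$ is the sample correlation matrix. Let $\textsc{Large}_\phi$ be the set of pairs $(i,j)$, $i\ne j$, with $|\mathbf C_{i,j}|\ge\phi$, and let $\mathbf C_{-k}$ be $\mathbf C$ with its diagonal and its $k$ off-diagonal entries of largest magnitude replaced by $0$ (all off-diagonal entries, if there are at most $k$). **Model.** A *linear sketch* draws a uniformly random seed at initialization, and the seed determines a vector $w$ of stored integers; $w$ contains all the randomness that is used later. It also stores some fixed reals and $s$ real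 counters, initially $0$. An update $(\alpha,i,j)$ adds $\alpha\, a_{w,i,j}$ to the counters for a vector $a_{w,i,j}\in\mathbb R^s$. The *size* is the total number of stored integers, fixed reals and counters; each stored integer has $O(\log(n+p+\text{size}))$ bits. The query runs on a unit-cost real RAM (integer registers and arrays with addition, truncated subtraction and comparison; real registers and arrays with $+,-,\times,/,\sqrt{\cdot}$ and comparison) which can also multiply an $a\times b$ by a $b\times a$ matrix at cost $\mathcal M(a,b)$, where $\mathcal M:\mathbb N\times\mathbb N\to\mathbb N$ is an arbitrary cost function. $\tilde O(f)$ means at most $K(1+\log n)^c f$ with absolute constants $K$, $c$; real arguments of $\mathcal M$ are rounded up. **Theorem.** There is a fixed query program such that the following holds for every $\theta\in[0,1]$, all integers $n\ge1$, $p\ge 0$, $k\ge0$ and all reals $0<\phi\le1$, $R\ge0$ with $k$, $R$ not both $0$. There is a linear sketch of $n\times p$ matrices, of size $$\tilde O\Big(n^{2\theta}\big(k^2+\tfrac{R^2}{\phi^2}\big)+\frac{n^{3-2\theta}}{k^2\phi^2+R^2}\Big),$$ such that, for every $\mathcal M$, the query program, started on the contents of the sketch after any stream, always halts within time $$\tilde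 O\Big(n^{2\theta}\big(k^2+\tfrac{R^2}{\phi^2}\big)+\frac{n^{3-2\theta}}{k^2\phi^2+R^2}+\mathcal M\Big(n^{\theta}\big(k+\tfrac R\phi\big),\ \frac{n^{2-2\theta}}{k^2\phi^2+R^2}\Big)\Big)$$ and outputs a list of index pairs, of length at most its running time. For every fixed stream with $|\textsc{Large}_\phi|\le k$ and $\|\mathbf C_{-k}\|_F\le R$, the list contains every element of $\textsc{Large}_\phi$ with probability at least $1-n^{-3}$ over the seed. -/

import Mathlib

namespace CorrOutliers

/-! ### Sample correlation, large entries, and the tail of the correlation matrix -/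

noncomputable section

/-- The sample mean `x̄ = (1/p) ∑ᵢ x⁽ⁱ⁾` of the `p` columns of `M`. -/
def sampleMean {n p : ℕ} (M : Matrix (Fin n) (Fin p) ℝ) : Fin n → ℝ :=
  fun i => (1 / (p : ℝ)) * ∑ j, M i j

/-- The centred data matrix `M - x̄ eᵀ`. -/
def centered {n p : ℕ} (M : Matrix (Fin n) (Fin p) ℝ) : Matrix (Fin n) (Fin p) ℝ :=
  M - Matrix.of fun i _ => sampleMean M i

/-- The sample covariance `V = (1/(p-1)) (M - x̄ eᵀ)(M - x̄ eᵀ)ᵀ`. -/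
def sampleCov {n p : ℕ} (M : Matrix (Fin n) (Fin p) ℝ) : Matrix (Fin n) (Fin n) ℝ :=
  (1 / ((p : ℝ) - 1)) • (centered M * (centered M).transpose)

/-- The sample correlation `C = Σ^{-1/2} V Σ^{-1/2}`, where `Σ` is the diagonal of `V`. It is
meaningful when all the sample variances `V i i` are nonzero. -/
def sampleCorr {n p : ℕ} (M : Matrix (Fin n) (Fin p) ℝ) : Matrix (Fin n) (Fin n) ℝ :=
  Matrix.diagonal (fun i => (Real.sqrt (sampleCov M i i))⁻¹) * sampleCov M *
    Matrix.diagonal (fun i => (Real.sqrt (sampleCov M i i))⁻¹)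

/-- The (ordered) index pairs of the off-diagonal entries of magnitude at least `φ`. -/
def large {n : ℕ} (C : Matrix (Fin n) (Fin n) ℝ) (φ : ℝ) : Finset (Fin n × Fin n) :=
  (Finset.univ : Finset (Fin n)).offDiag.filter fun e => φ ≤ |C e.1 e.2|

/-- `T` is a set of `k` off-diagonal positions of largest magnitude in `C` (of all the off-diagonal
positions, if there are fewer than `k`). Ties may be broken in any way. -/
def IsTop {n : ℕ} (C : Matrix (Fin n) (Fin n) ℝ) (k : ℕ) (T : Finset (Fin n × Fin n)) : Prop :=
  T ⊆ (Finset.univ : Finset (Fin n)).offDiag ∧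
  T.card = min k (Finset.univ : Finset (Fin n)).offDiag.card ∧
  ∀ e ∈ T, ∀ f ∈ (Finset.univ : Finset (Fin n)).offDiag, f ∉ T → |C f.1 f.2| ≤ |C e.1 e.2|

/-- `C` with the diagonal entries and the entries at the positions in `T` replaced by `0`. For a
set `T` with `IsTop C k T` this is `C_{-k}`. -/
def removeEntries {n : ℕ} (C : Matrix (Fin n) (Fin n) ℝ) (T : Finset (Fin n × Fin n)) :
    Matrix (Fin n) (Fin n) ℝ :=
  Matrix.of fun i j => if i = j ∨ (i, j) ∈ T then 0 else C i j

/-- The Frobenius norm. -/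
def frobenius {n : ℕ} (A : Matrix (Fin n) (Fin n) ℝ) : ℝ :=
  Real.sqrt (∑ i, ∑ j, A i j ^ 2)

/-! ### Turnstile streams -/

/-- A turnstile update: add `amount` to the entry at `(row, col)`. -/
structure Update (n p : ℕ) where
  amount : ℝ
  row : Fin n
  col : Fin p

/-- The matrix described by a stream of updates, starting from the zero matrix. -/
def streamMatrix {n p : ℕ} (us : List (Update n p)) : Matrix (Fin n) (Fin p) ℝ :=
  us.foldl (fun M u => M + Matrix.single u.row u.col u.amount) 0

/-! ### The machine: a unit-cost real RAM

The machine has integer registers and arrays (with addition, truncated subtraction and comparison)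
and real registers and arrays (with the field operations, square roots and comparison). Arrays and
registers are named by numerals in the program; array positions are computed in integer registers.
The matrix multiplication instruction multiplies an `a × b` matrix by a `b × a` matrix; it is
charged `Mul a b` steps, for a cost function `Mul` that is a parameter of the machine. Every other
instruction and every test is charged one step. -/

/-- The memory of the machine. -/
structure State where
  wreg : ℕ → ℕ
  rreg : ℕ → ℝ
  warr : ℕ → ℕ → ℕ
  rarr : ℕ → ℕ → ℝ

/-- The instructions. -/
inductive Instr where
  | wconst (d v : ℕ)
  | wadd (d a b : ℕ)
  | wsub (d a b : ℕ)
  | wload (d arr i : ℕ)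
  | wstore (arr i a : ℕ)
  | rconst (d v : ℕ)
  | radd (d a b : ℕ)
  | rsub (d a b : ℕ)
  | rmul (d a b : ℕ)
  | rdiv (d a b : ℕ)
  | rsqrt (d a : ℕ)
  | rload (d arr i : ℕ)
  | rstore (arr i a : ℕ)
  | matmul (dst x y a b : ℕ)

/-- Write `v` into the integer register `d`. -/
def State.setW (s : State) (d v : ℕ) : State :=
  { s with wreg := Function.update s.wreg d v }

/-- Write `v` into the real register `d`. -/
def State.setR (s : State) (d : ℕ) (v : ℝ) : State :=
  { s with rreg := Function.update s.rreg d v }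

/-- Write `v` into position `i` of the integer array `arr`. -/
def State.setWA (s : State) (arr i v : ℕ) : State :=
  { s with warr := Function.update s.warr arr (Function.update (s.warr arr) i v) }

/-- Write `v` into position `i` of the real array `arr`. -/
def State.setRA (s : State) (arr i : ℕ) (v : ℝ) : State :=
  { s with rarr := Function.update s.rarr arr (Function.update (s.rarr arr) i v) }

/-- The contents of an array that held `z`, after the row-major product of the `a × b` matrix
stored (row-major) in `x` by the `b × a` matrix stored (row-major) in `y` is written into it. -/
def mulArr (a b : ℕ) (x y z : ℕ → ℝ) : ℕ → ℝ :=
  fun t => if t < a * a then ∑ j ∈ Finset.range b, x (t / a * b + j) * y (j * a + t % a) else z t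

/-- The effect of an instruction. -/
def Instr.run : Instr → State → State
  | .wconst d v, s => s.setW d v
  | .wadd d a b, s => s.setW d (s.wreg a + s.wreg b)
  | .wsub d a b, s => s.setW d (s.wreg a - s.wreg b)
  | .wload d arr i, s => s.setW d (s.warr arr (s.wreg i))
  | .wstore arr i a, s => s.setWA arr (s.wreg i) (s.wreg a)
  | .rconst d v, s => s.setR d (v : ℝ)
  | .radd d a b, s => s.setR d (s.rreg a + s.rreg b)
  | .rsub d a b, s => s.setR d (s.rreg a - s.rreg b)
  | .rmul d a b, s => s.setR d (s.rreg a * s.rreg b)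
  | .rdiv d a b, s => s.setR d (s.rreg a / s.rreg b)
  | .rsqrt d a, s => s.setR d (Real.sqrt (s.rreg a))
  | .rload d arr i, s => s.setR d (s.rarr arr (s.wreg i))
  | .rstore arr i a, s => s.setRA arr (s.wreg i) (s.rreg a)
  | .matmul dst x y a b, s =>
      { s with
        rarr := Function.update s.rarr dst
          (mulArr (s.wreg a) (s.wreg b) (s.rarr x) (s.rarr y) (s.rarr dst)) }

/-- The number of steps an instruction is charged. -/
def Instr.cost (Mul : ℕ → ℕ → ℕ) : Instr → State → ℕ
  | .matmul _ _ _ a b, s => Mul (s.wreg a) (s.wreg b)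
  | _, _ => 1

/-- Programs. The branch `ifWord a b P Q` takes `P` when integer register `a` is less than integer
register `b`; `ifReal a b P Q` takes `P` when real register `a` is less than real register `b`;
`loop a b P` repeats `P` while integer register `a` is less than integer register `b`. -/
inductive Program where
  | skip
  | step (c : Instr)
  | seq (P Q : Program)
  | ifWord (a b : ℕ) (P Q : Program)
  | ifReal (a b : ℕ) (P Q : Program)
  | loop (a b : ℕ) (P : Program)

/-- `Exec Mul P s s' t`: started in `s`, the program `P` halts in `s'` after `t` steps. -/
inductive Exec (Mul : ℕ → ℕ → ℕ) : Program → State → State → ℕ → Prop where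
  | skip (s : State) : Exec Mul .skip s s 0
  | step (c : Instr) (s : State) : Exec Mul (.step c) s (c.run s) (c.cost Mul s)
  | seq {P Q : Program} {s s₁ s₂ : State} {t₁ t₂ : ℕ} :
      Exec Mul P s s₁ t₁ → Exec Mul Q s₁ s₂ t₂ → Exec Mul (.seq P Q) s s₂ (t₁ + t₂)
  | ifWord_true {a b : ℕ} {P Q : Program} {s s' : State} {t : ℕ} :
      s.wreg a < s.wreg b → Exec Mul P s s' t → Exec Mul (.ifWord a b P Q) s s' (t + 1)
  | ifWord_false {a b : ℕ} {P Q : Program} {s s' : State} {t : ℕ} :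
      ¬ s.wreg a < s.wreg b → Exec Mul Q s s' t → Exec Mul (.ifWord a b P Q) s s' (t + 1)
  | ifReal_true {a b : ℕ} {P Q : Program} {s s' : State} {t : ℕ} :
      s.rreg a < s.rreg b → Exec Mul P s s' t → Exec Mul (.ifReal a b P Q) s s' (t + 1)
  | ifReal_false {a b : ℕ} {P Q : Program} {s s' : State} {t : ℕ} :
      ¬ s.rreg a < s.rreg b → Exec Mul Q s s' t → Exec Mul (.ifReal a b P Q) s s' (t + 1)
  | loop_false {a b : ℕ} {P : Program} {s : State} :
      ¬ s.wreg a < s.wreg b → Exec Mul (.loop a b P) s s 1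
  | loop_true {a b : ℕ} {P : Program} {s s₁ s₂ : State} {t₁ t₂ : ℕ} :
      s.wreg a < s.wreg b → Exec Mul P s s₁ t₁ → Exec Mul (.loop a b P) s₁ s₂ t₂ →
      Exec Mul (.loop a b P) s s₂ (t₁ + t₂ + 1)

/-! ### Linear sketches -/

/-- A randomized linear sketch of `n × p` matrices. At initialization a seed is drawn uniformly
at random and determines `numWords` stored integers; these include all the randomness that updates
or queries can use later. The sketch stores moreover `numParams` fixed reals and
`numCounters` real counters, which start at `0`. An update `(α, i, j)` adds `α` times the vector
`column w i j` to the counters, where `w` is the vector of stored integers. -/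
structure LinearSketch (n p : ℕ) where
  numSeeds : ℕ
  numSeeds_pos : 0 < numSeeds
  numWords : ℕ
  numParams : ℕ
  numCounters : ℕ
  words : Fin numSeeds → Fin numWords → ℕ
  params : Fin numParams → ℝ
  column : (Fin numWords → ℕ) → Fin n → Fin p → Fin numCounters → ℝ

/-- The number of memory cells that the sketch occupies. -/
def LinearSketch.size {n p : ℕ} (S : LinearSketch n p) : ℕ :=
  S.numWords + S.numParams + S.numCounters

/-- The counters after a stream of updates. -/
def LinearSketch.counters {n p : ℕ} (S : LinearSketch n p) (ω : Fin S.numSeeds)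
    (us : List (Update n p)) : Fin S.numCounters → ℝ :=
  us.foldl (fun x u => x + u.amount • S.column (S.words ω) u.row u.col) 0

/-- The memory in which the query program starts: the stored integers are in integer array `0`, the
counters in real array `0`, the fixed reals in real array `1`, and all else is `0`. -/
def LinearSketch.memory {n p : ℕ} (S : LinearSketch n p) (ω : Fin S.numSeeds)
    (us : List (Update n p)) : State where
  wreg := fun _ => 0
  rreg := fun _ => 0
  warr := fun a t => if h : a = 0 ∧ t < S.numWords then S.words ω ⟨t, h.2⟩ else 0
  rarr := fun a t =>
    if h : a = 0 ∧ t < S.numCounters then S.counters ω us ⟨t, h.2⟩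
    else if h : a = 1 ∧ t < S.numParams then S.params ⟨t, h.2⟩
    else 0

/-- The pair `e` is on the output list of the final state `s`: the list has length `wreg 0`, and its
entry number `t` is the pair of the entries number `t` of the integer arrays `1` and `2`. -/
def Outputs {n : ℕ} (s : State) (e : Fin n × Fin n) : Prop :=
  ∃ t < s.wreg 0, s.warr 1 t = (e.1 : ℕ) ∧ s.warr 2 t = (e.2 : ℕ)

/-- The probability of an event over the random seed of the sketch. -/
def LinearSketch.prob {n p : ℕ} (S : LinearSketch n p) (E : Fin S.numSeeds → Prop) : ℝ :=
  (Nat.card {ω : Fin S.numSeeds // E ω} : ℝ) / (S.numSeeds : ℝ)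

/-! ### The bounds -/

/-- `n^{2θ} (k² + R²/φ²) + n^{3-2θ} / (k²φ² + R²)`. -/
def sizeBound (θ : ℝ) (n k : ℕ) (φ R : ℝ) : ℝ :=
  (n : ℝ) ^ (2 * θ) * ((k : ℝ) ^ 2 + R ^ 2 / φ ^ 2) +
    (n : ℝ) ^ (3 - 2 * θ) * (1 / ((k : ℝ) ^ 2 * φ ^ 2 + R ^ 2))

/-- `n^θ (k + R/φ)`, rounded up. -/
def outerDim (θ : ℝ) (n k : ℕ) (φ R : ℝ) : ℕ :=
  ⌈(n : ℝ) ^ θ * ((k : ℝ) + R / φ)⌉₊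

/-- `n^{2-2θ} / (k²φ² + R²)`, rounded up. -/
def innerDim (θ : ℝ) (n k : ℕ) (φ R : ℝ) : ℕ :=
  ⌈(n : ℝ) ^ (2 - 2 * θ) * (1 / ((k : ℝ) ^ 2 * φ ^ 2 + R ^ 2))⌉₊

end

end CorrOutliers

/-!
The centred rows of the matrix, scaled to norm one, are unit vectors `x i` whose Gram matrix is the
correlation matrix `C` (`sampleCorr_eq_dot`). A linear sketch cannot scale, but it can store the
inner products of the centred rows with random sign vectors, since centring can be moved to the
sign vector (`sum_centered_mul`). Four-wise independence of the signs suffices for all moments that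
are needed; cubic polynomials over a field with `2 ^ m` elements provide such signs with seeds of
`O(log (n + p))` bits (`exists_isFourwise`).

**One trial.** Every row is put on the left side, or on the right side, or, with the largest
probability, is dropped. The rows on a side are hashed into `B` buckets, and the sketches, of
length `r`, of the rows in a bucket are added up with random signs. This makes a `B × r` and an `r
× B` matrix. Up to scaling, the entry of their product in the cell of a pair `(i, j)` is `± r C i
j` plus an error whose second moment is governed by the squared correlations of the other pairs in
the cell and by the sketching error (`expect_cell_deviation_sq`). Random labels make it unlikely
that a given other pair falls into the same cell (`pr_inCell_le`); a pair of large weight must not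
be there at all, the others contribute in expectation. Hence a pair with `φ ≤ |C i j|` dominates
its cell with probability at least the inverse of a polylogarithm (`pr_reveals`). The indices are
read off by repeating the product with the extra sign `-1` for all rows on one side whose index has
a one at a given bit: the sign of the cell changes exactly if that bit is one in the index of the
row of the pair that is on this side (`queryData_output`). The norms of the rows are also estimated
from sketches, and factors that are polylogarithmic on the relevant rows are enough
(`pr_normGood`).

**Heavy rows.** The pairs that share a row with `(i, j)` fall into its cell more often. This harms
if the squared correlation norm `∑ v, C i v ^ 2` of a row exceeds `B φ ^ 2` by more than a
polylogarithm. By the bound on the Frobenius norm at most about `B` rows are like that, and a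
second-moment estimate recognises them with constant probability (`pr_rowEst_good`). In such a
trial the left side is restricted to these rows, and the `r` sketch coordinates are divided into `n
/ B` slots: a row on the right uses one slot only, while a row on the left has a bucket of its own
for each slot. The pairs that share the row `i` with `(i, j)` are thereby spread over the slots,
and the loss in the length of the sketches is made up for by the small number of rows on the left.
So there are three variants of a trial: no row of the pair is heavy (`pr_trialReveals_one_slot`),
the first one is, or the second one is (`pr_trialReveals_slots`); one of them reveals the pair
(`exists_variant`). Polylogarithmically many repetitions and a union bound over the pairs give the
probability `1 - n⁻³` (`correlationSketch_prob`).

**Parameters.** `B` and `r` are the dimensions of the claimed matrix product. All requirements on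
them hold if the claimed size is less than `n ^ 2` by a certain polylogarithmic factor
(`regime_of_le`); otherwise the sketch without counters that lists all pairs is small enough
(`isGoodSketch_allPairsSketch`).

**The machine.** The query program does not depend on the parameters. It interprets lists of
elementary operations (multiply and add two array entries, take an inverse square root, compare,
and so on), which are stored, encoded as integers, along with the seeds (`queryProg_spec`); its
running time is linear in the length of the lists, apart from the cost of the matrix products.
-/

/-! ### Running programs -/

namespace CorrOutliers

/-- Started in `s`, the program `P` halts, in a state and after a time that satisfy `Φ`. -/
def Ends (Mul : ℕ → ℕ → ℕ) (P : Program) (s : State) (Φ : State → ℕ → Prop) : Prop :=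
  ∃ s' t, Exec Mul P s s' t ∧ Φ s' t

theorem Ends.mono {Mul : ℕ → ℕ → ℕ} {P : Program} {s : State} {Φ Ψ : State → ℕ → Prop}
    (h : Ends Mul P s Φ) (H : ∀ s' t, Φ s' t → Ψ s' t) : Ends Mul P s Ψ := by
  obtain ⟨s', t, h1, h2⟩ := h
  exact ⟨s', t, h1, H _ _ h2⟩

theorem Ends.skip {Mul : ℕ → ℕ → ℕ} {s : State} {Φ : State → ℕ → Prop} (h : Φ s 0) :
    Ends Mul .skip s Φ := ⟨s, 0, .skip s, h⟩

theorem Ends.step {Mul : ℕ → ℕ → ℕ} {c : Instr} {s : State} {Φ : State → ℕ → Prop}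
    (h : Φ (c.run s) (c.cost Mul s)) : Ends Mul (.step c) s Φ := ⟨_, _, .step c s, h⟩

theorem Ends.seq {Mul : ℕ → ℕ → ℕ} {P Q : Program} {s : State} {Φ : State → ℕ → Prop}
    (h : Ends Mul P s fun s₁ t₁ => Ends Mul Q s₁ fun s₂ t₂ => Φ s₂ (t₁ + t₂)) :
    Ends Mul (.seq P Q) s Φ := by
  obtain ⟨s₁, t₁, h₁, s₂, t₂, h₂, h⟩ := h
  exact ⟨s₂, _, .seq h₁ h₂, h⟩

theorem Ends.ifReal {Mul : ℕ → ℕ → ℕ} {a b : ℕ} {P Q : Program} {s : State}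
    {Φ : State → ℕ → Prop}
    (h₁ : s.rreg a < s.rreg b → Ends Mul P s fun s' t => Φ s' (t + 1))
    (h₂ : ¬ s.rreg a < s.rreg b → Ends Mul Q s fun s' t => Φ s' (t + 1)) :
    Ends Mul (.ifReal a b P Q) s Φ := by
  by_cases hc : s.rreg a < s.rreg b
  · obtain ⟨s', t, h, h'⟩ := h₁ hc
    exact ⟨s', _, .ifReal_true hc h, h'⟩
  · obtain ⟨s', t, h, h'⟩ := h₂ hc
    exact ⟨s', _, .ifReal_false hc h, h'⟩

/-- A program that consists of a list of instructions. -/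
def block : List Instr → Program
  | [] => .skip
  | c :: cs => .seq (.step c) (block cs)

theorem Ends.block_nil {Mul : ℕ → ℕ → ℕ} {s : State} {Φ : State → ℕ → Prop} (h : Φ s 0) :
    Ends Mul (block []) s Φ := Ends.skip h

theorem Ends.block_cons {Mul : ℕ → ℕ → ℕ} {c : Instr} {cs : List Instr} {s : State}
    {Φ : State → ℕ → Prop}
    (h : Ends Mul (block cs) (c.run s) fun s' t => Φ s' (c.cost Mul s + t)) :
    Ends Mul (block (c :: cs)) s Φ := Ends.seq (Ends.step h)

/-! ### Programs that consume a stream of stored integers -/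

/-- The part of the memory that the phases of the query work on: the number of output pairs, the
integer arrays and the real arrays. -/
structure Mem where
  out : ℕ
  words : ℕ → ℕ → ℕ
  reals : ℕ → ℕ → ℝ

/-- The entries of `f` from position `ptr` on are those of the list `l`. -/
def Holds (f : ℕ → ℕ) (ptr : ℕ) (l : List ℕ) : Prop :=
  ∀ k (h : k < l.length), f (ptr + k) = l[k]

theorem holds_nil (f : ℕ → ℕ) (ptr : ℕ) : Holds f ptr [] := fun k h => by simp at h

theorem holds_cons {f : ℕ → ℕ} {ptr a : ℕ} {l : List ℕ} :
    Holds f ptr (a :: l) ↔ f ptr = a ∧ Holds f (ptr + 1) l := by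
  constructor
  · intro h
    refine ⟨h 0 (by simp), fun k hk => ?_⟩
    have := h (k + 1) (by simpa using hk)
    rw [show ptr + 1 + k = ptr + (k + 1) by ring]
    simpa using this
  · rintro ⟨h0, h⟩ k hk
    cases k with
    | zero => simpa using h0
    | succ k =>
      have := h k (by simpa using hk)
      rw [show ptr + 1 + k = ptr + (k + 1) by ring] at this
      simpa using this

theorem holds_append {f : ℕ → ℕ} {ptr : ℕ} {l₁ l₂ : List ℕ} :
    Holds f ptr (l₁ ++ l₂) ↔ Holds f ptr l₁ ∧ Holds f (ptr + l₁.length) l₂ := by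
  induction l₁ generalizing ptr with
  | nil => simp [holds_nil]
  | cons a l ih =>
    rw [List.cons_append, holds_cons, holds_cons, ih, List.length_cons, and_assoc,
      show ptr + (l.length + 1) = ptr + 1 + l.length by ring]

/-- The relevant contents of a state: register `0` holds the number of output pairs, register `1`
the position reached in the stream (integer array `0`), register `2` the constant `1`. -/
structure Core (s : State) (ptr : ℕ) (m : Mem) : Prop where
  out : s.wreg 0 = m.out
  ptr : s.wreg 1 = ptr
  one : s.wreg 2 = 1
  words : s.warr = m.words
  reals : s.rarr = m.reals

/-- `P` reads an item `x`, encoded as `enc x`, from the stream and changes the memory by `eff x`. It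
does not touch the integer registers from number `h` on, and needs time linear in the length of
the item, apart from the cost `mul` of multiplying matrices. The number of output pairs grows by
at most one per step. The slack of `2` in the time pays for the loop that repeats `P`: one test and
one increment per round. -/
def Reads {α : Type*} (h : ℕ) (P : Program) (enc : α → List ℕ) (eff : α → Mem → Mem)
    (mul : (ℕ → ℕ → ℕ) → α → ℕ) : Prop :=
  ∀ Mul s x m ptr, Core s ptr m → Holds (m.words 0) ptr (enc x) →
    Ends Mul P s fun s' t => Core s' (ptr + (enc x).length) (eff x m) ∧
      (∀ z, h ≤ z → s'.wreg z = s.wreg z) ∧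
      t + 2 ≤ 40 * (enc x).length + mul Mul x ∧
      (eff x m).out ≤ m.out + t ∧ (eff x m).words 0 = m.words 0

theorem Reads.seq {α β : Type*} {h : ℕ} {P Q : Program} {encA : α → List ℕ} {encB : β → List ℕ}
    {effA : α → Mem → Mem} {effB : β → Mem → Mem} {mulA : (ℕ → ℕ → ℕ) → α → ℕ}
    {mulB : (ℕ → ℕ → ℕ) → β → ℕ} (hP : Reads h P encA effA mulA) (hQ : Reads h Q encB effB mulB) :
    Reads h (.seq P Q) (fun x : α × β => encA x.1 ++ encB x.2)
      (fun x m => effB x.2 (effA x.1 m)) (fun Mul x => mulA Mul x.1 + mulB Mul x.2) := by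
  intro Mul s x m ptr hc hh
  rw [holds_append] at hh
  refine Ends.seq ((hP Mul s x.1 m ptr hc hh.1).mono ?_)
  rintro s₁ t₁ ⟨hc₁, hf₁, ht₁, ho₁, hw₁⟩
  refine (hQ Mul s₁ x.2 _ _ hc₁ (by rw [hw₁]; exact hh.2)).mono ?_
  rintro s₂ t₂ ⟨hc₂, hf₂, ht₂, ho₂, hw₂⟩
  refine ⟨by simpa [add_assoc] using hc₂, fun z hz => (hf₂ z hz).trans (hf₁ z hz), ?_, ?_,
    hw₂.trans hw₁⟩
  · simp only [List.length_append]; omega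
  · simp only; omega

/-- The instructions that read the next stored integer of the stream into register `d`. -/
def readWord (d : ℕ) : List Instr := [.wload d 0 1, .wadd 1 1 2]

/-- Reads a number `N` from the stream and executes the body `N` times. -/
def forLoop (h : ℕ) (P : Program) : Program :=
  .seq (block (readWord (h + 1) ++ [.wconst h 0]))
    (.loop h (h + 1) (.seq P (.step (.wadd h h 2))))

/-- The encoding of a list: its length, followed by the encodings of the members. -/
def encList {α : Type*} (enc : α → List ℕ) (l : List α) : List ℕ := l.length :: l.flatMap enc

theorem forLoop_aux {α : Type*} {h : ℕ} (hh : 3 ≤ h) {P : Program} {enc : α → List ℕ}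
    {eff : α → Mem → Mem} {mul : (ℕ → ℕ → ℕ) → α → ℕ} (hP : Reads h P enc eff mul)
    (Mul : ℕ → ℕ → ℕ) (l : List α) (s : State) (m : Mem) (ptr : ℕ) (hc : Core s ptr m)
    (hl : Holds (m.words 0) ptr (l.flatMap enc)) (hN : s.wreg (h + 1) = s.wreg h + l.length) :
    Ends Mul (.loop h (h + 1) (.seq P (.step (.wadd h h 2)))) s fun s' t =>
      Core s' (ptr + (l.flatMap enc).length) (l.foldl (fun m x => eff x m) m) ∧
      (∀ z, h + 2 ≤ z → s'.wreg z = s.wreg z) ∧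
      t ≤ 40 * (l.flatMap enc).length + (l.map (mul Mul)).sum + 1 ∧
      (l.foldl (fun m x => eff x m) m).out ≤ m.out + t ∧
      (l.foldl (fun m x => eff x m) m).words 0 = m.words 0 := by
  induction l generalizing s m ptr with
  | nil =>
    refine ⟨s, 1, .loop_false (by simp [hN]), ?_⟩
    simpa using hc
  | cons x l ih =>
    rw [List.flatMap_cons, holds_append] at hl
    rw [List.length_cons] at hN
    obtain ⟨s₁, t₁, he₁, hc₁, hf₁, ht₁, ho₁, hw₁⟩ := hP Mul s x m ptr hc hl.1
    have hc' : Core ((Instr.wadd h h 2).run s₁) (ptr + (enc x).length) (eff x m) := by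
      constructor
      · simpa [Instr.run, State.setW, Function.update_apply, show (0 : ℕ) ≠ h by omega]
          using hc₁.out
      · simpa [Instr.run, State.setW, Function.update_apply, show (1 : ℕ) ≠ h by omega]
          using hc₁.ptr
      · simpa [Instr.run, State.setW, Function.update_apply, show (2 : ℕ) ≠ h by omega]
          using hc₁.one
      · simpa [Instr.run, State.setW] using hc₁.words
      · simpa [Instr.run, State.setW] using hc₁.reals
    have hz : ∀ z, h < z → ((Instr.wadd h h 2).run s₁).wreg z = s.wreg z := by
      intro z hz
      simpa [Instr.run, State.setW, Function.update_apply, show z ≠ h by omega]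
        using hf₁ z hz.le
    have hN' : ((Instr.wadd h h 2).run s₁).wreg (h + 1)
        = ((Instr.wadd h h 2).run s₁).wreg h + l.length := by
      rw [hz _ (by omega), hN]
      simp [Instr.run, State.setW, hf₁ h le_rfl, hc₁.one]
      omega
    obtain ⟨s₂, t₂, he₂, hc₂, hf₂, ht₂, ho₂, hw₂⟩ :=
      ih _ _ _ hc' (by rw [hw₁]; exact hl.2) hN'
    refine ⟨s₂, _, .loop_true (by omega) (.seq he₁ (.step _ _)) he₂, ?_, ?_, ?_, ?_, ?_⟩
    · simpa [add_assoc] using hc₂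
    · intro z hz'
      rw [hf₂ z hz', hz z (by omega)]
    · simp only [List.flatMap_cons, List.length_append, List.map_cons, List.sum_cons, Instr.cost]
      omega
    · simp only [List.foldl_cons, Instr.cost]
      omega
    · simpa using hw₂.trans hw₁

theorem Reads.forLoop {α : Type*} {h : ℕ} (hh : 3 ≤ h) {P : Program} {enc : α → List ℕ}
    {eff : α → Mem → Mem} {mul : (ℕ → ℕ → ℕ) → α → ℕ} (hP : Reads h P enc eff mul) :
    Reads (h + 2) (forLoop h P) (encList enc) (fun l m => l.foldl (fun m x => eff x m) m)
      (fun Mul l => (l.map (mul Mul)).sum) := by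
  intro Mul s l m ptr hc hl
  rw [encList, holds_cons] at hl
  refine Ends.seq ?_
  simp only [readWord, List.cons_append, List.nil_append]
  refine Ends.block_cons (Ends.block_cons (Ends.block_cons (Ends.block_nil ?_)))
  set s₁ := (Instr.wconst h 0).run ((Instr.wadd 1 1 2).run ((Instr.wload (h + 1) 0 1).run s))
    with hs₁
  have h0 : (0 : ℕ) ≠ h := by omega
  have h1 : (1 : ℕ) ≠ h := by omega
  have h2 : (2 : ℕ) ≠ h := by omega
  have h0' : h ≠ 0 := by omega
  have h1' : h ≠ 1 := by omega
  have hc₁ : Core s₁ (ptr + 1) m := by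
    constructor
    · simpa [hs₁, Instr.run, State.setW, Function.update_apply, h0] using hc.out
    · simp [hs₁, Instr.run, State.setW, h1, h0', h1', hc.ptr, hc.one]
    · simpa [hs₁, Instr.run, State.setW, Function.update_apply, h2, h1'] using hc.one
    · simpa [hs₁, Instr.run, State.setW] using hc.words
    · simpa [hs₁, Instr.run, State.setW] using hc.reals
  have hN : s₁.wreg (h + 1) = s₁.wreg h + l.length := by
    simp [hs₁, Instr.run, State.setW, Function.update_apply, hc.ptr, hc.words, hl.1]
    omega
  refine (forLoop_aux hh hP Mul l s₁ m (ptr + 1) hc₁ hl.2 hN).mono ?_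
  rintro s₂ t₂ ⟨hc₂, hf₂, ht₂, ho₂, hw₂⟩
  refine ⟨by simpa [encList, add_assoc, add_comm, add_left_comm] using hc₂, ?_, ?_, ?_, hw₂⟩
  · intro z hz
    rw [hf₂ z hz]
    simp [hs₁, Instr.run, State.setW, Function.update_apply, show z ≠ h by omega,
      show z ≠ h + 1 by omega, show z ≠ 1 by omega]
  · simp only [encList, List.length_cons, Instr.cost]; omega
  · omega

/-! ### The phases of the query -/

/-! Each elementary operation of the query is a program `…Prog` that reads the operands, mostly
positions in arrays, from the stream. The function `…Eff` gives its effect on the memory. -/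

/-- Write `v` into position `i` of array `A`. -/
def setAt {V : Type*} (f : ℕ → ℕ → V) (A i : ℕ) (v : V) : ℕ → ℕ → V :=
  Function.update f A (Function.update (f A) i v)

/-- Appends a pair to the output. -/
def emitProg : Program :=
  block (readWord 3 ++ readWord 4 ++ [.wstore 1 0 3, .wstore 2 0 4, .wadd 0 0 2])

def emitEff (x : ℕ × ℕ) (m : Mem) : Mem :=
  ⟨m.out + 1, setAt (setAt m.words 1 m.out x.1) 2 m.out x.2, m.reals⟩

/-- Adds the product of an entry of array `A` and an entry of array `B` to an entry of array `D`. -/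
def mulAddProg (D A B : ℕ) : Program :=
  block (readWord 3 ++ readWord 4 ++ readWord 5 ++
    [.rload 0 A 4, .rload 1 B 5, .rmul 0 0 1, .rload 1 D 3, .radd 0 1 0, .rstore D 3 0])

def mulAddEff (D A B : ℕ) (x : ℕ × ℕ × ℕ) (m : Mem) : Mem :=
  ⟨m.out, m.words,
    setAt m.reals D x.1 (m.reals D x.1 + m.reals A x.2.1 * m.reals B x.2.2)⟩

/-- Copies an entry of array `A` into array `D`. -/
def copyProg (D A : ℕ) : Program :=
  block (readWord 3 ++ readWord 4 ++ [.rload 0 A 4, .rstore D 3 0])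

def copyEff (D A : ℕ) (x : ℕ × ℕ) (m : Mem) : Mem :=
  ⟨m.out, m.words, setAt m.reals D x.1 (m.reals A x.2)⟩

/-- Writes the inverse square root of an entry of array `2` into array `3`. -/
def invSqrtProg : Program :=
  block (readWord 3 ++ [.rload 0 2 3, .rsqrt 0 0, .rconst 1 1, .rdiv 0 1 0, .rstore 3 3 0])

noncomputable def invSqrtEff (x : ℕ) (m : Mem) : Mem :=
  ⟨m.out, m.words, setAt m.reals 3 x (1 / Real.sqrt (m.reals 2 x))⟩

/-- Writes `0` or `1` into array `7`, as the square of an entry of array `6` is below an entry of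
array `1` or not. -/
def maskProg : Program :=
  .seq (block (readWord 3 ++ readWord 4 ++ [.rload 0 6 3, .rmul 0 0 0, .rload 1 1 4]))
    (.seq (.ifReal 0 1 (block [.rconst 2 0]) (block [.rconst 2 1])) (block [.rstore 7 3 2]))

noncomputable def maskEff (x : ℕ × ℕ) (m : Mem) : Mem :=
  ⟨m.out, m.words,
    setAt m.reals 7 x.1 (if m.reals 6 x.1 * m.reals 6 x.1 < m.reals 1 x.2 then 0 else 1)⟩

/-- Multiplies the matrices in the arrays `11` and `12`; the product goes to array `13`. -/
def matmulProg : Program := block (readWord 3 ++ readWord 4 ++ [.matmul 13 11 12 3 4])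

noncomputable def matmulEff (x : ℕ × ℕ) (m : Mem) : Mem :=
  ⟨m.out, m.words,
    Function.update m.reals 13 (mulArr x.1 x.2 (m.reals 11) (m.reals 12) (m.reals 13))⟩

/-- If two entries of array `14` have a negative product, increases the two numbers of an output
pair. The item consists of the positions of the entries, the position in the output, and the two
increments. -/
def compareProg : Program :=
  .seq (block (readWord 3 ++ readWord 4 ++ readWord 5 ++ readWord 6 ++ readWord 7 ++
      [.rload 0 14 3, .rload 1 14 4, .rmul 0 0 1, .rconst 1 0]))
    (.ifReal 0 1
      (block [.wload 8 1 5, .wadd 8 8 6, .wstore 1 5 8, .wload 8 2 5, .wadd 8 8 7, .wstore 2 5 8])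
      .skip)

noncomputable def compareEff (x : ℕ × ℕ × ℕ × ℕ × ℕ) (m : Mem) : Mem :=
  ⟨m.out, if m.reals 14 x.1 * m.reals 14 x.2.1 < 0 then
      setAt (setAt m.words 1 x.2.2.1 (m.words 1 x.2.2.1 + x.2.2.2.1)) 2 x.2.2.1
        (m.words 2 x.2.2.1 + x.2.2.2.2)
    else m.words, m.reals⟩

/-! The encodings of the operands of an operation as stored integers. -/

def enc2 (x : ℕ × ℕ) : List ℕ := [x.1, x.2]
def enc3 (x : ℕ × ℕ × ℕ) : List ℕ := [x.1, x.2.1, x.2.2]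
def enc5 (x : ℕ × ℕ × ℕ × ℕ × ℕ) : List ℕ := [x.1, x.2.1, x.2.2.1, x.2.2.2.1, x.2.2.2.2]

theorem reads_emit : Reads 9 emitProg enc2 emitEff (fun _ _ => 0) := by
  intro Mul s x m ptr hc hh
  simp only [enc2, holds_cons] at hh
  obtain ⟨ha, hb, -⟩ := hh
  simp only [emitProg, readWord, List.cons_append, List.nil_append]
  iterate 7 refine Ends.block_cons ?_
  refine Ends.block_nil ⟨⟨?_, ?_, ?_, ?_, ?_⟩, fun z hz => ?_, ?_, ?_, ?_⟩
  · simp [Instr.run, State.setW, State.setWA, hc.out, hc.one, emitEff]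
  · simp [Instr.run, State.setW, State.setWA, hc.ptr, hc.one, enc2]
  · simp [Instr.run, State.setW, State.setWA, hc.one]
  · simp [Instr.run, State.setW, State.setWA, hc.out, hc.one, hc.ptr,
      hc.words, ha, hb, emitEff, setAt]
  · simp [Instr.run, State.setW, State.setWA, hc.reals, emitEff]
  · simp [Instr.run, State.setW, State.setWA, show z ≠ 0 by omega,
      show z ≠ 1 by omega, show z ≠ 3 by omega, show z ≠ 4 by omega]
  · simp [Instr.cost, enc2]
  · simp [Instr.cost, emitEff]
  · simp [emitEff, setAt]

theorem reads_mulAdd (D A B : ℕ) :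
    Reads 9 (mulAddProg D A B) enc3 (mulAddEff D A B) (fun _ _ => 0) := by
  intro Mul s x m ptr hc hh
  simp only [enc3, holds_cons] at hh
  obtain ⟨ha, hb, hb', -⟩ := hh
  simp only [mulAddProg, readWord, List.cons_append, List.nil_append]
  iterate 12 refine Ends.block_cons ?_
  refine Ends.block_nil ⟨⟨?_, ?_, ?_, ?_, ?_⟩, fun z hz => ?_, ?_, ?_, ?_⟩
  · simp [Instr.run, State.setW, State.setR, State.setRA, hc.out, mulAddEff]
  · simp [Instr.run, State.setW, State.setR, State.setRA, hc.ptr, hc.one,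
      enc3]
  · simp [Instr.run, State.setW, State.setR, State.setRA, hc.one]
  · simp [Instr.run, State.setW, State.setR, State.setRA, hc.words, mulAddEff]
  · simp [Instr.run, State.setW, State.setR, State.setRA, hc.one, hc.ptr,
      hc.words, hc.reals, ha, hb, hb', mulAddEff, setAt]
  · simp [Instr.run, State.setW, State.setR, State.setRA, show z ≠ 1 by omega,
      show z ≠ 3 by omega, show z ≠ 4 by omega, show z ≠ 5 by omega]
  · simp [Instr.cost, enc3]
  · simp [mulAddEff]
  · simp [mulAddEff]

theorem reads_copy (D A : ℕ) : Reads 9 (copyProg D A) enc2 (copyEff D A) (fun _ _ => 0) := by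
  intro Mul s x m ptr hc hh
  simp only [enc2, holds_cons] at hh
  obtain ⟨ha, hb, -⟩ := hh
  simp only [copyProg, readWord, List.cons_append, List.nil_append]
  iterate 6 refine Ends.block_cons ?_
  refine Ends.block_nil ⟨⟨?_, ?_, ?_, ?_, ?_⟩, fun z hz => ?_, ?_, ?_, ?_⟩
  · simp [Instr.run, State.setW, State.setR, State.setRA, hc.out, copyEff]
  · simp [Instr.run, State.setW, State.setR, State.setRA, hc.ptr, hc.one,
      enc2]
  · simp [Instr.run, State.setW, State.setR, State.setRA, hc.one]
  · simp [Instr.run, State.setW, State.setR, State.setRA, hc.words, copyEff]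
  · simp [Instr.run, State.setW, State.setR, State.setRA, hc.one, hc.ptr,
      hc.words, hc.reals, ha, hb, copyEff, setAt]
  · simp [Instr.run, State.setW, State.setR, State.setRA, show z ≠ 1 by omega,
      show z ≠ 3 by omega, show z ≠ 4 by omega]
  · simp [Instr.cost, enc2]
  · simp [copyEff]
  · simp [copyEff]

theorem reads_invSqrt : Reads 9 invSqrtProg (fun x => [x]) invSqrtEff (fun _ _ => 0) := by
  intro Mul s x m ptr hc hh
  simp only [holds_cons] at hh
  obtain ⟨ha, -⟩ := hh
  simp only [invSqrtProg, readWord, List.cons_append, List.nil_append]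
  iterate 7 refine Ends.block_cons ?_
  refine Ends.block_nil ⟨⟨?_, ?_, ?_, ?_, ?_⟩, fun z hz => ?_, ?_, ?_, ?_⟩
  · simp [Instr.run, State.setW, State.setR, State.setRA, hc.out, invSqrtEff]
  · simp [Instr.run, State.setW, State.setR, State.setRA, hc.ptr, hc.one]
  · simp [Instr.run, State.setW, State.setR, State.setRA, hc.one]
  · simp [Instr.run, State.setW, State.setR, State.setRA, hc.words, invSqrtEff]
  · simp [Instr.run, State.setW, State.setR, State.setRA, hc.ptr,
      hc.words, hc.reals, ha, invSqrtEff, setAt]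
  · simp [Instr.run, State.setW, State.setR, State.setRA, show z ≠ 1 by omega,
      show z ≠ 3 by omega]
  · simp [Instr.cost]
  · simp [invSqrtEff]
  · simp [invSqrtEff]

theorem reads_mask : Reads 9 maskProg enc2 maskEff (fun _ _ => 0) := by
  intro Mul s x m ptr hc hh
  simp only [enc2, holds_cons] at hh
  obtain ⟨ha, hb, -⟩ := hh
  simp only [maskProg, readWord, List.cons_append, List.nil_append]
  refine Ends.seq ?_
  iterate 7 refine Ends.block_cons ?_
  refine Ends.block_nil (Ends.seq (Ends.ifReal (fun hlt => ?_) fun hlt => ?_)) <;>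
  · refine Ends.block_cons (Ends.block_nil (Ends.block_cons (Ends.block_nil ?_)))
    simp [Instr.run, State.setW, State.setR, hc.one, hc.ptr,
      hc.words, hc.reals, ha, hb] at hlt
    refine ⟨⟨?_, ?_, ?_, ?_, ?_⟩, fun z hz => ?_, ?_, ?_, ?_⟩
    · simp [Instr.run, State.setW, State.setR, State.setRA, hc.out, maskEff]
    · simp [Instr.run, State.setW, State.setR, State.setRA, hc.ptr, hc.one,
        enc2]
    · simp [Instr.run, State.setW, State.setR, State.setRA, hc.one]
    · simp [Instr.run, State.setW, State.setR, State.setRA, hc.words, maskEff]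
    · simp [Instr.run, State.setW, State.setR, State.setRA, hc.one, hc.ptr,
        hc.words, hc.reals, ha, hb, maskEff, setAt, hlt] <;>
      rw [if_neg (not_lt.2 hlt)]
    · simp [Instr.run, State.setW, State.setR, State.setRA, show z ≠ 1 by omega,
        show z ≠ 3 by omega, show z ≠ 4 by omega]
    · simp [Instr.cost, enc2]
    · simp [maskEff]
    · simp [maskEff]

theorem reads_matmul : Reads 9 matmulProg enc2 matmulEff (fun Mul x => Mul x.1 x.2) := by
  intro Mul s x m ptr hc hh
  simp only [enc2, holds_cons] at hh
  obtain ⟨ha, hb, -⟩ := hh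
  simp only [matmulProg, readWord, List.cons_append, List.nil_append]
  iterate 5 refine Ends.block_cons ?_
  refine Ends.block_nil ⟨⟨?_, ?_, ?_, ?_, ?_⟩, fun z hz => ?_, ?_, ?_, ?_⟩
  · simp [Instr.run, State.setW, hc.out, matmulEff]
  · simp [Instr.run, State.setW, hc.ptr, hc.one, enc2]
  · simp [Instr.run, State.setW, hc.one]
  · simp [Instr.run, State.setW, hc.words, matmulEff]
  · simp [Instr.run, State.setW, hc.one, hc.ptr,
      hc.words, hc.reals, ha, hb, matmulEff]
  · simp [Instr.run, State.setW, show z ≠ 1 by omega, show z ≠ 3 by omega, show z ≠ 4 by omega]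
  · simp [Instr.cost, enc2, Instr.run, State.setW, hc.one, hc.ptr,
      hc.words, ha, hb]
    omega
  · simp [matmulEff]
  · simp [matmulEff]

theorem reads_compare : Reads 9 compareProg enc5 compareEff (fun _ _ => 0) := by
  intro Mul s x m ptr hc hh
  simp only [enc5, holds_cons] at hh
  obtain ⟨h1, h2, h3, h4, h5, -⟩ := hh
  simp only [compareProg, readWord, List.cons_append, List.nil_append]
  refine Ends.seq ?_
  iterate 14 refine Ends.block_cons ?_
  refine Ends.block_nil (Ends.ifReal (fun hlt => ?_) fun hlt => ?_)
  · iterate 6 refine Ends.block_cons ?_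
    simp [Instr.run, State.setW, State.setR, hc.one, hc.ptr,
      hc.words, hc.reals, h1, h2] at hlt
    refine Ends.block_nil ⟨⟨?_, ?_, ?_, ?_, ?_⟩, fun z hz => ?_, ?_, ?_, ?_⟩
    · simp [Instr.run, State.setW, State.setR, State.setWA, hc.out,
        compareEff]
    · simp [Instr.run, State.setW, State.setR, State.setWA, hc.ptr, hc.one,
        enc5]
    · simp [Instr.run, State.setW, State.setR, State.setWA, hc.one]
    · simp [Instr.run, State.setW, State.setR, State.setWA, hc.one, hc.ptr,
        hc.words, h3, h4, h5, compareEff, setAt, hlt]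
    · simp [Instr.run, State.setW, State.setR, State.setWA, hc.reals, compareEff]
    · simp [Instr.run, State.setW, State.setR, State.setWA, show z ≠ 1 by omega,
        show z ≠ 3 by omega, show z ≠ 4 by omega, show z ≠ 5 by omega, show z ≠ 6 by omega,
        show z ≠ 7 by omega, show z ≠ 8 by omega]
    · simp [Instr.cost, enc5]
    · simp [compareEff]
    · simp [compareEff, hlt, setAt]
  · simp [Instr.run, State.setW, State.setR, hc.one, hc.ptr,
      hc.words, hc.reals, h1, h2] at hlt
    refine Ends.skip ⟨⟨?_, ?_, ?_, ?_, ?_⟩, fun z hz => ?_, ?_, ?_, ?_⟩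
    · simp [Instr.run, State.setW, State.setR, hc.out, compareEff]
    · simp [Instr.run, State.setW, State.setR, hc.ptr, hc.one, enc5]
    · simp [Instr.run, State.setW, State.setR, hc.one]
    · simp [Instr.run, State.setW, State.setR, hc.words, compareEff, not_lt.2 hlt]
    · simp [Instr.run, State.setW, State.setR, hc.reals, compareEff]
    · simp [Instr.run, State.setW, State.setR, show z ≠ 1 by omega, show z ≠ 3 by omega,
        show z ≠ 4 by omega, show z ≠ 5 by omega, show z ≠ 6 by omega, show z ≠ 7 by omega]
    · simp [Instr.cost, enc5]
    · simp [compareEff]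
    · simp [compareEff, not_lt.2 hlt]

/-! ### The query program -/

theorem Reads.weaken {α : Type*} {h h' : ℕ} (hh : h ≤ h') {P : Program} {enc : α → List ℕ}
    {eff : α → Mem → Mem} {mul : (ℕ → ℕ → ℕ) → α → ℕ} (hP : Reads h P enc eff mul) :
    Reads h' P enc eff mul := fun Mul s x m ptr hc hl =>
  (hP Mul s x m ptr hc hl).mono fun _ _ H => ⟨H.1, fun z hz => H.2.1 z (hh.trans hz), H.2.2⟩

/-- The data of one matrix multiplication: the entries to be copied into the two factors, the
dimensions, and the entries of the product to be copied out. -/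
structure RoundData where
  left : List (ℕ × ℕ)
  right : List (ℕ × ℕ)
  dims : ℕ × ℕ
  prod : List (ℕ × ℕ)

/-- The encoding of the data of one multiplication as stored integers. -/
def RoundData.enc (d : RoundData) : List ℕ :=
  encList enc2 d.left ++ (encList enc2 d.right ++ (enc2 d.dims ++ encList enc2 d.prod))

/-- The effect of one multiplication: the factors are copied from the arrays `9` and `10` to the
arrays `11` and `12`, and the product from the array `13` to the array `14`. -/
noncomputable def RoundData.eff (d : RoundData) (m : Mem) : Mem :=
  d.prod.foldl (fun m x => copyEff 14 13 x m) (matmulEff d.dims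
    (d.right.foldl (fun m x => copyEff 12 10 x m) (d.left.foldl (fun m x => copyEff 11 9 x m) m)))

/-- The program for one multiplication. -/
def roundProg : Program :=
  .seq (forLoop 9 (copyProg 11 9)) (.seq (forLoop 9 (copyProg 12 10))
    (.seq matmulProg (forLoop 9 (copyProg 14 13))))

theorem reads_round : Reads 11 roundProg RoundData.enc RoundData.eff
    (fun Mul d => Mul d.dims.1 d.dims.2) := by
  intro Mul s d m ptr hc hl
  have h := ((reads_copy 11 9).forLoop (by norm_num)).seq (((reads_copy 12 10).forLoop
    (by norm_num)).seq ((reads_matmul.weaken (by norm_num)).seq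
      ((reads_copy 14 13).forLoop (by norm_num))))
  refine (h Mul s (d.left, d.right, d.dims, d.prod) m ptr hc hl).mono ?_
  rintro s' t ⟨h1, h2, h3, h4, h5⟩
  refine ⟨h1, h2, ?_, h4, h5⟩
  simpa [RoundData.enc] using h3

/-- The data that the query reads from the stored integers: for each phase, the list of its
operations. The first phase appends pairs to the output. The others work on the real arrays, where
array `0` holds the counters and array `1` the fixed reals. They compute the squared norms (array
`2`), the inverse norms (`3`), the scaled sketches (`4`), the sums of these with random signs (`5`),
the estimates of the correlation norms of the rows (`6`), which of these reach the threshold (`7`),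
the sketches of the rows that do (`8`), the left and the right factors of all products (`9` and
`10`), and the products (`14`), one after the other by way of the arrays `11`, `12` and `13`. The
last phase compares signs of the products and increases the entries of the output pairs. -/
structure QueryData where
  init : List (ℕ × ℕ)
  norm : List (ℕ × ℕ × ℕ)
  invSqrt : List ℕ
  scale : List (ℕ × ℕ × ℕ)
  signSum : List (ℕ × ℕ × ℕ)
  estimate : List (ℕ × ℕ × ℕ)
  mask : List (ℕ × ℕ)
  masked : List (ℕ × ℕ × ℕ)
  left : List (ℕ × ℕ × ℕ)
  right : List (ℕ × ℕ × ℕ)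
  rounds : List RoundData
  compare : List (ℕ × ℕ × ℕ × ℕ × ℕ)

/-- The encoding of the data of the query as stored integers. -/
def QueryData.enc (d : QueryData) : List ℕ :=
  encList enc2 d.init ++ (encList enc3 d.norm ++ (encList (fun x => [x]) d.invSqrt ++
    (encList enc3 d.scale ++ (encList enc3 d.signSum ++ (encList enc3 d.estimate ++
      (encList enc2 d.mask ++ (encList enc3 d.masked ++ (encList enc3 d.left ++
        (encList enc3 d.right ++ (encList RoundData.enc d.rounds ++
          encList enc5 d.compare))))))))))

/-- The effect of all phases. -/
noncomputable def QueryData.eff (d : QueryData) (m : Mem) : Mem :=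
  d.compare.foldl (fun m x => compareEff x m)
    (d.rounds.foldl (fun m x => x.eff m)
      (d.right.foldl (fun m x => mulAddEff 10 4 1 x m)
        (d.left.foldl (fun m x => mulAddEff 9 8 1 x m)
          (d.masked.foldl (fun m x => mulAddEff 8 4 7 x m)
            (d.mask.foldl (fun m x => maskEff x m)
              (d.estimate.foldl (fun m x => mulAddEff 6 4 5 x m)
                (d.signSum.foldl (fun m x => mulAddEff 5 4 1 x m)
                  (d.scale.foldl (fun m x => mulAddEff 4 0 3 x m)
                    (d.invSqrt.foldl (fun m x => invSqrtEff x m)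
                      (d.norm.foldl (fun m x => mulAddEff 2 0 0 x m)
                        (d.init.foldl (fun m x => emitEff x m) m)))))))))))

/-- The program for all phases. -/
def phasesProg : Program :=
  .seq (forLoop 9 emitProg) (.seq (forLoop 9 (mulAddProg 2 0 0)) (.seq (forLoop 9 invSqrtProg)
    (.seq (forLoop 9 (mulAddProg 4 0 3)) (.seq (forLoop 9 (mulAddProg 5 4 1))
      (.seq (forLoop 9 (mulAddProg 6 4 5)) (.seq (forLoop 9 maskProg)
        (.seq (forLoop 9 (mulAddProg 8 4 7)) (.seq (forLoop 9 (mulAddProg 9 8 1))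
          (.seq (forLoop 9 (mulAddProg 10 4 1)) (.seq (forLoop 11 roundProg)
            (forLoop 9 compareProg)))))))))))

/-- The query program. The first stored integer is the position at which the data of the phases
begin. -/
def queryProg : Program :=
  .seq (block [.wconst 2 1, .wload 1 0 0]) phasesProg

theorem reads_phases : Reads 13 phasesProg QueryData.enc QueryData.eff
    (fun Mul d => (d.rounds.map fun x => Mul x.dims.1 x.dims.2).sum) := by
  intro Mul s d m ptr hc hl
  have w : ∀ {α : Type} {P : Program} {enc : α → List ℕ} {eff : α → Mem → Mem}
      {mul : (ℕ → ℕ → ℕ) → α → ℕ}, Reads 9 P enc eff mul → Reads 13 (forLoop 9 P) (encList enc)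
      (fun l m => l.foldl (fun m x => eff x m) m) (fun Mul l => (l.map (mul Mul)).sum) :=
    fun h => (h.forLoop (by norm_num)).weaken (by norm_num)
  have h := (w reads_emit).seq ((w (reads_mulAdd 2 0 0)).seq ((w reads_invSqrt).seq
    ((w (reads_mulAdd 4 0 3)).seq ((w (reads_mulAdd 5 4 1)).seq ((w (reads_mulAdd 6 4 5)).seq
      ((w reads_mask).seq ((w (reads_mulAdd 8 4 7)).seq ((w (reads_mulAdd 9 8 1)).seq
        ((w (reads_mulAdd 10 4 1)).seq ((reads_round.forLoop (by norm_num)).seq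
          (w reads_compare)))))))))))
  refine (h Mul s (d.init, d.norm, d.invSqrt, d.scale, d.signSum, d.estimate, d.mask, d.masked,
    d.left, d.right, d.rounds, d.compare) m ptr hc hl).mono ?_
  rintro s' t ⟨h1, h2, h3, h4, h5⟩
  refine ⟨h1, h2, ?_, h4, h5⟩
  simpa [QueryData.enc] using h3

/-- The query program interprets the data `d` in its stored integers: its effect is `d.eff`, and its
running time is linear in the length of the data, apart from the matrix multiplications. -/
theorem queryProg_spec (Mul : ℕ → ℕ → ℕ) (s : State) (d : QueryData) (h0 : s.wreg 0 = 0)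
    (hd : Holds (s.warr 0) (s.warr 0 0) d.enc) :
    ∃ s' t, Exec Mul queryProg s s' t ∧
      s'.wreg 0 = (d.eff ⟨0, s.warr, s.rarr⟩).out ∧
      s'.warr = (d.eff ⟨0, s.warr, s.rarr⟩).words ∧
      s'.wreg 0 ≤ t ∧
      t ≤ 40 * d.enc.length + (d.rounds.map fun x => Mul x.dims.1 x.dims.2).sum := by
  have hc : Core ((Instr.wload 1 0 0).run ((Instr.wconst 2 1).run s)) (s.warr 0 0)
      ⟨0, s.warr, s.rarr⟩ := by
    constructor <;> simp [Instr.run, State.setW, h0]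
  refine Ends.seq (Ends.block_cons (Ends.block_cons (Ends.block_nil ?_)))
  refine (reads_phases Mul _ d ⟨0, s.warr, s.rarr⟩ _ hc hd).mono ?_
  rintro s' t ⟨h1, h2, h3, h4, h5⟩
  refine ⟨h1.out, h1.words, ?_, ?_⟩
  · rw [h1.out]; simp only [Instr.cost]; simp only at h4; omega
  · simp only [Instr.cost]; simp only at h3; omega

/-! ### The effect of the phases -/

theorem foldl_emit (l : List (ℕ × ℕ)) (m : Mem) :
    (l.foldl (fun m x => emitEff x m) m).out = m.out + l.length ∧
    (l.foldl (fun m x => emitEff x m) m).reals = m.reals ∧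
    (∀ A, A ≠ 1 → A ≠ 2 → (l.foldl (fun m x => emitEff x m) m).words A = m.words A) ∧
    (∀ t, t < m.out → (l.foldl (fun m x => emitEff x m) m).words 1 t = m.words 1 t ∧
      (l.foldl (fun m x => emitEff x m) m).words 2 t = m.words 2 t) ∧
    ∀ (t : ℕ) (ht : t < l.length),
      (l.foldl (fun m x => emitEff x m) m).words 1 (m.out + t) = l[t].1 ∧
      (l.foldl (fun m x => emitEff x m) m).words 2 (m.out + t) = l[t].2 := by
  induction l generalizing m with
  | nil => simp
  | cons x l ih =>
    obtain ⟨h1, h2, h3, h4, h5⟩ := ih (emitEff x m)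
    have e1 : (emitEff x m).out = m.out + 1 := rfl
    simp only [List.foldl_cons]
    refine ⟨?_, h2, ?_, ?_, ?_⟩
    · rw [h1, List.length_cons, e1]; ring
    · intro A hA1 hA2
      rw [h3 A hA1 hA2]
      simp [emitEff, setAt, hA1, hA2]
    · intro t ht
      obtain ⟨ha, hb⟩ := h4 t (by rw [e1]; omega)
      rw [ha, hb]
      simp [emitEff, setAt, ht.ne]
    · intro t ht
      cases t with
      | zero =>
        obtain ⟨ha, hb⟩ := h4 m.out (by rw [e1]; omega)
        simp only [add_zero, List.getElem_cons_zero]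
        rw [ha, hb]
        simp [emitEff, setAt]
      | succ t =>
        have := h5 t (by simpa using ht)
        rw [e1, show m.out + 1 + t = m.out + (t + 1) by ring] at this
        simpa using this

theorem foldl_mulAdd {D A B : ℕ} (hA : A ≠ D) (hB : B ≠ D) (l : List (ℕ × ℕ × ℕ)) (m : Mem) :
    l.foldl (fun m x => mulAddEff D A B x m) m = ⟨m.out, m.words, Function.update m.reals D fun z =>
      m.reals D z +
        (l.map fun x => if x.1 = z then m.reals A x.2.1 * m.reals B x.2.2 else 0).sum⟩ := by
  induction l generalizing m with
  | nil => simp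
  | cons x l ih =>
    rw [List.foldl_cons, ih]
    simp only [mulAddEff, setAt, Function.update_self, Function.update_of_ne hA,
      Function.update_of_ne hB, Function.update_idem, List.map_cons, List.sum_cons]
    congr 2
    funext z
    by_cases hz : x.1 = z
    · subst hz; simp [add_assoc]
    · simp [hz, Function.update_of_ne (Ne.symm hz)]

theorem foldl_invSqrt (l : List ℕ) (m : Mem) :
    l.foldl (fun m x => invSqrtEff x m) m = ⟨m.out, m.words, Function.update m.reals 3 fun z =>
      if z ∈ l then 1 / Real.sqrt (m.reals 2 z) else m.reals 3 z⟩ := by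
  induction l generalizing m with
  | nil => simp
  | cons x l ih =>
    rw [List.foldl_cons, ih]
    simp only [invSqrtEff, setAt, Function.update_self, Function.update_idem, List.mem_cons,
      Function.update_of_ne (show (2 : ℕ) ≠ 3 by norm_num)]
    congr 2
    funext z
    by_cases hz : z = x
    · subst hz; simp
    · simp [hz]

theorem foldl_mask (l : List (ℕ × ℕ)) (m : Mem)
    (hl : ∀ x ∈ l, ∀ y ∈ l, x.1 = y.1 → x.2 = y.2) :
    ∃ f : ℕ → ℝ, l.foldl (fun m x => maskEff x m) m =
        ⟨m.out, m.words, Function.update m.reals 7 f⟩ ∧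
      (∀ x ∈ l, f x.1 =
        if m.reals 6 x.1 * m.reals 6 x.1 < m.reals 1 x.2 then 0 else 1) ∧
      ∀ z, z ∉ l.map Prod.fst → f z = m.reals 7 z := by
  induction l generalizing m with
  | nil => exact ⟨m.reals 7, by simp, by simp, by simp⟩
  | cons x l ih =>
    obtain ⟨f, hf, h1, h2⟩ := ih (maskEff x m)
      fun a ha b hb => hl a (List.mem_cons_of_mem _ ha) b (List.mem_cons_of_mem _ hb)
    simp only [maskEff, setAt, Function.update_self, Function.update_idem,
      Function.update_of_ne (show (6 : ℕ) ≠ 7 by norm_num),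
      Function.update_of_ne (show (1 : ℕ) ≠ 7 by norm_num)] at hf h1 h2
    refine ⟨f, ?_, ?_, ?_⟩
    · rw [List.foldl_cons]; simpa [maskEff, setAt] using hf
    · intro y hy
      rcases List.mem_cons.1 hy with rfl | hy
      · by_cases hm : y.1 ∈ l.map Prod.fst
        · obtain ⟨z, hz, hzy⟩ := List.mem_map.1 hm
          rw [← hzy, h1 z hz, hl z (List.mem_cons_of_mem _ hz) y (by simp) hzy]
        · rw [h2 _ hm]; simp
      · exact h1 y hy
    · intro z hz
      simp only [List.map_cons, List.mem_cons, not_or] at hz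
      rw [h2 z hz.2, Function.update_of_ne hz.1]

theorem foldl_copy {D A : ℕ} (hA : A ≠ D) (l : List (ℕ × ℕ)) (m : Mem)
    (hl : ∀ x ∈ l, ∀ y ∈ l, x.1 = y.1 → x.2 = y.2) :
    ∃ f : ℕ → ℝ, l.foldl (fun m x => copyEff D A x m) m =
        ⟨m.out, m.words, Function.update m.reals D f⟩ ∧
      (∀ x ∈ l, f x.1 = m.reals A x.2) ∧
      ∀ z, z ∉ l.map Prod.fst → f z = m.reals D z := by
  induction l generalizing m with
  | nil => exact ⟨m.reals D, by simp, by simp, by simp⟩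
  | cons x l ih =>
    obtain ⟨f, hf, h1, h2⟩ := ih (copyEff D A x m)
      fun a ha b hb => hl a (List.mem_cons_of_mem _ ha) b (List.mem_cons_of_mem _ hb)
    simp only [copyEff, setAt, Function.update_self, Function.update_idem,
      Function.update_of_ne hA] at hf h1 h2
    refine ⟨f, ?_, ?_, ?_⟩
    · rw [List.foldl_cons]; simpa [copyEff, setAt] using hf
    · intro y hy
      rcases List.mem_cons.1 hy with rfl | hy
      · by_cases hm : y.1 ∈ l.map Prod.fst
        · obtain ⟨z, hz, hzy⟩ := List.mem_map.1 hm
          rw [← hzy, h1 z hz, hl z (List.mem_cons_of_mem _ hz) y (by simp) hzy]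
        · rw [h2 _ hm]; simp
      · exact h1 y hy
    · intro z hz
      simp only [List.map_cons, List.mem_cons, not_or] at hz
      rw [h2 z hz.2, Function.update_of_ne hz.1]

theorem foldl_compare (l : List (ℕ × ℕ × ℕ × ℕ × ℕ)) (m : Mem) :
    (l.foldl (fun m x => compareEff x m) m).out = m.out ∧
    (∀ z, (l.foldl (fun m x => compareEff x m) m).words 1 z = m.words 1 z +
      (l.map fun x => if x.2.2.1 = z ∧ m.reals 14 x.1 * m.reals 14 x.2.1 < 0
        then x.2.2.2.1 else 0).sum) ∧
    ∀ z, (l.foldl (fun m x => compareEff x m) m).words 2 z = m.words 2 z +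
      (l.map fun x => if x.2.2.1 = z ∧ m.reals 14 x.1 * m.reals 14 x.2.1 < 0
        then x.2.2.2.2 else 0).sum := by
  induction l generalizing m with
  | nil => simp
  | cons x l ih =>
    obtain ⟨h1, h2, h3⟩ := ih (compareEff x m)
    simp only [List.foldl_cons, List.map_cons, List.sum_cons]
    refine ⟨h1, fun z => ?_, fun z => ?_⟩
    · rw [h2 z, show (compareEff x m).reals = m.reals from rfl, ← add_assoc]
      congr 1
      by_cases hc : m.reals 14 x.1 * m.reals 14 x.2.1 < 0
      · by_cases hz : x.2.2.1 = z
        · subst hz; simp [compareEff, setAt, hc]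
        · simp [compareEff, setAt, hc, hz, Function.update_of_ne (Ne.symm hz)]
      · simp [compareEff, hc]
    · rw [h3 z, show (compareEff x m).reals = m.reals from rfl, ← add_assoc]
      congr 1
      by_cases hc : m.reals 14 x.1 * m.reals 14 x.2.1 < 0
      · by_cases hz : x.2.2.1 = z
        · subst hz; simp [compareEff, setAt, hc]
        · simp [compareEff, setAt, hc, hz, Function.update_of_ne (Ne.symm hz)]
      · simp [compareEff, hc]

open Finset BigOperators

/-! ### Finite probability spaces -/

/-- The probability of an event under the uniform distribution. -/
noncomputable def pr {Ω : Type*} [Fintype Ω] (p : Ω → Prop) : ℝ :=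
  𝔼 ω, (open Classical in if p ω then (1 : ℝ) else 0)

section
variable {Ω Ω' : Type*} [Fintype Ω] [Fintype Ω']

theorem expect_mono {f g : Ω → ℝ} (h : ∀ ω, f ω ≤ g ω) : 𝔼 ω, f ω ≤ 𝔼 ω, g ω :=
  Finset.expect_le_expect fun ω _ => h ω

theorem expect_prod (f : Ω × Ω' → ℝ) : 𝔼 x, f x = 𝔼 a, 𝔼 b, f (a, b) := by
  rw [← Finset.univ_product_univ, Finset.expect_product]

theorem expect_swap (f : Ω → Ω' → ℝ) : 𝔼 a, 𝔼 b, f a b = 𝔼 b, 𝔼 a, f a b :=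
  Finset.expect_comm _ _ _

theorem pr_nonneg (p : Ω → Prop) : 0 ≤ pr p :=
  Finset.expect_nonneg fun ω _ => by split_ifs <;> norm_num

theorem pr_mono {p q : Ω → Prop} (h : ∀ ω, p ω → q ω) : pr p ≤ pr q := by
  refine expect_mono fun ω => ?_
  by_cases hp : p ω
  · simp [hp, h ω hp]
  · rw [if_neg hp]; split_ifs <;> norm_num

theorem pr_le_one [Nonempty Ω] (p : Ω → Prop) : pr p ≤ 1 := by
  calc pr p ≤ 𝔼 _ω : Ω, (1 : ℝ) := expect_mono fun ω => by split_ifs <;> norm_num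
    _ = 1 := Fintype.expect_const _

theorem pr_true [Nonempty Ω] : pr (fun _ : Ω => True) = 1 := by
  simp [pr]

theorem pr_not [Nonempty Ω] (p : Ω → Prop) : pr (fun ω => ¬ p ω) = 1 - pr p := by
  rw [eq_sub_iff_add_eq, pr, pr, ← Finset.expect_add_distrib]
  rw [← Fintype.expect_const (ι := Ω) (1 : ℝ)]
  refine Finset.expect_congr rfl fun ω _ => ?_
  by_cases h : p ω <;> simp [h]

theorem pr_or_le (p q : Ω → Prop) : pr (fun ω => p ω ∨ q ω) ≤ pr p + pr q := by
  rw [pr, pr, pr, ← Finset.expect_add_distrib]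
  refine expect_mono fun ω => ?_
  by_cases h : p ω <;> by_cases h' : q ω <;> simp [h, h']

theorem pr_exists_le {ι : Type*} (s : Finset ι) (p : ι → Ω → Prop) :
    pr (fun ω => ∃ i ∈ s, p i ω) ≤ ∑ i ∈ s, pr (p i) := by
  classical
  simp only [pr]
  rw [← Finset.expect_sum_comm]
  refine expect_mono fun ω => ?_
  by_cases h : ∃ i ∈ s, p i ω
  · obtain ⟨i, hi, hp⟩ := h
    rw [if_pos ⟨i, hi, hp⟩]
    calc (1 : ℝ) = if p i ω then 1 else 0 := by simp [hp]
      _ ≤ _ := Finset.single_le_sum (f := fun i => if p i ω then (1 : ℝ) else 0)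
        (fun i _ => by split_ifs <;> norm_num) hi
  · rw [if_neg h]
    exact Finset.sum_nonneg fun i _ => by split_ifs <;> norm_num

theorem pr_markov {f : Ω → ℝ} (hf : ∀ ω, 0 ≤ f ω) {c : ℝ} (hc : 0 < c) :
    pr (fun ω => c ≤ f ω) ≤ (𝔼 ω, f ω) / c := by
  rw [Finset.expect_div]
  refine expect_mono fun ω => ?_
  split_ifs with h
  · rwa [le_div_iff₀ hc, one_mul]
  · exact div_nonneg (hf ω) hc.le

/-- A pair of independent choices: if the first is good with probability at least `p` and, given a
good first choice, the second is good with probability at least `q`, then both are good with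
probability at least `p * q`. -/
theorem pr_prod_ge {A : Ω → Prop} {B : Ω → Ω' → Prop} {p q : ℝ} (hq : 0 ≤ q) (hA : p ≤ pr A)
    (hB : ∀ a, A a → q ≤ pr (B a)) : p * q ≤ pr fun x : Ω × Ω' => A x.1 ∧ B x.1 x.2 := by
  classical
  rw [pr, expect_prod]
  calc p * q ≤ pr A * q := mul_le_mul_of_nonneg_right hA hq
    _ = 𝔼 a, (if A a then (1 : ℝ) else 0) * q := by rw [pr, Finset.expect_mul]
    _ ≤ _ := expect_mono fun a => by
      by_cases h : A a
      · simpa [h, pr] using hB a h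
      · simp [h]

theorem pr_fst [Nonempty Ω'] (A : Ω → Prop) : pr (fun x : Ω × Ω' => A x.1) = pr A := by
  rw [pr, expect_prod, pr]
  refine Finset.expect_congr rfl fun a _ => ?_
  by_cases h : A a <;> simp [h]

theorem pr_eq_card (p : Ω → Prop) :
    pr p = (Nat.card {ω // p ω} : ℝ) / Fintype.card Ω := by
  classical
  rw [pr, Fintype.expect_eq_sum_div_card, Nat.card_eq_fintype_card, Fintype.card_subtype]
  congr 1
  rw [Finset.sum_boole]

end

section
variable {ι : Type*} [Fintype ι] [DecidableEq ι] {Ω : ι → Type*} [∀ i, Fintype (Ω i)]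

theorem expect_pi_prod (f : ∀ i, Ω i → ℝ) :
    𝔼 ω : (∀ i, Ω i), ∏ i, f i (ω i) = ∏ i, 𝔼 a, f i a := by
  simp only [Fintype.expect_eq_sum_div_card]
  rw [Finset.prod_div_distrib, Finset.prod_univ_sum, Fintype.piFinset_univ, Fintype.card_pi]
  push_cast
  rfl

theorem pr_pi (p : ∀ i, Ω i → Prop) :
    pr (fun ω : ∀ i, Ω i => ∀ i, p i (ω i)) = ∏ i, pr (p i) := by
  simp only [pr]
  rw [← expect_pi_prod]
  refine Finset.expect_congr rfl fun ω _ => ?_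
  by_cases h : ∀ i, p i (ω i)
  · simp [h]
  · rw [if_neg h]
    obtain ⟨i, hi⟩ := not_forall.1 h
    exact (Finset.prod_eq_zero (mem_univ i) (by simp [hi])).symm

end

section
variable {ι Ω : Type*} [Fintype ι] [DecidableEq ι] [Fintype Ω] [Nonempty Ω]

theorem expect_pi_apply (f : Ω → ℝ) (i : ι) : 𝔼 ω : ι → Ω, f (ω i) = 𝔼 a, f a := by
  have := expect_pi_prod (Ω := fun _ : ι => Ω) fun j a => if j = i then f a else 1
  simp only [Finset.prod_ite_eq', mem_univ, if_true] at this
  rw [this, Finset.prod_eq_single i]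
  · simp
  · intro j _ hj; simp [hj]
  · simp

theorem expect_pi_mul (f g : Ω → ℝ) {i j : ι} (hij : i ≠ j) :
    𝔼 ω : ι → Ω, f (ω i) * g (ω j) = (𝔼 a, f a) * 𝔼 a, g a := by
  have := expect_pi_prod (Ω := fun _ : ι => Ω)
    fun l a => (if l = i then f a else 1) * (if l = j then g a else 1)
  simp only [Finset.prod_mul_distrib, Finset.prod_ite_eq', mem_univ, if_true] at this
  rw [this, ← Finset.mul_prod_erase _ _ (mem_univ i),
    ← Finset.mul_prod_erase _ _ (Finset.mem_erase.2 ⟨hij.symm, mem_univ j⟩),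
    Finset.prod_eq_one]
  · simp [hij, hij.symm]
  · intro l hl
    simp only [mem_erase, mem_univ, and_true] at hl
    simp [hl.1, hl.2]

/-- A sum of independent centred variables has variance the sum of the variances. -/
theorem expect_sum_sq (f : Ω → ℝ) (hf : 𝔼 a, f a = 0) (S : Finset ι) :
    𝔼 ω : ι → Ω, (∑ l ∈ S, f (ω l)) ^ 2 = #S * 𝔼 a, f a ^ 2 := by
  simp only [sq, Finset.sum_mul_sum]
  rw [Finset.expect_sum_comm]
  have : ∀ i ∈ S, 𝔼 ω : ι → Ω, ∑ j ∈ S, f (ω i) * f (ω j) = 𝔼 a, f a * f a := by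
    intro i hi
    rw [Finset.expect_sum_comm, Finset.sum_eq_single i]
    · exact expect_pi_apply (fun a => f a * f a) i
    · intro j _ hj
      rw [expect_pi_mul f f hj.symm, hf, zero_mul]
    · exact fun h => absurd hi h
  rw [Finset.sum_congr rfl this, Finset.sum_const, nsmul_eq_mul]

/-- A random function agrees with prescribed values at the points of `S` with probability
`|Ω| ^ (-|S|)`. -/
theorem pr_fun_eq [DecidableEq Ω] (S : Finset ι) (c : ι → Ω) :
    pr (fun ω : ι → Ω => ∀ i ∈ S, ω i = c i) = (1 / (Fintype.card Ω : ℝ)) ^ #S := by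
  have h := pr_pi (Ω := fun _ : ι => Ω) (fun i a => i ∈ S → a = c i)
  rw [h, ← Finset.prod_subset (Finset.subset_univ S), ← Finset.prod_const]
  · refine Finset.prod_congr rfl fun i hi => ?_
    simp [pr, hi]
  · intro i _ hi
    simp [hi, pr_true]

theorem pr_fun_collide [DecidableEq Ω] {i j : ι} (hij : i ≠ j) :
    pr (fun ω : ι → Ω => ω i = ω j) = 1 / Fintype.card Ω := by
  have h : pr (fun ω : ι → Ω => ω i = ω j) =
      ∑ c : Ω, pr (fun ω : ι → Ω => ∀ l ∈ ({i, j} : Finset ι), ω l = c) := by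
    simp only [pr]
    rw [← Finset.expect_sum_comm]
    refine Finset.expect_congr rfl fun ω _ => ?_
    by_cases h : ω i = ω j
    · rw [if_pos h, Finset.sum_eq_single (ω i)]
      · simp [h]
      · intro c _ hc
        simp [Ne.symm hc]
      · simp
    · rw [if_neg h, Finset.sum_eq_zero]
      intro c _
      rw [if_neg]
      intro hc
      exact h ((hc i (by simp)).trans (hc j (by simp)).symm)
  rw [h]
  have h2 : ∀ c : Ω, pr (fun ω : ι → Ω => ∀ l ∈ ({i, j} : Finset ι), ω l = c) =
      (1 / (Fintype.card Ω : ℝ)) ^ 2 := fun c => by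
    rw [pr_fun_eq {i, j} fun _ => c, Finset.card_pair hij]
  rw [Finset.sum_congr rfl fun c _ => h2 c, Finset.sum_const, nsmul_eq_mul, card_univ]
  have : (Fintype.card Ω : ℝ) ≠ 0 := by exact_mod_cast Fintype.card_ne_zero
  field_simp

end

/-- The second moment method: a variable whose second moment is at most three times the
square of its positive mean is at least half of its mean with probability at least `1/12`. -/
theorem paley_zygmund {Ω : Type*} [Fintype Ω] {Y : Ω → ℝ} {μ : ℝ} (hμ : 0 < μ)
    (h1 : 𝔼 ω, Y ω = μ) (h2 : 𝔼 ω, Y ω ^ 2 ≤ 3 * μ ^ 2) [Nonempty Ω] :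
    1 / 12 ≤ pr fun ω => μ / 2 ≤ Y ω := by
  have key : μ ≤ μ / 2 + ((1 / (12 * μ)) * 𝔼 ω, Y ω ^ 2) + 3 * μ * pr (fun ω => μ / 2 ≤ Y ω) := by
    have e : μ / 2 = 𝔼 _ω : Ω, μ / 2 := (Fintype.expect_const _).symm
    have e' : ∀ x, μ / 2 + x = (𝔼 _ω : Ω, μ / 2) + x := fun x => by rw [← e]
    rw [pr, Finset.mul_expect, Finset.mul_expect, add_assoc, ← Finset.expect_add_distrib, e',
      ← Finset.expect_add_distrib]
    conv_lhs => rw [← h1]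
    refine expect_mono fun ω => ?_
    by_cases h : μ / 2 ≤ Y ω
    · simp only [h, if_true]
      have : 0 ≤ (1 / (12 * μ)) * (Y ω - 6 * μ) ^ 2 := by positivity
      have e : (1 / (12 * μ)) * (Y ω - 6 * μ) ^ 2
          = (1 / (12 * μ)) * Y ω ^ 2 - Y ω + 3 * μ := by field_simp; ring
      linarith
    · simp only [h, if_false]
      have : 0 ≤ (1 / (12 * μ)) * Y ω ^ 2 := by positivity
      linarith [not_le.1 h]
  have h3 : (1 / (12 * μ)) * 𝔼 ω, Y ω ^ 2 ≤ μ / 4 := by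
    calc _ ≤ (1 / (12 * μ)) * (3 * μ ^ 2) := by gcongr
      _ = μ / 4 := by field_simp; norm_num
  have h4 : μ * (1 / 12) ≤ μ * pr (fun ω => μ / 2 ≤ Y ω) := by linarith
  exact le_of_mul_le_mul_left h4 hμ

/-! ### Four-wise independent signs -/

/-- A random vector `g ω` of signs whose fourth moments vanish whenever some index occurs exactly
once among four. -/
structure IsFourwise {Ω ι : Type*} [Fintype Ω] (g : Ω → ι → ℝ) : Prop where
  sq : ∀ ω a, g ω a * g ω a = 1
  four : ∀ a b c d, a ≠ b → a ≠ c → a ≠ d → 𝔼 ω, g ω a * g ω b * g ω c * g ω d = 0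

theorem IsFourwise.comp {Ω ι κ : Type*} [Fintype Ω] {g : Ω → ι → ℝ} (hg : IsFourwise g)
    {f : κ → ι} (hf : Function.Injective f) : IsFourwise fun ω a => g ω (f a) :=
  ⟨fun ω a => hg.sq ω (f a), fun _ _ _ _ hb hc hd =>
    hg.four _ _ _ _ (hf.ne hb) (hf.ne hc) (hf.ne hd)⟩

/-- A balanced sign function on a finite type of even cardinality. -/
theorem exists_balanced {F : Type*} [Fintype F] (h : Even (Fintype.card F)) :
    ∃ ψ : F → ℝ, (∀ x, ψ x * ψ x = 1) ∧ ∑ x, ψ x = 0 := by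
  refine ⟨fun x => (-1) ^ (Fintype.equivFin F x : ℕ), fun x => ?_, ?_⟩
  · rw [← mul_pow]; norm_num
  · rw [(Fintype.equivFin F).sum_comp fun i : Fin (Fintype.card F) => (-1 : ℝ) ^ (i : ℕ),
      Fin.sum_univ_eq_sum_range fun i => (-1 : ℝ) ^ i, neg_one_geom_sum, if_pos h]

/-- The signs of the values of a random cubic polynomial over a finite field of even order are
four-wise independent: adding a multiple of the cubic that vanishes at `b`, `c` and `d` changes
the value at `a` only. -/
theorem isFourwise_cubic {F ι : Type*} [Field F] [Fintype F] {ψ : F → ℝ}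
    (hψ : ∀ x, ψ x * ψ x = 1) (hψ0 : ∑ x, ψ x = 0) {e : ι → F} (he : Function.Injective e) :
    IsFourwise fun (c : F × F × F × F) a =>
      ψ (c.1 + c.2.1 * e a + c.2.2.1 * e a ^ 2 + c.2.2.2 * e a ^ 3) := by
  refine ⟨fun ω a => hψ _, fun a b c d hab hac had => ?_⟩
  set P : F × F × F × F → F → F :=
    fun c x => c.1 + c.2.1 * x + c.2.2.1 * x ^ 2 + c.2.2.2 * x ^ 3 with hP
  set δ : F → F × F × F × F := fun y => (-(y * (e b * e c * e d)),
    y * (e b * e c + e b * e d + e c * e d), -(y * (e b + e c + e d)), y) with hδ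
  have hδP : ∀ y x ω, P (ω + δ y) x = P ω x + y * ((x - e b) * (x - e c) * (x - e d)) := by
    intro y x ω
    simp only [hP, hδ, Prod.fst_add, Prod.snd_add]
    ring
  set u : F := (e a - e b) * (e a - e c) * (e a - e d) with hu
  have hu0 : u ≠ 0 := mul_ne_zero (mul_ne_zero (sub_ne_zero.2 (he.ne hab))
    (sub_ne_zero.2 (he.ne hac))) (sub_ne_zero.2 (he.ne had))
  have hsum : ∑ ω, ψ (P ω (e a)) * ψ (P ω (e b)) * ψ (P ω (e c)) * ψ (P ω (e d)) = 0 := by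
    set f : F × F × F × F → ℝ :=
      fun ω => ψ (P ω (e a)) * ψ (P ω (e b)) * ψ (P ω (e c)) * ψ (P ω (e d)) with hf
    have h1 : ∀ y : F, ∑ ω, f (ω + δ y) = ∑ ω, f ω := fun y =>
      Equiv.sum_comp (Equiv.addRight (δ y)) f
    have h2 : ∑ y : F, ∑ ω, f (ω + δ y) = 0 := by
      rw [Finset.sum_comm]
      refine Finset.sum_eq_zero fun ω _ => ?_
      have h3 : ∀ y, f (ω + δ y) = ψ (P ω (e a) + y * u) *
          (ψ (P ω (e b)) * ψ (P ω (e c)) * ψ (P ω (e d))) := by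
        intro y
        simp only [hf, hδP, sub_self, zero_mul, mul_zero, add_zero, ← hu]
        ring
      rw [Finset.sum_congr rfl fun y _ => h3 y, ← Finset.sum_mul]
      have h4 : ∑ y, ψ (P ω (e a) + y * u) = ∑ y, ψ y :=
        ((Equiv.mulRight₀ u hu0).trans (Equiv.addLeft (P ω (e a)))).sum_comp ψ
      rw [h4, hψ0, zero_mul]
    simp only [h1, Finset.sum_const, nsmul_eq_mul] at h2
    rcases mul_eq_zero.1 h2 with h | h
    · exact absurd h (by simp)
    · exact h
  rw [Fintype.expect_eq_sum_div_card, hsum, zero_div]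

/-- There are `N` four-wise independent signs with polynomially many seeds. -/
theorem exists_isFourwise (N : ℕ) : ∃ (M : ℕ) (g : Fin M → Fin N → ℝ),
    0 < M ∧ M ≤ (N + 2) ^ 8 ∧ IsFourwise g := by
  classical
  -- A field of even order with more than `N` elements; a seed is the list of the four coefficients.
  set m := Nat.log 2 N + 1 with hm
  let F := GaloisField 2 m
  let _ : Fintype F := Fintype.ofFinite F
  have hcard : Fintype.card F = 2 ^ m := by
    rw [← Nat.card_eq_fintype_card]; exact GaloisField.card 2 m (by omega)
  have hN : N < 2 ^ m := Nat.lt_pow_succ_log_self (by norm_num) N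
  have hle : 2 ^ m ≤ (N + 2) ^ 2 := by
    rcases Nat.eq_zero_or_pos N with h | h
    · subst h; simp [hm]
    · have := Nat.pow_log_le_self 2 h.ne'
      rw [hm, pow_succ]; nlinarith
  obtain ⟨ψ, hψ, hψ0⟩ := exists_balanced (F := F) (by rw [hcard, hm, pow_succ]; simp)
  set e : Fin N → F := fun a => (Fintype.equivFin F).symm ⟨a, by rw [hcard]; omega⟩ with he
  have hinj : Function.Injective e := by
    intro a b hab
    have := (Fintype.equivFin F).symm.injective hab
    simpa [Fin.ext_iff] using this
  have h := isFourwise_cubic hψ hψ0 hinj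
  let E := Fintype.equivFin (F × F × F × F)
  refine ⟨_, fun κ a => _, ?_, ?_, ⟨fun ω a => h.sq (E.symm ω) a, fun a b c d h1 h2 h3 => ?_⟩⟩
  · exact Fintype.card_pos
  · simp only [Fintype.card_prod, hcard]
    calc 2 ^ m * (2 ^ m * (2 ^ m * 2 ^ m)) = (2 ^ m) ^ 4 := by ring
      _ ≤ ((N + 2) ^ 2) ^ 4 := Nat.pow_le_pow_left hle 4
      _ = (N + 2) ^ 8 := by ring
  · rw [← h.four a b c d h1 h2 h3]
    exact Fintype.expect_equiv E.symm _ _ fun ω => rfl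

/-! ### Second and fourth moments -/

section
variable {Ω ι : Type*} [Fintype Ω] [Nonempty Ω] {g : Ω → ι → ℝ}

theorem IsFourwise.two [DecidableEq ι] (hg : IsFourwise g) (a b : ι) :
    𝔼 ω, g ω a * g ω b = if a = b then 1 else 0 := by
  split_ifs with h
  · subst h
    simp [hg.sq]
  · rw [← hg.four a b b b h h h]
    refine Finset.expect_congr rfl fun ω _ => ?_
    rw [mul_assoc (g ω a * g ω b), hg.sq, mul_one]

theorem IsFourwise.four_eq [DecidableEq ι] (hg : IsFourwise g) {a b c d : ι} (hab : a ≠ b)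
    (hcd : c ≠ d) : 𝔼 ω, g ω a * g ω b * g ω c * g ω d =
      (if c = a then (if d = b then 1 else 0) else 0) +
        (if c = b then (if d = a then 1 else 0) else 0) := by
  by_cases hca : c = a
  · subst hca
    by_cases hdb : d = b
    · subst hdb
      have : ∀ ω, g ω c * g ω d * g ω c * g ω d = 1 := fun ω => by
        rw [mul_assoc, mul_assoc, ← mul_assoc (g ω d), mul_comm (g ω d) (g ω c),
          mul_assoc (g ω c), hg.sq, mul_one, hg.sq]
      simp [this, hcd]
    · have := hg.four d c b c (Ne.symm hcd) hdb (Ne.symm hcd)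
      simp only [if_true, hdb, if_false, hab, add_zero]
      rw [← this]
      exact Finset.expect_congr rfl fun ω _ => by ring
  · by_cases hda : d = a
    · subst hda
      by_cases hcb : c = b
      · subst hcb
        have : ∀ ω, g ω d * g ω c * g ω c * g ω d = 1 := fun ω => by
          rw [mul_assoc (g ω d), hg.sq, mul_one, hg.sq]
        simp [this, hca]
      · have := hg.four c d b d hcd hcb hcd
        simp only [hca, hcb, if_false, add_zero]
        rw [← this]
        exact Finset.expect_congr rfl fun ω _ => by ring
    · have := hg.four a b c d hab (Ne.symm hca) (Ne.symm hda)
      simp [this, hca, hda]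

variable [Fintype ι]

/-- An off-diagonal quadratic form in four-wise independent signs. -/
theorem IsFourwise.quad (hg : IsFourwise g) (C : ι → ι → ℝ) (hC : ∀ a, C a a = 0) :
    𝔼 ω, (∑ a, ∑ b, C a b * (g ω a * g ω b)) ^ 2 ≤ 2 * ∑ a, ∑ b, C a b ^ 2 := by
  classical
  have h1 : 𝔼 ω, (∑ a, ∑ b, C a b * (g ω a * g ω b)) ^ 2 =
      ∑ a, ∑ b, ∑ c, ∑ d, C a b * C c d * 𝔼 ω, g ω a * g ω b * g ω c * g ω d := by
    have h0 : ∀ ω, (∑ a, ∑ b, C a b * (g ω a * g ω b)) ^ 2 =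
        ∑ a, ∑ b, ∑ c, ∑ d, C a b * C c d * (g ω a * g ω b * g ω c * g ω d) := by
      intro ω
      simp only [pow_two, Finset.sum_mul]
      refine Finset.sum_congr rfl fun a _ => Finset.sum_congr rfl fun b _ => ?_
      simp only [Finset.mul_sum]
      exact Finset.sum_congr rfl fun c _ => Finset.sum_congr rfl fun d _ => by ring
    simp only [h0, Finset.expect_sum_comm, ← Finset.mul_expect]
  have h2 : ∀ a b c d, C a b * C c d * 𝔼 ω, g ω a * g ω b * g ω c * g ω d =
      C a b * ((if c = a then (if d = b then C c d else 0) else 0) +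
        (if c = b then (if d = a then C c d else 0) else 0)) := by
    intro a b c d
    by_cases hab : a = b
    · subst hab; simp [hC]
    by_cases hcd : c = d
    · subst hcd; simp [hC]
    rw [hg.four_eq hab hcd]
    split_ifs <;> ring
  rw [h1]
  simp only [h2, ← Finset.mul_sum, Finset.sum_add_distrib]
  have h3 : ∀ b a, (∑ c, ∑ d, if c = b then (if d = a then C c d else 0) else 0) = C b a := by
    intro b a
    rw [Finset.sum_eq_single b]
    · simp
    · intro c _ hc; simp [hc]
    · simp
  simp only [h3]
  have h4 : ∑ a, ∑ b, C a b ^ 2 = ∑ a, ∑ b, C b a ^ 2 := Finset.sum_comm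
  have h5 : ∑ a, ∑ b, C a b * (C a b + C b a) ≤
      ∑ a, ∑ b, ((3 / 2) * C a b ^ 2 + (1 / 2) * C b a ^ 2) :=
    Finset.sum_le_sum fun a _ => Finset.sum_le_sum fun b _ => by
      nlinarith [sq_nonneg (C a b - C b a)]
  refine h5.trans (le_of_eq ?_)
  simp only [Finset.sum_add_distrib, ← Finset.mul_sum]
  rw [← h4]; ring

/-- The inner product. -/
def dot (u x : ι → ℝ) : ℝ := ∑ a, u a * x a

theorem IsFourwise.expect_dot_mul (hg : IsFourwise g) (x y : ι → ℝ) :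
    𝔼 ω, dot (g ω) x * dot (g ω) y = dot x y := by
  classical
  have : ∀ ω, dot (g ω) x * dot (g ω) y = ∑ a, ∑ b, (x a * y b) * (g ω a * g ω b) := by
    intro ω
    simp only [dot, Finset.sum_mul_sum]
    exact Finset.sum_congr rfl fun a _ => Finset.sum_congr rfl fun b _ => by ring
  simp only [this, Finset.expect_sum_comm, ← Finset.mul_expect, hg.two]
  simp [dot]

theorem sum_sq_mul (x y : ι → ℝ) : ∑ a, ∑ b, (x a * y b) ^ 2 = dot x x * dot y y := by
  simp only [dot, Finset.sum_mul_sum]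
  exact Finset.sum_congr rfl fun a _ => Finset.sum_congr rfl fun b _ => by ring

theorem dot_self_nonneg (x : ι → ℝ) : 0 ≤ dot x x :=
  Finset.sum_nonneg fun _ _ => mul_self_nonneg _

/-- The variance of the estimator of an inner product by a product of two linear forms in
four-wise independent signs. -/
theorem IsFourwise.variance_dot_mul (hg : IsFourwise g) (x y : ι → ℝ) :
    𝔼 ω, (dot (g ω) x * dot (g ω) y - dot x y) ^ 2 ≤ 2 * (dot x x * dot y y) := by
  classical
  have h1 : ∀ ω, dot (g ω) x * dot (g ω) y - dot x y =
      ∑ a, ∑ b, (if a = b then 0 else x a * y b) * (g ω a * g ω b) := by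
    intro ω
    rw [sub_eq_iff_eq_add]
    simp only [dot, Finset.sum_mul_sum]
    rw [← Finset.sum_add_distrib]
    refine Finset.sum_congr rfl fun a _ => ?_
    rw [← Finset.add_sum_erase _ _ (Finset.mem_univ a),
      ← Finset.add_sum_erase (a := a) univ (fun b => (if a = b then 0 else x a * y b) * _)
        (Finset.mem_univ a)]
    have e1 : g ω a * x a * (g ω a * y a) = x a * y a := by
      rw [show g ω a * x a * (g ω a * y a) = (g ω a * g ω a) * (x a * y a) by ring, hg.sq, one_mul]
    rw [e1, if_pos rfl, zero_mul, zero_add, add_comm]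
    congr 1
    refine Finset.sum_congr rfl fun b hb => ?_
    rw [if_neg (Ne.symm (Finset.ne_of_mem_erase hb))]
    ring
  simp only [h1]
  refine (hg.quad _ fun a => by simp).trans ?_
  rw [← sum_sq_mul]
  refine mul_le_mul_of_nonneg_left (Finset.sum_le_sum fun a _ => Finset.sum_le_sum fun b _ => ?_)
    (by norm_num)
  split_ifs
  · simpa using sq_nonneg (x a * y b)
  · exact le_rfl

theorem IsFourwise.dot_fourth (hg : IsFourwise g) (x : ι → ℝ) :
    𝔼 ω, (dot (g ω) x ^ 2) ^ 2 ≤ 3 * dot x x ^ 2 := by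
  have h1 := hg.variance_dot_mul x x
  have h2 := hg.expect_dot_mul x x
  have h3 : ∀ ω, (dot (g ω) x ^ 2) ^ 2 = (dot (g ω) x * dot (g ω) x - dot x x) ^ 2 +
      (2 * dot x x * (dot (g ω) x * dot (g ω) x) - dot x x ^ 2) := fun ω => by ring
  simp only [h3]
  rw [Finset.expect_add_distrib, Finset.expect_sub_distrib, ← Finset.mul_expect, h2,
    Fintype.expect_const]
  nlinarith

theorem IsFourwise.anticoncentration (hg : IsFourwise g) (x : ι → ℝ) (hx : 0 < dot x x) :
    1 / 12 ≤ pr fun ω => dot x x / 2 ≤ dot (g ω) x ^ 2 :=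
  paley_zygmund hx
    (by simp only [pow_two]; exact hg.expect_dot_mul x x) (hg.dot_fourth x)

variable {κ : Type*} [Fintype κ] [DecidableEq κ]

/-- The estimate of the inner product of `x` and `y` from the sketch coordinates in `S`; its mean
is `|S|` times the inner product. -/
def est (g : Ω → ι → ℝ) (S : Finset κ) (σ : κ → Ω) (x y : ι → ℝ) : ℝ :=
  ∑ l ∈ S, dot (g (σ l)) x * dot (g (σ l)) y

theorem IsFourwise.variance_est (hg : IsFourwise g) (S : Finset κ) (x y : ι → ℝ) :
    𝔼 σ : κ → Ω, (est g S σ x y - #S * dot x y) ^ 2 ≤ #S * (2 * (dot x x * dot y y)) := by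
  have h : ∀ σ : κ → Ω, est g S σ x y - #S * dot x y =
      ∑ l ∈ S, (dot (g (σ l)) x * dot (g (σ l)) y - dot x y) := fun σ => by
    rw [Finset.sum_sub_distrib, Finset.sum_const, nsmul_eq_mul, est]
  simp only [h]
  rw [expect_sum_sq (fun ω => dot (g ω) x * dot (g ω) y - dot x y)]
  · exact mul_le_mul_of_nonneg_left (hg.variance_dot_mul x y) (Nat.cast_nonneg _)
  · rw [Finset.expect_sub_distrib, hg.expect_dot_mul, Fintype.expect_const, sub_self]

theorem IsFourwise.expect_est (hg : IsFourwise g) (S : Finset κ) (x y : ι → ℝ) :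
    𝔼 σ : κ → Ω, est g S σ x y = #S * dot x y := by
  simp only [est, Finset.expect_sum_comm]
  rw [Finset.sum_congr rfl fun l _ =>
    (expect_pi_apply (fun ω => dot (g ω) x * dot (g ω) y) l).trans (hg.expect_dot_mul x y),
    Finset.sum_const, nsmul_eq_mul]

theorem IsFourwise.expect_est_sq (hg : IsFourwise g) (S : Finset κ) (x y : ι → ℝ) :
    𝔼 σ : κ → Ω, est g S σ x y ^ 2 ≤
      (#S : ℝ) ^ 2 * dot x y ^ 2 + #S * (2 * (dot x x * dot y y)) := by
  have h1 := hg.variance_est S x y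
  have h3 : ∀ σ : κ → Ω, est g S σ x y ^ 2 = (est g S σ x y - #S * dot x y) ^ 2 +
      (2 * (#S * dot x y) * est g S σ x y - (#S * dot x y) ^ 2) := fun ω => by ring
  simp only [h3]
  rw [Finset.expect_add_distrib, Finset.expect_sub_distrib, ← Finset.mul_expect, hg.expect_est,
    Fintype.expect_const]
  nlinarith

end

/-! ### Estimating the row norms -/

section
variable {n p M : ℕ}

/-- The estimate of the squared norm of `x i` from the signs with the seeds `σ`, up to the factor
`T`. -/
def normEst {T : ℕ} (g : Fin M → Fin p → ℝ) (x : Fin n → Fin p → ℝ) (σ : Fin T → Fin M)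
    (i : Fin n) : ℝ := ∑ u, dot (g (σ u)) (x i) ^ 2

/-- What is required of the norm estimates `v` of unit vectors, for the detection of the pair
`(i₀, j₀)`: none is too small, those of `i₀` and `j₀` are not too large, and those of the vectors
correlated with `i₀` are not too large on average. -/
structure NormGood (T : ℕ) (x : Fin n → Fin p → ℝ) (i₀ j₀ : Fin n) (v : Fin n → ℝ) : Prop where
  lower : ∀ i, 1 / 2 ≤ v i
  left : v i₀ ≤ 8 * T
  right : v j₀ ≤ 8 * T
  mean : ∑ j, dot (x i₀) (x j) ^ 2 * v j ≤ 8 * T * ∑ j, dot (x i₀) (x j) ^ 2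

variable [Nonempty (Fin M)] {g : Fin M → Fin p → ℝ} {x : Fin n → Fin p → ℝ}

theorem expect_normEst {T : ℕ} (hg : IsFourwise g) (hx : ∀ i, dot (x i) (x i) = 1) (i : Fin n) :
    𝔼 σ : Fin T → Fin M, normEst g x σ i = T := by
  simp only [normEst, Finset.expect_sum_comm, pow_two]
  rw [Finset.sum_congr rfl fun u _ =>
    (expect_pi_apply (fun ω => dot (g ω) (x i) * dot (g ω) (x i)) u).trans
      (hg.expect_dot_mul (x i) (x i))]
  simp [hx]

theorem pr_weighted_normEst_gt {T : ℕ} (hT : 0 < T) (hg : IsFourwise g)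
    (hx : ∀ i, dot (x i) (x i) = 1) (w : Fin n → ℝ) (hw : ∀ i, 0 ≤ w i) (hw' : 0 < ∑ i, w i) :
    pr (fun σ : Fin T → Fin M => ¬ ∑ i, w i * normEst g x σ i ≤ 8 * T * ∑ i, w i) ≤ 1 / 8 := by
  have hT' : (0 : ℝ) < T := by exact_mod_cast hT
  have h1 : 𝔼 σ : Fin T → Fin M, ∑ i, w i * normEst g x σ i = T * ∑ i, w i := by
    simp only [Finset.expect_sum_comm, ← Finset.mul_expect, expect_normEst hg hx]
    rw [← Finset.sum_mul, mul_comm]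
  calc _ ≤ pr (fun σ : Fin T → Fin M => 8 * T * ∑ i, w i ≤ ∑ i, w i * normEst g x σ i) :=
        pr_mono fun σ h => (not_le.1 h).le
    _ ≤ (𝔼 σ : Fin T → Fin M, ∑ i, w i * normEst g x σ i) / (8 * T * ∑ i, w i) :=
        pr_markov (fun σ => Finset.sum_nonneg fun i _ =>
          mul_nonneg (hw i) (Finset.sum_nonneg fun u _ => sq_nonneg _)) (by positivity)
    _ = 1 / 8 := by rw [h1]; field_simp

theorem pr_normEst_lt {T : ℕ} (hg : IsFourwise g) (hx : ∀ i, dot (x i) (x i) = 1) (i : Fin n) :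
    pr (fun σ : Fin T → Fin M => ¬ 1 / 2 ≤ normEst g x σ i) ≤ (11 / 12) ^ T := by
  have h1 : pr (fun ω => ¬ 1 / 2 ≤ dot (g ω) (x i) ^ 2) ≤ 11 / 12 := by
    rw [pr_not]
    have := hg.anticoncentration (x i) (by rw [hx]; norm_num)
    rw [hx] at this
    linarith
  calc _ ≤ pr (fun σ : Fin T → Fin M => ∀ u, ¬ 1 / 2 ≤ dot (g (σ u)) (x i) ^ 2) := by
        refine pr_mono fun σ h u hu => h (hu.trans ?_)
        exact Finset.single_le_sum (f := fun u => dot (g (σ u)) (x i) ^ 2)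
          (fun u _ => sq_nonneg _) (Finset.mem_univ u)
    _ = (pr fun ω => ¬ 1 / 2 ≤ dot (g ω) (x i) ^ 2) ^ T := by
        rw [pr_pi (Ω := fun _ : Fin T => Fin M) fun _ ω => ¬ 1 / 2 ≤ dot (g ω) (x i) ^ 2]
        simp
    _ ≤ _ := pow_le_pow_left₀ (pr_nonneg _) h1 T

/-- With `12 (γ + 3)` sketches per row the norm estimates are good with probability at least `1/2`.
A single sketch is too small with probability at most `11/12`; the number of sketches is what the
union bound over `n` rows takes. The upper bounds follow from Markov's inequality. -/
theorem pr_normGood {γ : ℕ} (hn : n ≤ 2 ^ γ) (hg : IsFourwise g)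
    (hx : ∀ i, dot (x i) (x i) = 1) (i₀ j₀ : Fin n) :
    1 / 2 ≤ pr fun σ : Fin (12 * (γ + 3)) → Fin M =>
      NormGood (12 * (γ + 3)) x i₀ j₀ (normEst g x σ) := by
  classical
  set T := 12 * (γ + 3) with hT
  have hT0 : 0 < T := by omega
  have h1 : pr (fun σ : Fin T → Fin M => ∃ i ∈ (Finset.univ : Finset (Fin n)),
      ¬ 1 / 2 ≤ normEst g x σ i) ≤ 1 / 8 := by
    refine (pr_exists_le _ _).trans ((Finset.sum_le_sum fun i _ => pr_normEst_lt hg hx i).trans ?_)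
    rw [Finset.sum_const, nsmul_eq_mul, Finset.card_univ, Fintype.card_fin]
    have h2 : ((11 : ℝ) / 12) ^ T ≤ (1 / 2) ^ (γ + 3) := by
      rw [hT, pow_mul]
      exact pow_le_pow_left₀ (by positivity) (by norm_num) _
    have h3 : (n : ℝ) ≤ 2 ^ γ := by exact_mod_cast hn
    calc (n : ℝ) * (11 / 12) ^ T ≤ 2 ^ γ * (1 / 2) ^ (γ + 3) := by gcongr
      _ = 1 / 8 := by rw [pow_add, ← mul_assoc, ← mul_pow]; norm_num
  have hone : ∀ i : Fin n, pr (fun σ : Fin T → Fin M => ¬ normEst g x σ i ≤ 8 * T) ≤ 1 / 8 := by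
    intro i
    have := pr_weighted_normEst_gt hT0 hg hx (fun j => if j = i then 1 else 0)
      (fun j => by split_ifs <;> norm_num) (by simp)
    simpa using this
  have hmean := pr_weighted_normEst_gt hT0 hg hx (fun j => dot (x i₀) (x j) ^ 2)
    (fun j => sq_nonneg _) (by
      refine lt_of_lt_of_le (b := dot (x i₀) (x i₀) ^ 2) (by rw [hx]; norm_num) ?_
      exact Finset.single_le_sum (f := fun j => dot (x i₀) (x j) ^ 2)
        (fun u _ => sq_nonneg _) (Finset.mem_univ i₀))
  have hnot : pr (fun σ : Fin T → Fin M => ¬ NormGood T x i₀ j₀ (normEst g x σ)) ≤ 1 / 2 := by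
    calc _ ≤ pr (fun σ : Fin T → Fin M =>
          ((∃ i ∈ (Finset.univ : Finset (Fin n)), ¬ 1 / 2 ≤ normEst g x σ i) ∨
            ¬ normEst g x σ i₀ ≤ 8 * T) ∨ (¬ normEst g x σ j₀ ≤ 8 * T ∨
            ¬ ∑ j, dot (x i₀) (x j) ^ 2 * normEst g x σ j ≤
              8 * T * ∑ j, dot (x i₀) (x j) ^ 2)) := by
          refine pr_mono fun σ h => ?_
          by_contra hc
          simp only [not_or, not_not, not_exists, not_and] at hc
          exact h ⟨fun i => hc.1.1 i (Finset.mem_univ i), hc.1.2, hc.2.1, hc.2.2⟩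
      _ ≤ (1 / 8 + 1 / 8) + (1 / 8 + 1 / 8) :=
          (pr_or_le _ _).trans (add_le_add ((pr_or_le _ _).trans (add_le_add h1 (hone i₀)))
            ((pr_or_le _ _).trans (add_le_add (hone j₀) hmean)))
      _ = 1 / 2 := by norm_num
  rw [pr_not] at hnot
  linarith

/-! ### Detecting the rows of large norm -/

/-- The scaling factor that normalises a vector with estimated squared norm `v`. -/
noncomputable def scaleOf (v : ℝ) : ℝ := 1 / Real.sqrt v

theorem scaleOf_sq {v : ℝ} (hv : 0 ≤ v) : scaleOf v ^ 2 = 1 / v := by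
  rw [scaleOf, div_pow, Real.sq_sqrt hv, one_pow]

theorem scaleOf_sq_le {v : ℝ} (hv : 1 / 2 ≤ v) : scaleOf v ^ 2 ≤ 2 := by
  rw [scaleOf_sq (by linarith), div_le_iff₀ (by linarith)]
  linarith

/-- The estimate of the correlation of row `i` with a sum of all rows with random signs, up to the
factor `r`. The mean of its square is about the squared norm of row `i` of the Gram matrix. -/
noncomputable def rowEst {r : ℕ} (g : Fin M → Fin p → ℝ) (s : Fin M → Fin n → ℝ)
    (x : Fin n → Fin p → ℝ) (v : Fin n → ℝ) (ω : (Fin r → Fin M) × Fin M) (i : Fin n) : ℝ :=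
  dot (s ω.2) fun j => scaleOf (v i) * scaleOf (v j) * est g univ ω.1 (x i) (x j)

variable {s : Fin M → Fin n → ℝ} {r : ℕ}

theorem expect_rowEst_sq (hg : IsFourwise g) (hs : IsFourwise s)
    (hx : ∀ i, dot (x i) (x i) = 1) {v : Fin n → ℝ} (hv : ∀ i, 1 / 2 ≤ v i) (i : Fin n) :
    𝔼 ω : (Fin r → Fin M) × Fin M, rowEst g s x v ω i ^ 2 ≤
      4 * r ^ 2 * ∑ j, dot (x i) (x j) ^ 2 + 8 * r * n := by
  rw [expect_prod]
  have h1 : ∀ σ : Fin r → Fin M, 𝔼 κ, rowEst g s x v (σ, κ) i ^ 2 ≤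
      ∑ j, 4 * est g univ σ (x i) (x j) ^ 2 := by
    intro σ
    simp only [rowEst, pow_two (dot _ _)]
    rw [hs.expect_dot_mul]
    refine Finset.sum_le_sum fun j _ => ?_
    have e1 := scaleOf_sq_le (hv i)
    have e2 := scaleOf_sq_le (hv j)
    have e3 : scaleOf (v i) ^ 2 * scaleOf (v j) ^ 2 ≤ 2 * 2 :=
      mul_le_mul e1 e2 (sq_nonneg _) (by norm_num)
    calc _ = (scaleOf (v i) ^ 2 * scaleOf (v j) ^ 2) * est g univ σ (x i) (x j) ^ 2 := by ring
      _ ≤ (2 * 2) * est g univ σ (x i) (x j) ^ 2 := by gcongr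
      _ = _ := by ring
  refine (expect_mono h1).trans ?_
  rw [Finset.expect_sum_comm]
  calc _ ≤ ∑ j, (4 * (r ^ 2 * dot (x i) (x j) ^ 2) + 8 * r) := by
        refine Finset.sum_le_sum fun j _ => ?_
        rw [← Finset.mul_expect]
        have := hg.expect_est_sq (Finset.univ : Finset (Fin r)) (x i) (x j)
        rw [hx, hx, Finset.card_univ, Fintype.card_fin] at this
        linarith
    _ = _ := by
        rw [Finset.sum_add_distrib, ← Finset.mul_sum, ← Finset.mul_sum, Finset.sum_const,
          Finset.card_univ, Fintype.card_fin, nsmul_eq_mul]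
        ring

/-- A row of large correlation norm is detected with constant probability: with
probability `1/2` the sketches keep a constant fraction of its mass, and then, with probability
`1/12`, the random signs do not cancel. -/
theorem pr_rowEst_ge {T : ℕ} (hT : 0 < T) (hr : 0 < r) (hn : 0 < n) (hg : IsFourwise g)
    (hs : IsFourwise s)
    (hx : ∀ i, dot (x i) (x i) = 1) {v : Fin n → ℝ} {i₀ j₀ : Fin n}
    (hv : NormGood T x i₀ j₀ v) {τ : ℝ} (hτ : 0 < τ)
    (h : 2 * τ + 16 * r * n ≤ r ^ 2 * (∑ j, dot (x i₀) (x j) ^ 2) / (128 * T ^ 2)) :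
    1 / 24 ≤ pr fun ω : (Fin r → Fin M) × Fin M => τ ≤ rowEst g s x v ω i₀ ^ 2 := by
  have hT' : (0 : ℝ) < T := by exact_mod_cast hT
  have hr' : (0 : ℝ) < r := by exact_mod_cast hr
  have hn' : (0 : ℝ) < n := by exact_mod_cast hn
  set ρ := ∑ j, dot (x i₀) (x j) ^ 2 with hρ
  have hρ1 : 1 ≤ ρ := by
    calc (1 : ℝ) = dot (x i₀) (x i₀) ^ 2 := by rw [hx]; norm_num
      _ ≤ ρ := Finset.single_le_sum (f := fun j => dot (x i₀) (x j) ^ 2)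
        (fun u _ => sq_nonneg _) (Finset.mem_univ i₀)
  -- By Cauchy–Schwarz, the normalised row keeps a constant fraction of its mass.
  have hmass : ρ / (8 * T) ≤ ∑ j, dot (x i₀) (x j) ^ 2 * (1 / v j) := by
    have hcs := Finset.sum_mul_sq_le_sq_mul_sq univ
      (fun j => dot (x i₀) (x j) * Real.sqrt (v j)) (fun j => dot (x i₀) (x j) / Real.sqrt (v j))
    have hv0 : ∀ j, 0 < v j := fun j => by linarith [hv.lower j]
    have e1 : ∀ j, dot (x i₀) (x j) * Real.sqrt (v j) * (dot (x i₀) (x j) / Real.sqrt (v j)) =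
        dot (x i₀) (x j) ^ 2 := fun j => by
      have := Real.sqrt_pos.2 (hv0 j)
      field_simp
    have e2 : ∀ j, (dot (x i₀) (x j) * Real.sqrt (v j)) ^ 2 = dot (x i₀) (x j) ^ 2 * v j :=
      fun j => by rw [mul_pow, Real.sq_sqrt (hv0 j).le]
    have e3 : ∀ j, (dot (x i₀) (x j) / Real.sqrt (v j)) ^ 2 =
        dot (x i₀) (x j) ^ 2 * (1 / v j) :=
      fun j => by rw [div_pow, Real.sq_sqrt (hv0 j).le]; ring
    simp only [e1, e2, e3] at hcs
    rw [← hρ] at hcs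
    have h0 : 0 ≤ ∑ j, dot (x i₀) (x j) ^ 2 * (1 / v j) :=
      Finset.sum_nonneg fun j _ => mul_nonneg (sq_nonneg _) (by have := hv0 j; positivity)
    have h2 : ρ ^ 2 ≤ (8 * T * ρ) * ∑ j, dot (x i₀) (x j) ^ 2 * (1 / v j) :=
      hcs.trans (mul_le_mul_of_nonneg_right hv.mean h0)
    rw [div_le_iff₀ (by positivity)]
    have h3 : ρ * ρ ≤ ρ * ((∑ j, dot (x i₀) (x j) ^ 2 * (1 / v j)) * (8 * T)) := by nlinarith
    exact le_of_mul_le_mul_left h3 (by linarith)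
  have hσ : 1 / 2 ≤ pr fun σ : Fin r → Fin M =>
      ∑ j, (est g univ σ (x i₀) (x j) - r * dot (x i₀) (x j)) ^ 2 ≤ 4 * r * n := by
    have h1 : 𝔼 σ : Fin r → Fin M,
        ∑ j, (est g univ σ (x i₀) (x j) - r * dot (x i₀) (x j)) ^ 2 ≤ 2 * r * n := by
      rw [Finset.expect_sum_comm]
      calc _ ≤ ∑ _j : Fin n, (2 : ℝ) * r := by
            refine Finset.sum_le_sum fun j _ => ?_
            have := hg.variance_est (Finset.univ : Finset (Fin r)) (x i₀) (x j)
            rw [hx, hx, Finset.card_univ, Fintype.card_fin] at this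
            linarith
        _ = _ := by simp; ring
    have h2 := pr_markov (f := fun σ : Fin r → Fin M =>
      ∑ j, (est g univ σ (x i₀) (x j) - r * dot (x i₀) (x j)) ^ 2)
      (fun σ => Finset.sum_nonneg fun j _ => sq_nonneg _) (c := 4 * r * n) (by positivity)
    have h3 : (𝔼 σ : Fin r → Fin M,
        ∑ j, (est g univ σ (x i₀) (x j) - r * dot (x i₀) (x j)) ^ 2) / (4 * r * n) ≤ 1 / 2 := by
      rw [div_le_iff₀ (by positivity)]; linarith
    have h4 := pr_not (fun σ : Fin r → Fin M =>
      ∑ j, (est g univ σ (x i₀) (x j) - r * dot (x i₀) (x j)) ^ 2 ≤ 4 * r * n)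
    have h5 : pr (fun σ : Fin r → Fin M =>
        ¬ ∑ j, (est g univ σ (x i₀) (x j) - r * dot (x i₀) (x j)) ^ 2 ≤ 4 * r * n) ≤ 1 / 2 :=
      (pr_mono fun σ h => (not_le.1 h).le).trans (h2.trans h3)
    linarith
  have hkey := pr_prod_ge (B := fun (σ : Fin r → Fin M) (κ : Fin M) =>
    τ ≤ rowEst g s x v (σ, κ) i₀ ^ 2) (q := 1 / 12) (by norm_num) hσ ?_
  · calc (1 : ℝ) / 24 = 1 / 2 * (1 / 12) := by norm_num
      _ ≤ _ := hkey
      _ ≤ _ := pr_mono fun ω h => h.2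
  · intro σ hσ'
    set y : Fin n → ℝ := fun j => scaleOf (v i₀) * scaleOf (v j) * est g univ σ (x i₀) (x j)
      with hy
    have hlow : 2 * τ ≤ dot y y := by
      have hvi : 1 / (8 * (T : ℝ)) ≤ 1 / v i₀ :=
        one_div_le_one_div_of_le (by linarith [hv.lower i₀]) hv.left
      have hterm : ∀ j, (1 / (8 * (T : ℝ))) * (r ^ 2 / 2 * (dot (x i₀) (x j) ^ 2 * (1 / v j)))
          - 4 * (est g univ σ (x i₀) (x j) - r * dot (x i₀) (x j)) ^ 2 ≤ y j * y j := by
        intro j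
        have hvj : 0 < v j := by linarith [hv.lower j]
        have hvi0 : 0 < v i₀ := by linarith [hv.lower i₀]
        have e1 : y j * y j = (1 / v i₀) * (1 / v j) * est g univ σ (x i₀) (x j) ^ 2 := by
          rw [← scaleOf_sq hvj.le, ← scaleOf_sq hvi0.le, hy]; ring
        have e2 : r ^ 2 / 2 * dot (x i₀) (x j) ^ 2 -
            (est g univ σ (x i₀) (x j) - r * dot (x i₀) (x j)) ^ 2 ≤
            est g univ σ (x i₀) (x j) ^ 2 := by
          nlinarith [sq_nonneg (2 * est g univ σ (x i₀) (x j) - r * dot (x i₀) (x j))]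
        have e3 : (1 / v i₀) * (1 / v j) ≤ 4 := by
          have a1 : 1 / v i₀ ≤ 2 := by
            rw [div_le_iff₀ hvi0]; linarith [hv.lower i₀]
          have a2 : 1 / v j ≤ 2 := by
            rw [div_le_iff₀ hvj]; linarith [hv.lower j]
          calc _ ≤ (2 : ℝ) * 2 := mul_le_mul a1 a2 (by positivity) (by norm_num)
            _ = 4 := by norm_num
        have e4 : (1 / (8 * (T : ℝ))) * (r ^ 2 / 2 * (dot (x i₀) (x j) ^ 2 * (1 / v j))) ≤
            (1 / v i₀) * (r ^ 2 / 2 * (dot (x i₀) (x j) ^ 2 * (1 / v j))) := by gcongr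
        have e5 : ((1 / v i₀) * (1 / v j)) *
            (est g univ σ (x i₀) (x j) - r * dot (x i₀) (x j)) ^ 2 ≤
            4 * (est g univ σ (x i₀) (x j) - r * dot (x i₀) (x j)) ^ 2 := by gcongr
        have e6 : ((1 / v i₀) * (1 / v j)) * (r ^ 2 / 2 * dot (x i₀) (x j) ^ 2 -
            (est g univ σ (x i₀) (x j) - r * dot (x i₀) (x j)) ^ 2) ≤
            ((1 / v i₀) * (1 / v j)) * est g univ σ (x i₀) (x j) ^ 2 := by gcongr
        rw [e1]
        nlinarith
      have hsum := Finset.sum_le_sum fun j (_ : j ∈ univ) => hterm j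
      rw [Finset.sum_sub_distrib, ← Finset.mul_sum, ← Finset.mul_sum, ← Finset.mul_sum] at hsum
      have e7 : (1 / (8 * (T : ℝ))) * (r ^ 2 / 2 * (ρ / (8 * T))) ≤
          (1 / (8 * (T : ℝ))) * (r ^ 2 / 2 * ∑ j, dot (x i₀) (x j) ^ 2 * (1 / v j)) := by gcongr
      have e8 : (1 / (8 * (T : ℝ))) * (r ^ 2 / 2 * (ρ / (8 * T))) =
          r ^ 2 * ρ / (128 * T ^ 2) := by field_simp; norm_num
      have e9 : dot y y = ∑ j, y j * y j := rfl
      rw [e9]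
      linarith
    have := hs.anticoncentration y (by linarith)
    refine this.trans (pr_mono fun κ hκ => ?_)
    have : rowEst g s x v (σ, κ) i₀ = dot (s κ) y := rfl
    rw [this]
    linarith

/-- With constant probability the row of large correlation norm is detected, and, by Markov's
inequality, no more than `B` rows reach the threshold. -/
theorem pr_rowEst_good {T B : ℕ} (hT : 0 < T) (hr : 0 < r) (hn : 0 < n) (hB : 0 < B)
    (hg : IsFourwise g) (hs : IsFourwise s)
    (hx : ∀ i, dot (x i) (x i) = 1) {v : Fin n → ℝ} {i₀ j₀ : Fin n}
    (hv : NormGood T x i₀ j₀ v) {τ : ℝ} (hτ : 0 < τ)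
    (h : 2 * τ + 16 * r * n ≤ r ^ 2 * (∑ j, dot (x i₀) (x j) ^ 2) / (128 * T ^ 2))
    (h' : 48 * (4 * r ^ 2 * (∑ i, ∑ j, dot (x i) (x j) ^ 2) + 8 * r * n ^ 2) ≤ τ * B) :
    1 / 48 ≤ pr fun ω : (Fin r → Fin M) × Fin M => τ ≤ rowEst g s x v ω i₀ ^ 2 ∧
      #{i | τ ≤ rowEst g s x v ω i ^ 2} ≤ B := by
  classical
  have hB' : (0 : ℝ) < B := by exact_mod_cast hB
  have h1 := pr_rowEst_ge hT hr hn hg hs hx hv hτ h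
  have h2 : pr (fun ω : (Fin r → Fin M) × Fin M => ¬ #{i | τ ≤ rowEst g s x v ω i ^ 2} ≤ B) ≤
      1 / 48 := by
    have e1 : ∀ ω : (Fin r → Fin M) × Fin M, (#{i | τ ≤ rowEst g s x v ω i ^ 2} : ℝ) ≤
        ∑ i, rowEst g s x v ω i ^ 2 / τ := by
      intro ω
      rw [Finset.card_filter]
      push_cast
      refine Finset.sum_le_sum fun i _ => ?_
      split_ifs with hi
      · rwa [le_div_iff₀ hτ, one_mul]
      · positivity
    calc _ ≤ pr (fun ω : (Fin r → Fin M) × Fin M => (B : ℝ) ≤ ∑ i, rowEst g s x v ω i ^ 2 / τ) := by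
          refine pr_mono fun ω hω => le_trans ?_ (e1 ω)
          exact_mod_cast (not_le.1 hω).le
      _ ≤ (𝔼 ω : (Fin r → Fin M) × Fin M, ∑ i, rowEst g s x v ω i ^ 2 / τ) / B :=
          pr_markov (fun ω => Finset.sum_nonneg fun i _ => by positivity) hB'
      _ ≤ 1 / 48 := by
          rw [div_le_iff₀ hB', Finset.expect_sum_comm]
          calc _ ≤ ∑ i, (4 * r ^ 2 * (∑ j, dot (x i) (x j) ^ 2) + 8 * r * n) / τ := by
                refine Finset.sum_le_sum fun i _ => ?_
                rw [← Finset.expect_div]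
                exact div_le_div_of_nonneg_right (expect_rowEst_sq hg hs hx hv.lower i) hτ.le
            _ = (4 * r ^ 2 * (∑ i, ∑ j, dot (x i) (x j) ^ 2) + 8 * r * n ^ 2) / τ := by
                rw [← Finset.sum_div, Finset.sum_add_distrib, ← Finset.mul_sum, Finset.sum_const,
                  Finset.card_univ, Fintype.card_fin, nsmul_eq_mul]
                ring
            _ ≤ _ := by rw [div_le_iff₀ hτ]; linarith
  have h3 := pr_or_le (fun ω : (Fin r → Fin M) × Fin M => τ ≤ rowEst g s x v ω i₀ ^ 2 ∧
      #{i | τ ≤ rowEst g s x v ω i ^ 2} ≤ B)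
    (fun ω : (Fin r → Fin M) × Fin M => ¬ #{i | τ ≤ rowEst g s x v ω i ^ 2} ≤ B)
  have h4 : pr (fun ω : (Fin r → Fin M) × Fin M => τ ≤ rowEst g s x v ω i₀ ^ 2) ≤
      pr (fun ω : (Fin r → Fin M) × Fin M => (τ ≤ rowEst g s x v ω i₀ ^ 2 ∧
        #{i | τ ≤ rowEst g s x v ω i ^ 2} ≤ B) ∨ ¬ #{i | τ ≤ rowEst g s x v ω i ^ 2} ≤ B) := by
    refine pr_mono fun ω h => ?_
    by_cases hc : #{i | τ ≤ rowEst g s x v ω i ^ 2} ≤ B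
    · exact Or.inl ⟨h, hc⟩
    · exact Or.inr hc
  linarith

end

/-! ### One cell of the product of the bucketed matrices -/

/-- The random labels of the rows: a class in `Fin C` (class `0` is the left side, class `1` the
right side, rows of other classes are dropped), a bucket for the right side, a slot, and for the
left side a bucket for every slot. A row on the right side uses the sketch coordinates of its slot
only; a row on the left side is placed in one bucket per slot. -/
abbrev Labels (n B m C : ℕ) :=
  (Fin n → Fin C) × (Fin n → Fin B) × (Fin n → Fin m) × (Fin n × Fin m → Fin B)

namespace Labels
variable {n B m C : ℕ}

/-- The row is on the left side. -/
def isLeft (L : Labels n B m C) (i : Fin n) : Prop := (L.1 i : ℕ) = 0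

/-- The row is on the right side. -/
def isRight (L : Labels n B m C) (i : Fin n) : Prop := (L.1 i : ℕ) = 1

/-- The bucket of a row on the right side. -/
def bucketR (L : Labels n B m C) (i : Fin n) : Fin B := L.2.1 i

/-- The slot of a row on the right side. -/
def slot (L : Labels n B m C) (i : Fin n) : Fin m := L.2.2.1 i

/-- The bucket in the slot `q` of a row on the left side. -/
def bucketL (L : Labels n B m C) (i : Fin n) (q : Fin m) : Fin B := L.2.2.2 (i, q)

/-- The pair of the row `i` on the left and the row `v` on the right contributes to the cell
`(a, b)`. -/
def InCell (L : Labels n B m C) (a b : Fin B) (i v : Fin n) : Prop :=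
  L.isLeft i ∧ L.isRight v ∧ L.bucketR v = b ∧ L.bucketL i (L.slot v) = a

theorem InCell.ne {L : Labels n B m C} {a b : Fin B} {i v : Fin n} (h : L.InCell a b i v) :
    i ≠ v := by
  rintro rfl
  have h1 := h.1
  have h2 := h.2.1
  rw [isLeft] at h1
  rw [isRight] at h2
  omega

end Labels

section
variable {n p M r B m C : ℕ}

open Classical in
/-- The entry at `(a, b)` of the product of the matrix of the left side and that of the right side.
The row `i` enters with the sign `s κ i`, the weight `α i` or `β i`, and the extra sign `ε i` or
`ε' i`; `sl` maps a sketch coordinate to its slot. -/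
noncomputable def cellValue (g : Fin M → Fin p → ℝ) (s : Fin M → Fin n → ℝ)
    (x : Fin n → Fin p → ℝ) (sl : Fin r → Fin m) (L : Labels n B m C) (α β ε ε' : Fin n → ℝ)
    (ω : Fin M × (Fin r → Fin M)) (a b : Fin B) : ℝ :=
  ∑ l, (∑ i, if L.isLeft i ∧ L.bucketL i (sl l) = a
      then ε i * s ω.1 i * (α i * dot (g (ω.2 l)) (x i)) else 0) *
    ∑ v, if L.isRight v ∧ L.bucketR v = b ∧ L.slot v = sl l
      then ε' v * s ω.1 v * (β v * dot (g (ω.2 l)) (x v)) else 0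

/-- The sketch coordinates of a slot. -/
def fiber (sl : Fin r → Fin m) (q : Fin m) : Finset (Fin r) := univ.filter fun l => sl l = q

variable {g : Fin M → Fin p → ℝ} {s : Fin M → Fin n → ℝ} {x : Fin n → Fin p → ℝ}
  {sl : Fin r → Fin m}

open Classical in
theorem cellValue_eq (L : Labels n B m C) (α β ε ε' : Fin n → ℝ) (ω : Fin M × (Fin r → Fin M))
    (a b : Fin B) : cellValue g s x sl L α β ε ε' ω a b =
      ∑ i, ∑ v, (if L.InCell a b i v then ε i * ε' v * (α i * β v) *
        est g (fiber sl (L.slot v)) ω.2 (x i) (x v) else 0) * (s ω.1 i * s ω.1 v) := by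
  simp only [cellValue, Finset.sum_mul_sum]
  rw [Finset.sum_comm]
  refine Finset.sum_congr rfl fun i _ => ?_
  rw [Finset.sum_comm]
  refine Finset.sum_congr rfl fun v _ => ?_
  by_cases h : L.InCell a b i v
  · rw [if_pos h, est, fiber, Finset.sum_filter, Finset.mul_sum, Finset.sum_mul]
    refine Finset.sum_congr rfl fun l _ => ?_
    obtain ⟨h1, h2, h3, h4⟩ := h
    by_cases hl : sl l = L.slot v
    · rw [if_pos ⟨h1, by rw [hl]; exact h4⟩, if_pos ⟨h2, h3, hl.symm⟩, if_pos hl]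
      ring
    · rw [if_neg (fun hc : _ ∧ _ ∧ _ => hl hc.2.2.symm), if_neg hl]
      ring
  · rw [if_neg h, zero_mul]
    refine Finset.sum_eq_zero fun l _ => ?_
    by_cases hl : L.isLeft i ∧ L.bucketL i (sl l) = a
    · rw [if_neg (fun hc : _ ∧ _ ∧ _ => h ⟨hl.1, hc.1, hc.2.1, by rw [hc.2.2]; exact hl.2⟩),
        mul_zero]
    · rw [if_neg hl, zero_mul]

variable [Nonempty (Fin M)]

open Classical in
/-- The second moment of the deviation of a cell from the contribution of the pair `(i₀, j₀)`. At
most `2 ℓ` sketch coordinates belong to a slot; the terms `1 / ℓ` and `2 / ℓ` stem from the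
variances of the estimates of the inner products. -/
theorem expect_cell_deviation_sq (hg : IsFourwise g) (hs : IsFourwise s)
    (hx : ∀ i, dot (x i) (x i) = 1) {ℓ : ℕ} (hℓ : 0 < ℓ)
    (hsl : ∀ q, #(fiber sl q) ≤ 2 * ℓ)
    (L : Labels n B m C) {α β ε ε' : Fin n → ℝ} (hε : ∀ i, ε i ^ 2 = 1) (hε' : ∀ i, ε' i ^ 2 = 1)
    (hα : ∀ i, α i ^ 2 ≤ 2) (hβ : ∀ i, β i ^ 2 ≤ 2) {a b : Fin B} {i₀ j₀ : Fin n}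
    (h0 : L.InCell a b i₀ j₀) :
    𝔼 ω, (cellValue g s x sl L α β ε ε' ω a b - ε i₀ * ε' j₀ * (α i₀ * β j₀) *
        (#(fiber sl (L.slot j₀)) * dot (x i₀) (x j₀)) * (s ω.1 i₀ * s ω.1 j₀)) ^ 2 ≤
      16 * ℓ ^ 2 * ((∑ i, ∑ v, if L.InCell a b i v ∧ (i, v) ≠ (i₀, j₀)
        then α i ^ 2 * (dot (x i) (x v) ^ 2 + 1 / ℓ) else 0) + 2 / ℓ) := by
  have hℓ' : (0 : ℝ) < ℓ := by exact_mod_cast hℓ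
  -- The deviation is a quadratic form in the signs `s`, with coefficients `c` that depend on the
  -- sketches. It is off-diagonal, because no row is on both sides.
  set c : (Fin r → Fin M) → Fin n → Fin n → ℝ := fun σ i v => if L.InCell a b i v then
    ε i * ε' v * (α i * β v) * (est g (fiber sl (L.slot v)) σ (x i) (x v) -
      if (i, v) = (i₀, j₀) then #(fiber sl (L.slot v)) * dot (x i) (x v) else 0) else 0 with hc
  have hdev : ∀ ω : Fin M × (Fin r → Fin M), cellValue g s x sl L α β ε ε' ω a b -
      ε i₀ * ε' j₀ * (α i₀ * β j₀) * (#(fiber sl (L.slot j₀)) * dot (x i₀) (x j₀)) *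
        (s ω.1 i₀ * s ω.1 j₀) = ∑ i, ∑ v, c ω.2 i v * (s ω.1 i * s ω.1 v) := by
    intro ω
    have h1 : ε i₀ * ε' j₀ * (α i₀ * β j₀) * (#(fiber sl (L.slot j₀)) * dot (x i₀) (x j₀)) *
        (s ω.1 i₀ * s ω.1 j₀) = ∑ i, ∑ v, (if (i, v) = (i₀, j₀) then
          ε i * ε' v * (α i * β v) * (#(fiber sl (L.slot v)) * dot (x i) (x v)) else 0) *
            (s ω.1 i * s ω.1 v) := by
      rw [Finset.sum_eq_single i₀, Finset.sum_eq_single j₀]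
      · simp
      · intro v _ hv; simp [hv]
      · simp
      · intro i _ hi; simp [hi]
      · simp
    rw [cellValue_eq, h1, ← Finset.sum_sub_distrib]
    refine Finset.sum_congr rfl fun i _ => ?_
    rw [← Finset.sum_sub_distrib]
    refine Finset.sum_congr rfl fun v _ => ?_
    rw [← sub_mul, hc]
    by_cases hiv : L.InCell a b i v
    · simp only [if_pos hiv]
      split_ifs <;> ring
    · have : (i, v) ≠ (i₀, j₀) := by
        rintro h
        rw [Prod.mk.injEq] at h
        rw [h.1, h.2] at hiv
        exact hiv h0
      simp [hiv, this]
  have hquad : ∀ σ, 𝔼 κ, (∑ i, ∑ v, c σ i v * (s κ i * s κ v)) ^ 2 ≤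
      2 * ∑ i, ∑ v, c σ i v ^ 2 := by
    intro σ
    refine hs.quad _ fun i => ?_
    rw [hc]
    exact if_neg fun h => h.ne rfl
  have hentry : ∀ i v, 𝔼 σ, c σ i v ^ 2 ≤
      8 * ℓ ^ 2 * ((if L.InCell a b i v ∧ (i, v) ≠ (i₀, j₀)
        then α i ^ 2 * (dot (x i) (x v) ^ 2 + 1 / ℓ) else 0) +
          if (i, v) = (i₀, j₀) then 2 / (ℓ : ℝ) else 0) := by
    intro i v
    by_cases hiv : L.InCell a b i v
    · have hcard : (#(fiber sl (L.slot v)) : ℝ) ≤ 2 * ℓ := by exact_mod_cast hsl _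
      have hcard0 : (0 : ℝ) ≤ #(fiber sl (L.slot v)) := Nat.cast_nonneg _
      have hβv := hβ v
      by_cases heq : (i, v) = (i₀, j₀)
      · have e : ∀ σ, c σ i v ^ 2 = (α i ^ 2 * β v ^ 2) *
            (est g (fiber sl (L.slot v)) σ (x i) (x v) -
              #(fiber sl (L.slot v)) * dot (x i) (x v)) ^ 2 := by
          intro σ
          simp only [hc, if_pos hiv, if_pos heq, mul_pow, hε, hε']
          ring
        have hvar := hg.variance_est (fiber sl (L.slot v)) (x i) (x v)
        rw [hx, hx] at hvar
        simp only [e, ← Finset.mul_expect]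
        rw [if_neg (fun h : L.InCell a b i v ∧ (i, v) ≠ (i₀, j₀) => h.2 heq), if_pos heq, zero_add]
        have h4 : α i ^ 2 * β v ^ 2 ≤ 2 * 2 :=
          mul_le_mul (hα i) hβv (sq_nonneg _) (by norm_num)
        calc _ ≤ (2 * 2) * (2 * ℓ * (2 * (1 * 1)) : ℝ) :=
              mul_le_mul h4 (hvar.trans (by gcongr))
                (Finset.expect_nonneg fun σ _ => sq_nonneg _) (by norm_num)
          _ = 8 * ℓ ^ 2 * (2 / ℓ) := by field_simp; norm_num
      · have e : ∀ σ, c σ i v ^ 2 = (α i ^ 2 * β v ^ 2) *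
            est g (fiber sl (L.slot v)) σ (x i) (x v) ^ 2 := by
          intro σ
          simp only [hc, if_pos hiv, if_neg heq, mul_pow, hε, hε']
          ring
        have hsq := hg.expect_est_sq (fiber sl (L.slot v)) (x i) (x v)
        rw [hx, hx] at hsq
        simp only [e, ← Finset.mul_expect]
        rw [if_pos ⟨hiv, heq⟩, if_neg heq, add_zero]
        calc _ ≤ (α i ^ 2 * 2) * ((2 * ℓ) ^ 2 * dot (x i) (x v) ^ 2 + 2 * ℓ * (2 * (1 * 1))) :=
              mul_le_mul (by gcongr) (hsq.trans (by gcongr))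
                (Finset.expect_nonneg fun σ _ => sq_nonneg _) (by positivity)
          _ = 8 * ℓ ^ 2 * (α i ^ 2 * (dot (x i) (x v) ^ 2 + 1 / ℓ)) := by
              field_simp; ring
    · have e : ∀ σ, c σ i v ^ 2 = 0 := fun σ => by simp [hc, hiv]
      simp only [e, Finset.expect_const_zero]
      have h5 : (0 : ℝ) ≤ if L.InCell a b i v ∧ (i, v) ≠ (i₀, j₀)
        then α i ^ 2 * (dot (x i) (x v) ^ 2 + 1 / ℓ) else 0 := by split_ifs <;> positivity
      have h6 : (0 : ℝ) ≤ if (i, v) = (i₀, j₀) then 2 / (ℓ : ℝ) else 0 := by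
        split_ifs <;> positivity
      positivity
  simp only [hdev]
  rw [expect_prod, expect_swap]
  refine (expect_mono hquad).trans ?_
  rw [← Finset.mul_expect, Finset.expect_sum_comm]
  have hsum : ∑ i, 𝔼 σ, ∑ v, c σ i v ^ 2 ≤ ∑ i, ∑ v, 8 * (ℓ : ℝ) ^ 2 *
      ((if L.InCell a b i v ∧ (i, v) ≠ (i₀, j₀)
        then α i ^ 2 * (dot (x i) (x v) ^ 2 + 1 / ℓ) else 0) +
          if (i, v) = (i₀, j₀) then 2 / (ℓ : ℝ) else 0) :=
    Finset.sum_le_sum fun i _ => by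
      rw [Finset.expect_sum_comm]
      exact Finset.sum_le_sum fun v _ => hentry i v
  have hone : ∑ i, ∑ v, (if (i, v) = (i₀, j₀) then 2 / (ℓ : ℝ) else 0) = 2 / ℓ := by
    rw [Finset.sum_eq_single i₀, Finset.sum_eq_single j₀]
    · simp
    · intro v _ hv; simp [hv]
    · simp
    · intro i _ hi; simp [hi]
    · simp
  simp only [← Finset.mul_sum, Finset.sum_add_distrib] at hsum
  rw [hone] at hsum
  linarith

open Classical in
/-- For fixed labels that put `i₀` on the left and `j₀` on the right, all the tests `t`, with extra
signs `ε t` and `ε' t`, see the contribution of the pair `(i₀, j₀)` in its cell, unless a pair of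
weight `w ≥ 1` is in the same cell or the other pairs in the cell weigh too much. The probability is
that over the signs and the sketches. -/
theorem pr_cell_good {K : Type*} [Fintype K] (hg : IsFourwise g) (hs : IsFourwise s)
    (hx : ∀ i, dot (x i) (x i) = 1) {ℓ T : ℕ} (hℓ : 0 < ℓ) (hT : 0 < T)
    (hsl : ∀ q, #(fiber sl q) ≤ 2 * ℓ) (hsl' : ∀ q, ℓ ≤ #(fiber sl q))
    (L : Labels n B m C) {α β : Fin n → ℝ} {ε ε' : K → Fin n → ℝ}
    (hε : ∀ t i, ε t i ^ 2 = 1) (hε' : ∀ t i, ε' t i ^ 2 = 1)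
    (hα : ∀ i, α i ^ 2 ≤ 2) (hβ : ∀ i, β i ^ 2 ≤ 2) {a b : Fin B} {i₀ j₀ : Fin n}
    (hα0 : 1 / (8 * T) ≤ α i₀ ^ 2) (hβ0 : 1 / (8 * T) ≤ β j₀ ^ 2)
    (h0 : L.InCell a b i₀ j₀) {φ : ℝ} (hφ : 0 < φ) (hC : φ ≤ |dot (x i₀) (x j₀)|)
    {w : Fin n → Fin n → ℝ} {G : ℝ} (hG : G = Fintype.card K * 1024 * T ^ 2)
    (hw0 : ∀ i v, 0 ≤ w i v) (hw : ∀ i v, 1 ≤ w i v ∨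
      G / φ ^ 2 * (α i ^ 2 * (dot (x i) (x v) ^ 2 + 1 / ℓ)) ≤ w i v) :
    1 - (∑ i, ∑ v, if L.InCell a b i v ∧ (i, v) ≠ (i₀, j₀) then w i v else 0) -
        G / φ ^ 2 * (2 / ℓ) ≤
      pr fun ω : Fin M × (Fin r → Fin M) => ∀ t,
        |cellValue g s x sl L α β (ε t) (ε' t) ω a b - ε t i₀ * ε' t j₀ * (α i₀ * β j₀) *
          (#(fiber sl (L.slot j₀)) * dot (x i₀) (x j₀)) * (s ω.1 i₀ * s ω.1 j₀)| <
        |ε t i₀ * ε' t j₀ * (α i₀ * β j₀) *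
          (#(fiber sl (L.slot j₀)) * dot (x i₀) (x j₀)) * (s ω.1 i₀ * s ω.1 j₀)| := by
  have hℓ' : (0 : ℝ) < ℓ := by exact_mod_cast hℓ
  have hT' : (0 : ℝ) < T := by exact_mod_cast hT
  have hG0 : 0 ≤ G := by rw [hG]; positivity
  set W : ℝ := ∑ i, ∑ v, if L.InCell a b i v ∧ (i, v) ≠ (i₀, j₀) then w i v else 0 with hW
  have hterm0 : ∀ i v, (0 : ℝ) ≤ if L.InCell a b i v ∧ (i, v) ≠ (i₀, j₀) then w i v else 0 :=
    fun i v => by split_ifs; exacts [hw0 i v, le_rfl]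
  -- If a pair of weight at least `1` is in the cell, the claimed bound is not positive.
  by_cases hbig : ∃ i v, (L.InCell a b i v ∧ (i, v) ≠ (i₀, j₀)) ∧ 1 ≤ w i v
  · obtain ⟨i, v, hiv, h1⟩ := hbig
    have hWge : 1 ≤ W := by
      calc (1 : ℝ) ≤ if L.InCell a b i v ∧ (i, v) ≠ (i₀, j₀) then w i v else 0 := by
            rwa [if_pos hiv]
        _ ≤ ∑ v, if L.InCell a b i v ∧ (i, v) ≠ (i₀, j₀) then w i v else 0 :=
            Finset.single_le_sum (f := fun v => if L.InCell a b i v ∧ (i, v) ≠ (i₀, j₀)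
              then w i v else 0) (fun v _ => hterm0 i v) (Finset.mem_univ v)
        _ ≤ W := Finset.single_le_sum (f := fun i => ∑ v, if L.InCell a b i v ∧ (i, v) ≠ (i₀, j₀)
              then w i v else 0) (fun i _ => Finset.sum_nonneg fun v _ => hterm0 i v)
              (Finset.mem_univ i)
    have h2 : 0 ≤ G / φ ^ 2 * (2 / ℓ) := by positivity
    have h3 : 1 - W - G / φ ^ 2 * (2 / ℓ) ≤ 0 := by linarith
    exact h3.trans (pr_nonneg _)
  · push Not at hbig
    set F : ℝ := ((#(fiber sl (L.slot j₀)) : ℕ) : ℝ) with hF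
    have hFge : (ℓ : ℝ) ≤ F := by rw [hF]; exact_mod_cast hsl' _
    set main : K → Fin M × (Fin r → Fin M) → ℝ := fun t ω => ε t i₀ * ε' t j₀ * (α i₀ * β j₀) *
      (F * dot (x i₀) (x j₀)) * (s ω.1 i₀ * s ω.1 j₀) with hmain
    -- `D` is a lower bound for the square of the main term. By Markov's inequality, the squared
    -- deviations, summed over all tests, are likely to be less.
    set D : ℝ := ℓ ^ 2 * φ ^ 2 / (64 * T ^ 2) with hD
    have hD0 : 0 < D := by positivity
    have hmain2 : ∀ t ω, D ≤ main t ω ^ 2 := by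
      intro t ω
      have e1 : main t ω ^ 2 = (α i₀ ^ 2 * β j₀ ^ 2) * (F ^ 2 * dot (x i₀) (x j₀) ^ 2) := by
        have s1 : s ω.1 i₀ ^ 2 = 1 := by rw [pow_two]; exact hs.sq _ _
        have s2 : s ω.1 j₀ ^ 2 = 1 := by rw [pow_two]; exact hs.sq _ _
        simp only [hmain, mul_pow, hε, hε', s1, s2]; ring
      have e2 : φ ^ 2 ≤ dot (x i₀) (x j₀) ^ 2 := by
        rw [← sq_abs (dot _ _)]; exact pow_le_pow_left₀ hφ.le hC 2
      calc D = (1 / (8 * T) * (1 / (8 * T))) * (ℓ ^ 2 * φ ^ 2) := by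
            rw [hD]; field_simp; norm_num
        _ ≤ _ := by rw [e1]; gcongr
    have hfail : pr (fun ω => ¬ ∀ t, |cellValue g s x sl L α β (ε t) (ε' t) ω a b - main t ω| <
        |main t ω|) ≤ W + G / φ ^ 2 * (2 / ℓ) := by
      set U : Fin M × (Fin r → Fin M) → ℝ := fun ω =>
        ∑ t, (cellValue g s x sl L α β (ε t) (ε' t) ω a b - main t ω) ^ 2 with hU
      have h1 : pr (fun ω => ¬ ∀ t, |cellValue g s x sl L α β (ε t) (ε' t) ω a b - main t ω| <
          |main t ω|) ≤ pr fun ω => D ≤ U ω := by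
        refine pr_mono fun ω h => ?_
        push Not at h
        obtain ⟨t, ht⟩ := h
        calc D ≤ main t ω ^ 2 := hmain2 t ω
          _ ≤ (cellValue g s x sl L α β (ε t) (ε' t) ω a b - main t ω) ^ 2 := sq_le_sq.2 ht
          _ ≤ U ω := Finset.single_le_sum
              (f := fun t => (cellValue g s x sl L α β (ε t) (ε' t) ω a b - main t ω) ^ 2)
              (fun t _ => sq_nonneg _) (Finset.mem_univ t)
      have h2 := pr_markov (f := U) (fun ω => Finset.sum_nonneg fun t _ => sq_nonneg _) hD0
      refine h1.trans (h2.trans ?_)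
      rw [div_le_iff₀ hD0, hU, Finset.expect_sum_comm]
      set S : ℝ := ∑ i, ∑ v, if L.InCell a b i v ∧ (i, v) ≠ (i₀, j₀)
        then α i ^ 2 * (dot (x i) (x v) ^ 2 + 1 / ℓ) else 0 with hS
      have h3 : ∀ t, 𝔼 ω, (cellValue g s x sl L α β (ε t) (ε' t) ω a b - main t ω) ^ 2 ≤
          16 * ℓ ^ 2 * (S + 2 / ℓ) := fun t =>
        expect_cell_deviation_sq hg hs hx hℓ hsl L (hε t) (hε' t) hα hβ h0
      refine (Finset.sum_le_sum fun t _ => h3 t).trans ?_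
      rw [Finset.sum_const, Finset.card_univ, nsmul_eq_mul]
      have h4 : G / φ ^ 2 * S ≤ W := by
        rw [hS, Finset.mul_sum]
        refine Finset.sum_le_sum fun i _ => ?_
        rw [Finset.mul_sum]
        refine Finset.sum_le_sum fun v _ => ?_
        split_ifs with hiv
        · exact (hw i v).resolve_left (not_le.2 (hbig i v hiv))
        · simp
      have h5 : (Fintype.card K : ℝ) * (16 * ℓ ^ 2 * (S + 2 / ℓ)) =
          (G / φ ^ 2 * S + G / φ ^ 2 * (2 / ℓ)) * D := by
        rw [hD, hG]; field_simp; ring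
      rw [h5]
      gcongr
    rw [pr_not] at hfail
    linarith

end

/-! ### Collisions of random labels -/

theorem pr_prod {Ω Ω' : Type*} [Fintype Ω] [Fintype Ω'] (p : Ω × Ω' → Prop) :
    pr p = 𝔼 a, pr fun b => p (a, b) := by
  simp only [pr, expect_prod]

theorem pr_prod_le {Ω Ω' : Type*} [Fintype Ω] [Fintype Ω'] {A : Ω → Prop} {B : Ω → Ω' → Prop}
    {p q : ℝ} (hq : 0 ≤ q) (hA : pr A ≤ p) (hB : ∀ a, pr (B a) ≤ q) :
    pr (fun x : Ω × Ω' => A x.1 ∧ B x.1 x.2) ≤ p * q := by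
  classical
  rw [pr, expect_prod]
  calc _ ≤ 𝔼 a, (if A a then (1 : ℝ) else 0) * q := expect_mono fun a => by
        by_cases h : A a
        · simpa [h, pr] using hB a
        · simp [h]
    _ = pr A * q := by rw [pr, Finset.expect_mul]
    _ ≤ p * q := mul_le_mul_of_nonneg_right hA hq

section
variable {n B m C : ℕ}

/-- A bound for the probability that the pair `(i, v)` is in the cell of the pair `(i₀, j₀)`,
conditional on `i₀` being on the left and `j₀` on the right. -/
noncomputable def collisionBound (B m C : ℕ) (i₀ j₀ i v : Fin n) : ℝ :=
  if i = i₀ then 1 / (C * B) * (1 / m + 1 / B) else if v = j₀ then 1 / (C * B) else 1 / (C * B) ^ 2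

theorem pr_classes_eq (hC : 2 ≤ C) {i₀ j₀ : Fin n} (h : i₀ ≠ j₀) :
    pr (fun c : Fin n → Fin C => (c i₀ : ℕ) = 0 ∧ (c j₀ : ℕ) = 1) = (1 / (C : ℝ)) ^ 2 := by
  classical
  have : Nonempty (Fin C) := ⟨⟨0, by omega⟩⟩
  have h1 := pr_fun_eq ({i₀, j₀} : Finset (Fin n))
    (fun x => if x = i₀ then (⟨0, by omega⟩ : Fin C) else ⟨1, by omega⟩)
  rw [Finset.card_pair h, Fintype.card_fin] at h1
  rw [← h1]
  congr 1
  funext c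
  simp only [Finset.mem_insert, Finset.mem_singleton, forall_eq_or_imp, forall_eq, if_neg h.symm,
    if_true]
  simp only [Fin.ext_iff]

theorem pr_classes_le (hC : 2 ≤ C) {i₀ j₀ i v : Fin n} (S : Finset (Fin n))
    (hS : ∀ x ∈ S, x = i₀ ∨ x = j₀ ∨ x = i ∨ x = v) :
    pr (fun c : Fin n → Fin C => ((c i₀ : ℕ) = 0 ∧ (c j₀ : ℕ) = 1) ∧ (c i : ℕ) = 0 ∧
      (c v : ℕ) = 1) ≤ (1 / (C : ℝ)) ^ #S := by
  classical
  have : Nonempty (Fin C) := ⟨⟨0, by omega⟩⟩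
  have h1 := pr_fun_eq S
    (fun x => if x = i₀ ∨ x = i then (⟨0, by omega⟩ : Fin C) else ⟨1, by omega⟩)
  rw [Fintype.card_fin] at h1
  rw [← h1]
  refine pr_mono fun c hc x hx => ?_
  obtain ⟨⟨h2, h3⟩, h4, h5⟩ := hc
  by_cases hxx : x = i₀ ∨ x = i
  · rw [if_pos hxx]
    rcases hxx with rfl | rfl <;> exact Fin.ext (by simpa)
  · rw [if_neg hxx]
    rcases hS x hx with rfl | rfl | rfl | rfl
    · exact absurd (Or.inl rfl) hxx
    · exact Fin.ext (by simpa)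
    · exact absurd (Or.inr rfl) hxx
    · exact Fin.ext (by simpa)

/-- If `i₀` is on the left and `j₀` on the right, then another pair is rarely in the same cell. A
pair `(i₀, v)` has the bucket of its left row in common with `(i₀, j₀)` if `v` uses the slot of
`j₀`; therefore the bound for such pairs improves with the number `m` of slots. -/
theorem pr_inCell_le (hC : 2 ≤ C) (hB : 0 < B) (hm : 0 < m) {i₀ j₀ : Fin n} (h : i₀ ≠ j₀)
    {i v : Fin n} (hiv : (i, v) ≠ (i₀, j₀)) :
    pr (fun L : Labels n B m C => (L.isLeft i₀ ∧ L.isRight j₀) ∧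
      L.InCell (L.bucketL i₀ (L.slot j₀)) (L.bucketR j₀) i v) ≤
      (1 / (C : ℝ)) ^ 2 * collisionBound B m C i₀ j₀ i v := by
  classical
  have : Nonempty (Fin C) := ⟨⟨0, by omega⟩⟩
  have : Nonempty (Fin B) := ⟨⟨0, by omega⟩⟩
  have : Nonempty (Fin m) := ⟨⟨0, by omega⟩⟩
  have hC' : (0 : ℝ) < C := by exact_mod_cast (by omega : 0 < C)
  have hB' : (0 : ℝ) < B := by exact_mod_cast hB
  have hm' : (0 : ℝ) < m := by exact_mod_cast hm
  -- The labels are independent, so that the probability is a product.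
  have key : ∀ (S : Finset (Fin n)) (q₁ q₂ : ℝ), 0 ≤ q₁ → 0 ≤ q₂ →
      (∀ x ∈ S, x = i₀ ∨ x = j₀ ∨ x = i ∨ x = v) →
      pr (fun c : Fin n → Fin B => c v = c j₀) ≤ q₁ →
      pr (fun c : (Fin n → Fin m) × (Fin n × Fin m → Fin B) =>
        c.2 (i, c.1 v) = c.2 (i₀, c.1 j₀)) ≤ q₂ →
      pr (fun L : Labels n B m C => (L.isLeft i₀ ∧ L.isRight j₀) ∧
        L.InCell (L.bucketL i₀ (L.slot j₀)) (L.bucketR j₀) i v) ≤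
        (1 / (C : ℝ)) ^ #S * (q₁ * q₂) := by
    intro S q₁ q₂ hq₁ hq₂ hS h1 h2
    refine (pr_mono ?_).trans (pr_prod_le (Ω := Fin n → Fin C)
      (Ω' := (Fin n → Fin B) × (Fin n → Fin m) × (Fin n × Fin m → Fin B))
      (B := fun _ (y : (Fin n → Fin B) × (Fin n → Fin m) × (Fin n × Fin m → Fin B)) =>
        y.1 v = y.1 j₀ ∧ y.2.2 (i, y.2.1 v) = y.2.2 (i₀, y.2.1 j₀)) (mul_nonneg hq₁ hq₂)
      (pr_classes_le hC (i₀ := i₀) (j₀ := j₀) (i := i) (v := v) S hS) fun _ =>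
        pr_prod_le (B := fun _ (c : (Fin n → Fin m) × (Fin n × Fin m → Fin B)) =>
          c.2 (i, c.1 v) = c.2 (i₀, c.1 j₀)) hq₂ h1 fun _ => h2)
    rintro L ⟨⟨h3, h4⟩, h5, h6, h7, h8⟩
    exact ⟨⟨⟨h3, h4⟩, h5, h6⟩, h7, h8⟩
  have hzero : (i = j₀ ∨ v = i₀ ∨ i = v) → pr (fun L : Labels n B m C =>
      (L.isLeft i₀ ∧ L.isRight j₀) ∧
        L.InCell (L.bucketL i₀ (L.slot j₀)) (L.bucketR j₀) i v) ≤ 0 := by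
    intro hc
    rw [pr]
    refine le_of_eq (Finset.expect_eq_zero fun L _ => if_neg ?_)
    rintro ⟨⟨h3, h4⟩, h5⟩
    have h6 := h5.1
    have h7 := h5.2.1
    rw [Labels.isLeft] at h3 h6
    rw [Labels.isRight] at h4 h7
    rcases hc with rfl | rfl | rfl <;> omega
  have hcb0 : 0 ≤ collisionBound B m C i₀ j₀ i v := by
    rw [collisionBound]; split_ifs <;> positivity
  by_cases hc : i = j₀ ∨ v = i₀ ∨ i = v
  · exact (hzero hc).trans (by positivity)
  simp only [not_or] at hc
  obtain ⟨hij, hvi, hivne⟩ := hc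
  have hR : v ≠ j₀ → pr (fun c : Fin n → Fin B => c v = c j₀) ≤ 1 / B := fun hvj => by
    rw [pr_fun_collide hvj, Fintype.card_fin]
  have hL : i ≠ i₀ → pr (fun c : (Fin n → Fin m) × (Fin n × Fin m → Fin B) =>
      c.2 (i, c.1 v) = c.2 (i₀, c.1 j₀)) ≤ 1 / B := by
    intro hii
    have := pr_prod_le (A := fun _ : Fin n → Fin m => True)
      (B := fun (c : Fin n → Fin m) (y : Fin n × Fin m → Fin B) => y (i, c v) = y (i₀, c j₀))
      (p := 1) (q := 1 / (B : ℝ)) (by positivity) (pr_le_one _) fun c => by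
        rw [pr_fun_collide (by simp [hii]), Fintype.card_fin]
    rw [one_mul] at this
    exact (pr_mono fun c hc => ⟨trivial, hc⟩).trans this
  by_cases hii : i = i₀
  · have hvj : v ≠ j₀ := fun h => hiv (by rw [hii, h])
    rw [collisionBound, if_pos hii]
    refine (key {i₀, j₀, v} (1 / B) (1 / m + 1 / B) (by positivity) (by positivity) (by simp)
      (hR hvj) ?_).trans (le_of_eq ?_)
    · subst hii
      have e1 : pr (fun c : (Fin n → Fin m) × (Fin n × Fin m → Fin B) => c.1 v = c.1 j₀) ≤
          1 / m := by
        rw [pr_fst (fun c : Fin n → Fin m => c v = c j₀), pr_fun_collide hvj, Fintype.card_fin]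
      have e2 : pr (fun c : (Fin n → Fin m) × (Fin n × Fin m → Fin B) =>
          c.1 v ≠ c.1 j₀ ∧ c.2 (i, c.1 v) = c.2 (i, c.1 j₀)) ≤ 1 / B := by
        have := pr_prod_le (A := fun _ : Fin n → Fin m => True)
          (B := fun (c : Fin n → Fin m) (y : Fin n × Fin m → Fin B) =>
            c v ≠ c j₀ ∧ y (i, c v) = y (i, c j₀))
          (p := 1) (q := 1 / (B : ℝ)) (by positivity) (pr_le_one _) fun c => by
            by_cases hcc : c v = c j₀
            · simp [hcc, pr]
            · refine (pr_mono fun y hy => hy.2).trans ?_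
              rw [pr_fun_collide (by simp [hcc]), Fintype.card_fin]
        rw [one_mul] at this
        exact (pr_mono fun c hc => ⟨trivial, hc⟩).trans this
      refine (pr_mono fun c hc => ?_).trans ((pr_or_le _ _).trans (add_le_add e1 e2))
      by_cases hcc : c.1 v = c.1 j₀
      · exact Or.inl hcc
      · exact Or.inr ⟨hcc, hc⟩
    · rw [Finset.card_insert_of_notMem (by simp [h, Ne.symm hvi]),
        Finset.card_pair (Ne.symm hvj)]
      simp only [one_div, inv_pow]
      field_simp
  · by_cases hvj : v = j₀
    · rw [collisionBound, if_neg hii, if_pos hvj]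
      have : Nonempty (Fin n → Fin B) := inferInstance
      refine (key {i₀, j₀, i} 1 (1 / B) (by positivity) (by positivity) (by simp)
        (pr_le_one _) (hL hii)).trans (le_of_eq ?_)
      rw [Finset.card_insert_of_notMem (by simp [h, Ne.symm hii]),
        Finset.card_pair (Ne.symm hij)]
      simp only [one_div, inv_pow]
      field_simp
    · rw [collisionBound, if_neg hii, if_neg hvj]
      refine (key {i₀, j₀, i, v} (1 / B) (1 / B) (by positivity) (by positivity) (by simp)
        (hR hvj) (hL hii)).trans (le_of_eq ?_)
      rw [Finset.card_insert_of_notMem (by simp [h, Ne.symm hii, Ne.symm hvi]),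
        Finset.card_insert_of_notMem (by simp [Ne.symm hij, Ne.symm hvj]),
        Finset.card_pair hivne]
      simp only [one_div, inv_pow]
      field_simp

theorem sum_collisionBound_le {i₀ j₀ : Fin n} {w : Fin n → Fin n → ℝ} (hw : ∀ i v, 0 ≤ w i v) :
    ∑ i, ∑ v, w i v * collisionBound B m C i₀ j₀ i v ≤
      (∑ v, w i₀ v) * (1 / (C * B) * (1 / m + 1 / B)) + (∑ i, w i j₀) * (1 / (C * B)) +
        (∑ i, ∑ v, w i v) * (1 / (C * B) ^ 2) := by
  have h1 : ∀ i v, w i v * collisionBound B m C i₀ j₀ i v ≤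
      (if i = i₀ then w i v * (1 / (C * B) * (1 / m + 1 / B)) else 0) +
        (if v = j₀ then w i v * (1 / (C * B)) else 0) + w i v * (1 / (C * B) ^ 2) := by
    intro i v
    have a0 := hw i v
    have a1 : (0 : ℝ) ≤ w i v * (1 / (C * B) * (1 / m + 1 / B)) := by positivity
    have a2 : (0 : ℝ) ≤ w i v * (1 / (C * B)) := by positivity
    have a3 : (0 : ℝ) ≤ w i v * (1 / (C * B) ^ 2) := by positivity
    rw [collisionBound]
    split_ifs <;> linarith
  refine (Finset.sum_le_sum fun i _ => Finset.sum_le_sum fun v _ => h1 i v).trans (le_of_eq ?_)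
  simp only [Finset.sum_add_distrib, Finset.sum_mul]
  congr 1
  congr 1
  · rw [Finset.sum_eq_single i₀]
    · simp
    · intro i _ hi; simp [hi]
    · simp
  · refine Finset.sum_congr rfl fun i _ => ?_
    simp

end

section
variable {n p M r B m C : ℕ} [Nonempty (Fin M)] {g : Fin M → Fin p → ℝ} {s : Fin M → Fin n → ℝ}
  {x : Fin n → Fin p → ℝ} {sl : Fin r → Fin m}

/-- The labels and sketches `ω` reveal the pair `(i₀, j₀)` to all the tests `t`: in the cell of the
pair, its contribution dominates. -/
def Reveals {K : Type*} (g : Fin M → Fin p → ℝ) (s : Fin M → Fin n → ℝ)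
    (x : Fin n → Fin p → ℝ) (sl : Fin r → Fin m) (α β : Fin n → ℝ) (ε ε' : K → Fin n → ℝ)
    (i₀ j₀ : Fin n) (ω : Labels n B m C × Fin M × (Fin r → Fin M)) : Prop :=
  ∃ (a b : Fin B) (c : ℝ), ∀ t, |cellValue g s x sl ω.1 α β (ε t) (ε' t) ω.2 a b -
    ε t i₀ * ε' t j₀ * c| < |ε t i₀ * ε' t j₀ * c|

set_option maxHeartbeats 800000 in
/-- The pair `(i₀, j₀)` is put on the two sides with probability `C⁻²`, and is then revealed with
probability at least `1/2`, if the weights of the other pairs, counted with the probabilities of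
collisions, are small in total. This is `pr_cell_good`, averaged over the labels. -/
theorem pr_reveals {K : Type*} [Fintype K] (hg : IsFourwise g) (hs : IsFourwise s)
    (hx : ∀ i, dot (x i) (x i) = 1) {ℓ T : ℕ} (hℓ : 0 < ℓ) (hT : 0 < T)
    (hsl : ∀ q, #(fiber sl q) ≤ 2 * ℓ) (hsl' : ∀ q, ℓ ≤ #(fiber sl q))
    (hC : 2 ≤ C) (hB : 0 < B) (hm : 0 < m)
    {α β : Fin n → ℝ} {ε ε' : K → Fin n → ℝ}
    (hε : ∀ t i, ε t i ^ 2 = 1) (hε' : ∀ t i, ε' t i ^ 2 = 1)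
    (hα : ∀ i, α i ^ 2 ≤ 2) (hβ : ∀ i, β i ^ 2 ≤ 2) {i₀ j₀ : Fin n} (h : i₀ ≠ j₀)
    (hα0 : 1 / (8 * T) ≤ α i₀ ^ 2) (hβ0 : 1 / (8 * T) ≤ β j₀ ^ 2)
    {φ : ℝ} (hφ : 0 < φ) (hc : φ ≤ |dot (x i₀) (x j₀)|)
    {w : Fin n → Fin n → ℝ} {G : ℝ} (hG : G = Fintype.card K * 1024 * T ^ 2)
    (hw0 : ∀ i v, 0 ≤ w i v) (hw : ∀ i v, 1 ≤ w i v ∨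
      G / φ ^ 2 * (α i ^ 2 * (dot (x i) (x v) ^ 2 + 1 / ℓ)) ≤ w i v)
    (htot : (∑ v, w i₀ v) * (1 / (C * B) * (1 / m + 1 / B)) + (∑ i, w i j₀) * (1 / (C * B)) +
        (∑ i, ∑ v, w i v) * (1 / (C * B) ^ 2) + G / φ ^ 2 * (2 / ℓ) ≤ 1 / 2) :
    1 / (2 * (C : ℝ) ^ 2) ≤
      pr fun ω : Labels n B m C × Fin M × (Fin r → Fin M) =>
        Reveals g s x sl α β ε ε' i₀ j₀ ω := by
  classical
  have : Nonempty (Fin C) := ⟨⟨0, by omega⟩⟩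
  have : Nonempty (Fin B) := ⟨⟨0, by omega⟩⟩
  have : Nonempty (Fin m) := ⟨⟨0, by omega⟩⟩
  have hC' : (0 : ℝ) < C := by exact_mod_cast (by omega : 0 < C)
  set c₀ := G / φ ^ 2 * (2 / ℓ) with hc₀
  set lr : Labels n B m C → Prop := fun L => L.isLeft i₀ ∧ L.isRight j₀ with hlr
  set col : Labels n B m C → Fin n → Fin n → Prop := fun L i v =>
    L.InCell (L.bucketL i₀ (L.slot j₀)) (L.bucketR j₀) i v with hcol
  have hpoint : ∀ L : Labels n B m C, (if lr L then (1 : ℝ) else 0) * (1 - c₀) -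
      (∑ i, ∑ v, if (i, v) ≠ (i₀, j₀) then (if lr L ∧ col L i v then (1 : ℝ) else 0) * w i v
        else 0) ≤ pr fun ω => Reveals g s x sl α β ε ε' i₀ j₀ (L, ω) := by
    intro L
    by_cases hL : lr L
    · have h1 := pr_cell_good hg hs hx hℓ hT hsl hsl' L hε hε' hα hβ hα0 hβ0
        (a := L.bucketL i₀ (L.slot j₀)) (b := L.bucketR j₀) ⟨hL.1, hL.2, rfl, rfl⟩ hφ hc hG hw0 hw
      have h2 : (∑ i, ∑ v, if (i, v) ≠ (i₀, j₀) then (if lr L ∧ col L i v then (1 : ℝ) else 0) *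
          w i v else 0) = ∑ i, ∑ v, if L.InCell (L.bucketL i₀ (L.slot j₀)) (L.bucketR j₀) i v ∧
            (i, v) ≠ (i₀, j₀) then w i v else 0 := by
        refine Finset.sum_congr rfl fun i _ => Finset.sum_congr rfl fun v _ => ?_
        by_cases e1 : (i, v) ≠ (i₀, j₀)
        · by_cases e2 : L.InCell (L.bucketL i₀ (L.slot j₀)) (L.bucketR j₀) i v
          · rw [if_pos e1, if_pos ⟨hL, e2⟩, if_pos ⟨e2, e1⟩, one_mul]
          · rw [if_pos e1, if_neg (fun h => e2 h.2), if_neg (fun h => e2 h.1), zero_mul]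
        · rw [if_neg e1, if_neg (fun h => e1 h.2)]
      rw [h2, if_pos hL, one_mul]
      have h3 : ∀ A : ℝ, 1 - c₀ - A = 1 - A - c₀ := fun A => by ring
      rw [h3]
      refine h1.trans (pr_mono fun ω hω => ⟨L.bucketL i₀ (L.slot j₀), L.bucketR j₀, (α i₀ * β j₀) *
          (#(fiber sl (L.slot j₀)) * dot (x i₀) (x j₀)) * (s ω.1 i₀ * s ω.1 j₀), fun t => ?_⟩)
      have := hω t
      rw [mul_assoc (ε t i₀ * ε' t j₀), mul_assoc (ε t i₀ * ε' t j₀)] at this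
      exact this
    · have h2 : (∑ i, ∑ v, if (i, v) ≠ (i₀, j₀) then (if lr L ∧ col L i v then (1 : ℝ) else 0) *
          w i v else 0) = 0 :=
        Finset.sum_eq_zero fun i _ => Finset.sum_eq_zero fun v _ => by
          rw [if_neg (fun h : _ ∧ _ => hL h.1), zero_mul, ite_self]
      rw [h2, if_neg hL, zero_mul, sub_zero]
      exact pr_nonneg _
  have hlow : 1 / (2 * (C : ℝ) ^ 2) ≤ 𝔼 L : Labels n B m C, ((if lr L then (1 : ℝ) else 0) *
      (1 - c₀) - ∑ i, ∑ v, if (i, v) ≠ (i₀, j₀)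
        then (if lr L ∧ col L i v then (1 : ℝ) else 0) * w i v else 0) := by
    rw [Finset.expect_sub_distrib, ← Finset.expect_mul]
    have h1 : 𝔼 L : Labels n B m C, (if lr L then (1 : ℝ) else 0) = (1 / (C : ℝ)) ^ 2 := by
      rw [← pr_classes_eq hC h,
        ← pr_fst (Ω' := (Fin n → Fin B) × (Fin n → Fin m) × (Fin n × Fin m → Fin B))]
      simp only [pr]
      congr!
    have h2 : 𝔼 L : Labels n B m C, (∑ i, ∑ v, if (i, v) ≠ (i₀, j₀)
        then (if lr L ∧ col L i v then (1 : ℝ) else 0) * w i v else 0) ≤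
        (1 / (C : ℝ)) ^ 2 * ∑ i, ∑ v, w i v * collisionBound B m C i₀ j₀ i v := by
      rw [Finset.expect_sum_comm, Finset.mul_sum]
      refine Finset.sum_le_sum fun i _ => ?_
      rw [Finset.expect_sum_comm, Finset.mul_sum]
      refine Finset.sum_le_sum fun v _ => ?_
      by_cases e1 : (i, v) ≠ (i₀, j₀)
      · simp only [if_pos e1]
        have := mul_le_mul_of_nonneg_right (pr_inCell_le hC hB hm h e1) (hw0 i v)
        have e2 : 𝔼 L : Labels n B m C, (if lr L ∧ col L i v then (1 : ℝ) else 0) =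
            pr fun L : Labels n B m C => (L.isLeft i₀ ∧ L.isRight j₀) ∧
              L.InCell (L.bucketL i₀ (L.slot j₀)) (L.bucketR j₀) i v := by
          simp only [pr]
          congr!
        rw [← Finset.expect_mul, e2]
        linarith
      · simp only [if_neg e1, Finset.expect_const_zero]
        have : 0 ≤ collisionBound B m C i₀ j₀ i v := by
          rw [collisionBound]; split_ifs <;> positivity
        have := hw0 i v
        positivity
    have h3 := sum_collisionBound_le (B := B) (m := m) (C := C) (i₀ := i₀) (j₀ := j₀) hw0
    rw [h1]
    have h4 : (1 / (C : ℝ)) ^ 2 * (∑ i, ∑ v, w i v * collisionBound B m C i₀ j₀ i v) ≤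
        (1 / (C : ℝ)) ^ 2 * (1 / 2 - c₀) := by
      refine mul_le_mul_of_nonneg_left ?_ (by positivity)
      linarith
    have h5 : 1 / (2 * (C : ℝ) ^ 2) = (1 / (C : ℝ)) ^ 2 * (1 - c₀) -
        (1 / (C : ℝ)) ^ 2 * (1 / 2 - c₀) := by field_simp; ring
    rw [h5]
    linarith
  refine hlow.trans ((expect_mono hpoint).trans (le_of_eq ?_))
  exact (pr_prod _).symm

end

/-! ### The parameters of a trial -/

/-- The inequalities between the parameters when the two matrices to be multiplied are `B × r` and
`r × B`, in the case where the claimed size is less than `n ^ 2` by a factor polynomial in `G`. -/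
structure Regime (n k B r G : ℕ) (φ R : ℝ) : Prop where
  n_pos : 0 < n
  G_pos : 0 < G
  φ_pos : 0 < φ
  φ_le : φ ≤ 1
  R_nonneg : 0 ≤ R
  k_le : (k : ℝ) ≤ B
  R_le : R ≤ B * φ
  B_le : 100 * G * (B : ℝ) ≤ 3 * n
  le_B : (n : ℝ) ≤ B ^ 2 * φ ^ 2
  le_r : (n : ℝ) ^ 2 ≤ r * B ^ 2 * φ ^ 2

namespace Regime
variable {n k B r G : ℕ} {φ R : ℝ} (h : Regime n k B r G φ R)
include h

theorem n_pos' : (0 : ℝ) < n := by exact_mod_cast h.n_pos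

theorem one_le_G : (1 : ℝ) ≤ G := by exact_mod_cast h.G_pos

theorem B_pos : 0 < B := by
  rcases Nat.eq_zero_or_pos B with h0 | h0
  · have := h.le_B
    have h1 := h.n_pos'
    rw [h0] at this
    norm_num at this
    exact absurd this h.n_pos.ne'
  · exact h0

theorem one_le_B : (1 : ℝ) ≤ B := by exact_mod_cast h.B_pos

theorem r_pos : 0 < r := by
  rcases Nat.eq_zero_or_pos r with h0 | h0
  · have := h.le_r
    have h1 := pow_pos h.n_pos' 2
    rw [h0] at this
    norm_num at this
    exact absurd this h.n_pos.ne'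
  · exact h0

theorem B_le_n : (B : ℝ) ≤ n := by
  have h1 := h.B_le
  have h2 := h.one_le_G
  have h3 := h.one_le_B
  nlinarith

theorem n_le_sq : (n : ℝ) ≤ B ^ 2 := by
  have h1 : φ ^ 2 ≤ 1 := pow_le_one₀ h.φ_pos.le h.φ_le
  have := h.le_B
  nlinarith [sq_nonneg (B : ℝ)]

theorem mul_n_le : 100 * G * (n : ℝ) ≤ 3 * (r * B * φ ^ 2) := by
  have hn := h.n_pos'
  have hr : (0 : ℝ) ≤ r * B * φ ^ 2 := by positivity
  refine le_of_mul_le_mul_right ?_ hn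
  calc 100 * G * (n : ℝ) * n = 100 * G * n ^ 2 := by ring
    _ ≤ 100 * G * (r * B ^ 2 * φ ^ 2) := by
        have := h.le_r
        gcongr
    _ = (r * B * φ ^ 2) * (100 * G * B) := by ring
    _ ≤ (r * B * φ ^ 2) * (3 * n) := mul_le_mul_of_nonneg_left h.B_le hr
    _ = _ := by ring

theorem n_le : (n : ℝ) ≤ r * B * φ ^ 2 := by
  have h1 := h.mul_n_le
  have h2 := h.one_le_G
  have h3 := h.n_pos'
  nlinarith

theorem n_le_r_mul : (n : ℝ) ≤ r * B := by
  have h1 : φ ^ 2 ≤ 1 := pow_le_one₀ h.φ_pos.le h.φ_le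
  have h2 := h.n_le
  have h3 : (0 : ℝ) ≤ r * B := by positivity
  nlinarith

theorem mul_G_le : 1000 * G ≤ r * φ ^ 2 := by
  have h1 := h.mul_n_le
  have h2 := h.B_le
  have h3 := h.n_pos'
  have h5 := h.one_le_G
  have h6 : (0 : ℝ) ≤ r * φ ^ 2 := by positivity
  refine le_of_mul_le_mul_right (?_ : 1000 * (G : ℝ) * n ≤ r * φ ^ 2 * n) h3
  nlinarith [mul_le_mul_of_nonneg_right h2 h6, mul_nonneg (sub_nonneg.2 h5) h3.le]

set_option maxHeartbeats 400000 in
/-- The failure bound of `pr_reveals`, when the rows of the pair have small norms. -/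
theorem total_one_slot {C : ℝ} {H : ℝ} (hH : 1 ≤ H) (hC : C = 100 * G * H) :
    (2 + k + 2 * G / φ ^ 2 * (H * (B * φ ^ 2) + n * (1 / r))) *
          (1 / (C * B) * (1 / (1 : ℕ) + 1 / B)) +
        (2 + k + 2 * G / φ ^ 2 * (H * (B * φ ^ 2) + n * (1 / r))) * (1 / (C * B)) +
        (n + k + n + 2 * G / φ ^ 2 * (R ^ 2 + n * n * (1 / r))) * (1 / (C * B) ^ 2) +
        G / φ ^ 2 * (2 / r) ≤ 1 / 2 := by
  have hn := h.n_pos'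
  have hφ := h.φ_pos
  have hG := h.one_le_G
  have hB := h.one_le_B
  have hr : (0 : ℝ) < r := by exact_mod_cast h.r_pos
  have hk := h.k_le
  have hCpos : 0 < C := by rw [hC]; positivity
  have hGH : (1 : ℝ) ≤ G * H := by nlinarith
  have hnr : (n : ℝ) * (1 / r) ≤ B * φ ^ 2 := by
    rw [mul_one_div, div_le_iff₀ hr]; have := h.n_le; linarith
  have hnnr : (n : ℝ) * n * (1 / r) ≤ B ^ 2 * φ ^ 2 := by
    rw [mul_one_div, div_le_iff₀ hr]; have := h.le_r; linarith
  have hR2 : R ^ 2 ≤ B ^ 2 * φ ^ 2 := by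
    rw [← mul_pow]; exact pow_le_pow_left₀ h.R_nonneg h.R_le 2
  have hrow : 2 + k + 2 * G / φ ^ 2 * (H * (B * φ ^ 2) + n * (1 / r)) ≤ B * (7 * (G * H)) := by
    have : 2 * G / φ ^ 2 * (H * (B * φ ^ 2) + n * (1 / r)) ≤
        2 * G / φ ^ 2 * (H * (B * φ ^ 2) + B * φ ^ 2) := by gcongr
    have e : 2 * G / φ ^ 2 * (H * (B * φ ^ 2) + B * φ ^ 2) = B * (2 * (G * H) + 2 * G) := by
      field_simp
    have e3 : (G : ℝ) ≤ G * H := by nlinarith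
    have e4 : B * (2 * (G * H) + 2 * G) ≤ B * (4 * (G * H)) := by gcongr; linarith
    nlinarith
  have htot : n + k + n + 2 * G / φ ^ 2 * (R ^ 2 + n * n * (1 / r)) ≤ B ^ 2 * (7 * G) := by
    have : 2 * G / φ ^ 2 * (R ^ 2 + n * n * (1 / r)) ≤
        2 * G / φ ^ 2 * (B ^ 2 * φ ^ 2 + B ^ 2 * φ ^ 2) := by gcongr
    have e : 2 * G / φ ^ 2 * (B ^ 2 * φ ^ 2 + B ^ 2 * φ ^ 2) = B ^ 2 * (4 * G) := by
      field_simp; ring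
    have := h.n_le_sq
    have e5 : (B : ℝ) ≤ B ^ 2 := by nlinarith
    nlinarith [mul_le_mul_of_nonneg_left hG (sq_nonneg (B : ℝ))]
  have hinv : 1 / (B : ℝ) ≤ 1 := by rw [div_le_one (by linarith)]; exact hB
  have hc0 : G / φ ^ 2 * (2 / r) ≤ 1 / 100 := by
    have := h.mul_G_le
    rw [div_mul_div_comm, div_le_div_iff₀ (by positivity) (by norm_num)]
    linarith
  have t1 : (2 + k + 2 * G / φ ^ 2 * (H * (B * φ ^ 2) + n * (1 / r))) *
      (1 / (C * B) * (1 / (1 : ℕ) + 1 / B)) ≤ B * (7 * (G * H)) * (1 / (C * B) * (1 + 1)) := by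
    rw [Nat.cast_one, div_one]; gcongr
  have t2 : (2 + k + 2 * G / φ ^ 2 * (H * (B * φ ^ 2) + n * (1 / r))) * (1 / (C * B)) ≤
      B * (7 * (G * H)) * (1 / (C * B)) := by gcongr
  have t3 : (n + k + n + 2 * G / φ ^ 2 * (R ^ 2 + n * n * (1 / r))) * (1 / (C * B) ^ 2) ≤
      B ^ 2 * (7 * G) * (1 / (C * B) ^ 2) := by gcongr
  have u1 : B * (7 * (G * H)) * (1 / (C * B) * (1 + 1)) = 14 / 100 := by
    rw [hC]; field_simp; norm_num
  have u2 : B * (7 * (G * H)) * (1 / (C * B)) = 7 / 100 := by rw [hC]; field_simp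
  have u3 : B ^ 2 * (7 * G) * (1 / (C * B) ^ 2) ≤ 7 / 100 := by
    have e6 : B ^ 2 * (7 * G) * (1 / (C * B) ^ 2) = 7 * G / C ^ 2 := by field_simp
    have hC1 : (1 : ℝ) ≤ C := by rw [hC]; nlinarith
    rw [e6, div_le_div_iff₀ (by positivity) (by norm_num)]
    nlinarith
  refine (add_le_add (add_le_add (add_le_add (t1.trans_eq u1) (t2.trans_eq u2))
    (t3.trans u3)) hc0).trans (by norm_num)

set_option maxHeartbeats 400000 in
/-- The failure bound of `pr_reveals`, when the left side is restricted to `B` rows and is placed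
in `m` slots. -/
theorem total_slots {C : ℝ} {m ℓ : ℕ} {E : ℝ} (hE : E ≤ B) (hC : 100 * G ≤ C)
    (hm : 0 < m) (hℓ : 0 < ℓ) (hmn : (n : ℝ) ≤ 2 * B * m)
    (hℓr : (r : ℝ) * B ≤ 2 * n * ℓ) :
    (2 + k + 2 * G / φ ^ 2 * (n * φ ^ 2 + n * (1 / ℓ))) * (1 / (C * B) * (1 / m + 1 / B)) +
        (1 + k + E) * (1 / (C * B)) +
        (n + k + E + 2 * G / φ ^ 2 * (R ^ 2 + E * n * (1 / ℓ))) * (1 / (C * B) ^ 2) +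
        G / φ ^ 2 * (2 / ℓ) ≤ 1 / 2 := by
  have hn := h.n_pos'
  have hφ := h.φ_pos
  have hG := h.one_le_G
  have hB := h.one_le_B
  have hr : (0 : ℝ) < r := by exact_mod_cast h.r_pos
  have hm' : (1 : ℝ) ≤ m := by exact_mod_cast hm
  have hℓ' : (1 : ℝ) ≤ ℓ := by exact_mod_cast hℓ
  have hk := h.k_le
  have hCpos : 0 < C := by linarith
  have hℓφ : n * (1 / (ℓ : ℝ)) ≤ 2 * B * φ ^ 2 := by
    rw [mul_one_div, div_le_iff₀ (by linarith)]
    refine le_of_mul_le_mul_right (?_ : (n : ℝ) * n ≤ 2 * B * φ ^ 2 * ℓ * n) hn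
    have := h.le_r
    have e : B * φ ^ 2 * (r * B) ≤ B * φ ^ 2 * (2 * n * ℓ) := by gcongr
    nlinarith
  have hR2 : R ^ 2 ≤ B ^ 2 * φ ^ 2 := by
    rw [← mul_pow]; exact pow_le_pow_left₀ h.R_nonneg h.R_le 2
  have hinv : 1 / (B : ℝ) ≤ 1 := by rw [div_le_one (by linarith)]; exact hB
  have hminv : 1 / (m : ℝ) ≤ 1 := by rw [div_le_one (by linarith)]; exact hm'
  have hGB : (B : ℝ) ≤ G * B := le_mul_of_one_le_left (by linarith) hG
  have hfac : n * (1 / m + 1 / (B : ℝ)) ≤ 3 * B := by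
    have e1 : n * (1 / (m : ℝ)) ≤ 2 * B := by
      rw [mul_one_div, div_le_iff₀ (by linarith)]; exact hmn
    have e2 : n * (1 / (B : ℝ)) ≤ B := by
      rw [mul_one_div, div_le_iff₀ (by linarith), ← pow_two]; exact h.n_le_sq
    linarith
  have hCB : (0 : ℝ) < C * B := by positivity
  have t1 : (2 + k + 2 * G / φ ^ 2 * (n * φ ^ 2 + n * (1 / ℓ))) *
      (1 / (C * B) * (1 / m + 1 / B)) ≤ 20 * G / C := by
    have e1 : (2 + k : ℝ) * (1 / m + 1 / B) ≤ 6 * B := by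
      calc (2 + k : ℝ) * (1 / m + 1 / B) ≤ (3 * B) * (1 + 1) := by gcongr; linarith
        _ = _ := by ring
    have e2 : 2 * G / φ ^ 2 * (n * (1 / (ℓ : ℝ))) * (1 / m + 1 / B) ≤ 8 * G * B := by
      calc 2 * G / φ ^ 2 * (n * (1 / (ℓ : ℝ))) * (1 / m + 1 / B)
          ≤ 2 * G / φ ^ 2 * (2 * B * φ ^ 2) * (1 + 1) := by gcongr
        _ = _ := by field_simp; ring
    have e3 : 2 * G / φ ^ 2 * (n * φ ^ 2) * (1 / m + 1 / (B : ℝ)) ≤ 6 * G * B := by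
      have : 2 * G / φ ^ 2 * (n * φ ^ 2) * (1 / m + 1 / (B : ℝ)) =
          2 * G * (n * (1 / m + 1 / (B : ℝ))) := by field_simp
      rw [this]
      have := mul_le_mul_of_nonneg_left hfac (show (0 : ℝ) ≤ 2 * G by linarith)
      linarith
    calc _ = ((2 + k : ℝ) * (1 / m + 1 / B) + 2 * G / φ ^ 2 * (n * (1 / (ℓ : ℝ))) *
          (1 / m + 1 / B) + 2 * G / φ ^ 2 * (n * φ ^ 2) * (1 / m + 1 / (B : ℝ))) *
            (1 / (C * B)) := by ring
      _ ≤ (6 * B + 8 * G * B + 6 * G * B) * (1 / (C * B)) := by gcongr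
      _ ≤ (20 * G * B) * (1 / (C * B)) := by
          gcongr
          linarith
      _ = _ := by field_simp
  have t2 : (1 + k + E) * (1 / (C * B)) ≤ 3 * G / C := by
    calc (1 + k + E) * (1 / (C * B)) ≤ (3 * G * B) * (1 / (C * B)) := by
          gcongr
          linarith
      _ = _ := by field_simp
  have t3 : (n + k + E + 2 * G / φ ^ 2 * (R ^ 2 + E * n * (1 / ℓ))) * (1 / (C * B) ^ 2) ≤
      9 * G / C ^ 2 := by
    have e1 : 2 * G / φ ^ 2 * (R ^ 2 + E * n * (1 / (ℓ : ℝ))) ≤ 6 * G * B ^ 2 := by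
      calc 2 * G / φ ^ 2 * (R ^ 2 + E * n * (1 / (ℓ : ℝ)))
          = 2 * G / φ ^ 2 * (R ^ 2 + E * (n * (1 / (ℓ : ℝ)))) := by ring
        _ ≤ 2 * G / φ ^ 2 * (B ^ 2 * φ ^ 2 + B * (2 * B * φ ^ 2)) := by gcongr
        _ = _ := by field_simp; ring
    have := h.n_le_sq
    have e5 : (B : ℝ) ≤ B ^ 2 := by nlinarith
    calc _ ≤ (9 * G * B ^ 2) * (1 / (C * B) ^ 2) := by
          gcongr
          have := mul_le_mul_of_nonneg_right hG (sq_nonneg (B : ℝ))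
          linarith
      _ = _ := by field_simp
  have t4 : G / φ ^ 2 * (2 / ℓ) ≤ 12 / 100 := by
    rw [div_mul_div_comm, div_le_div_iff₀ (by positivity) (by norm_num)]
    have h1 := h.mul_n_le
    refine le_of_mul_le_mul_right (?_ : G * 2 * 100 * n ≤ 12 * (φ ^ 2 * ℓ) * n) hn
    have e : φ ^ 2 * (r * B) ≤ φ ^ 2 * (2 * n * ℓ) := by gcongr
    nlinarith
  have u1 : 20 * G / C ≤ 20 / 100 := by rw [div_le_div_iff₀ hCpos (by norm_num)]; linarith
  have u2 : 3 * G / C ≤ 3 / 100 := by rw [div_le_div_iff₀ hCpos (by norm_num)]; linarith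
  have u3 : 9 * G / C ^ 2 ≤ 9 / 100 := by
    rw [div_le_div_iff₀ (by positivity) (by norm_num)]; nlinarith
  refine (add_le_add (add_le_add (add_le_add (t1.trans u1) (t2.trans u2))
    (t3.trans u3)) t4).trans (by norm_num)

end Regime

/-! ### The weights of the colliding pairs -/

section
variable {n p M : ℕ}

/-- Outside the diagonal and the set `X`, which has at most `k` elements, the inner products of the
rows of `x` are at most `φ` in absolute value, and their squares sum to at most `R ^ 2`. -/
structure TailBound (x : Fin n → Fin p → ℝ) (φ R : ℝ) (k : ℕ) (X : Finset (Fin n × Fin n)) :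
    Prop where
  card_le : #X ≤ k
  entry : ∀ i v, i ≠ v → (i, v) ∉ X → dot (x i) (x v) ^ 2 ≤ φ ^ 2
  total : ∑ i, ∑ v, (if i = v ∨ (i, v) ∈ X then 0 else dot (x i) (x v) ^ 2) ≤ R ^ 2

open Classical in
/-- The weight of a pair for `pr_reveals`: the row `i` enters with `e i ∈ {0, 1}`, and the pairs on
the diagonal, in `X`, and, if `J` holds, in the column `j₀`, count as a failure. The others have the
weight `a (C i v ^ 2 + b)`, where `C i v` is the inner product and `b` the sketching error. -/
noncomputable def pairWeight (x : Fin n → Fin p → ℝ) (X : Finset (Fin n × Fin n)) (J : Prop)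
    (j₀ : Fin n) (e : Fin n → ℝ) (a b : ℝ) (i v : Fin n) : ℝ :=
  (if i = v then 1 else 0) + (if (i, v) ∈ X then 1 else 0) +
    e i * (if J ∧ v = j₀ then 1
      else a * ((if i = v ∨ (i, v) ∈ X then 0 else dot (x i) (x v) ^ 2) + b))

variable {x : Fin n → Fin p → ℝ} {X : Finset (Fin n × Fin n)} {J : Prop} {j₀ : Fin n}
  {e : Fin n → ℝ} {a b : ℝ}

theorem tail_nonneg (i v : Fin n) :
    0 ≤ if i = v ∨ (i, v) ∈ X then 0 else dot (x i) (x v) ^ 2 := by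
  split_ifs
  · exact le_rfl
  · exact sq_nonneg _

theorem pairWeight_nonneg (he : ∀ i, 0 ≤ e i) (ha : 0 ≤ a) (hb : 0 ≤ b) (i v : Fin n) :
    0 ≤ pairWeight x X J j₀ e a b i v := by
  have h1 := tail_nonneg (x := x) (X := X) i v
  have h2 := he i
  rw [pairWeight]
  refine add_nonneg (add_nonneg ?_ ?_) (mul_nonneg h2 ?_)
  · split_ifs <;> norm_num
  · split_ifs <;> norm_num
  · split_ifs <;> positivity

theorem pairWeight_le (he : ∀ i, 0 ≤ e i) (ha : 0 ≤ a) (hb : 0 ≤ b) (i v : Fin n) :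
    pairWeight x X J j₀ e a b i v ≤ (if i = v then 1 else 0) + (if (i, v) ∈ X then 1 else 0) +
      e i * ((if v = j₀ then 1 else 0) +
        a * ((if i = v ∨ (i, v) ∈ X then 0 else dot (x i) (x v) ^ 2) + b)) := by
  have h1 := tail_nonneg (x := x) (X := X) i v
  rw [pairWeight]
  refine add_le_add le_rfl (mul_le_mul_of_nonneg_left ?_ (he i))
  have h3 : 0 ≤ a * ((if i = v ∨ (i, v) ∈ X then 0 else dot (x i) (x v) ^ 2) + b) := by positivity
  by_cases hJ : J ∧ v = j₀
  · rw [if_pos hJ, if_pos hJ.2]; linarith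
  · rw [if_neg hJ]
    refine le_add_of_nonneg_left ?_
    split_ifs <;> norm_num

theorem sum_mem_row_le (X : Finset (Fin n × Fin n)) (i : Fin n) :
    ∑ v, (if (i, v) ∈ X then (1 : ℝ) else 0) ≤ #X := by
  rw [Finset.sum_boole]
  exact_mod_cast Finset.card_le_card_of_injOn (fun v => (i, v)) (fun v hv => by simpa using hv)
    (fun v _ v' _ h => by simpa using h)

theorem sum_mem_col_le (X : Finset (Fin n × Fin n)) (v : Fin n) :
    ∑ i, (if (i, v) ∈ X then (1 : ℝ) else 0) ≤ #X := by
  rw [Finset.sum_boole]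
  exact_mod_cast Finset.card_le_card_of_injOn (fun i => (i, v)) (fun v hv => by simpa using hv)
    (fun v _ v' _ h => by simpa using h)

theorem sum_mem_eq (X : Finset (Fin n × Fin n)) :
    ∑ i, ∑ v, (if (i, v) ∈ X then (1 : ℝ) else 0) = #X := by
  rw [← Finset.sum_product', Finset.univ_product_univ, Finset.sum_boole]
  simp

theorem pairWeight_row (he : ∀ i, 0 ≤ e i) (he1 : ∀ i, e i ≤ 1) (ha : 0 ≤ a) (hb : 0 ≤ b) {k : ℕ}
    (hX : #X ≤ k) {i : Fin n} {ρ : ℝ}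
    (hρ : ∑ v, (if i = v ∨ (i, v) ∈ X then 0 else dot (x i) (x v) ^ 2) ≤ ρ) :
    ∑ v, pairWeight x X J j₀ e a b i v ≤ 2 + k + a * (ρ + n * b) := by
  have hX' : (#X : ℝ) ≤ k := by exact_mod_cast hX
  refine (Finset.sum_le_sum fun v _ => pairWeight_le he ha hb i v).trans ?_
  simp only [Finset.sum_add_distrib, ← Finset.mul_sum, Finset.sum_ite_eq, Finset.sum_ite_eq',
    Finset.mem_univ, if_true, Finset.sum_const, Finset.card_univ, Fintype.card_fin, nsmul_eq_mul]
  have h1 := sum_mem_row_le X i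
  have h3 : 0 ≤ ∑ v, (if i = v ∨ (i, v) ∈ X then 0 else dot (x i) (x v) ^ 2) :=
    Finset.sum_nonneg fun v _ => tail_nonneg i v
  have h2 : e i * (1 + a * (∑ v, (if i = v ∨ (i, v) ∈ X then 0 else dot (x i) (x v) ^ 2) +
      n * b)) ≤ 1 * (1 + a * (ρ + n * b)) := by
    have := he i
    gcongr
    exact he1 i
  linarith

theorem pairWeight_col (he1 : ∀ i, e i ≤ 1) (ha : 0 ≤ a) (hb : 0 ≤ b) {k : ℕ} (hX : #X ≤ k) {ρ : ℝ}
    (hρ : ∑ i, (if i = j₀ ∨ (i, j₀) ∈ X then 0 else dot (x i) (x j₀) ^ 2) ≤ ρ) :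
    ∑ i, pairWeight x X False j₀ e a b i j₀ ≤ 2 + k + a * (ρ + n * b) := by
  have hX' : (#X : ℝ) ≤ k := by exact_mod_cast hX
  have hle : ∀ i, pairWeight x X False j₀ e a b i j₀ ≤ (if i = j₀ then 1 else 0) +
      (if (i, j₀) ∈ X then 1 else 0) +
        a * ((if i = j₀ ∨ (i, j₀) ∈ X then 0 else dot (x i) (x j₀) ^ 2) + b) := by
    intro i
    have h1 := tail_nonneg (x := x) (X := X) i j₀
    rw [pairWeight, if_neg (fun h : False ∧ _ => h.1)]
    refine add_le_add le_rfl (mul_le_of_le_one_left (by positivity) (he1 i))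
  refine (Finset.sum_le_sum fun i _ => hle i).trans ?_
  simp only [Finset.sum_add_distrib, ← Finset.mul_sum, Finset.sum_ite_eq', Finset.mem_univ,
    if_true, Finset.sum_const, Finset.card_univ, Fintype.card_fin, nsmul_eq_mul]
  have h1 := sum_mem_col_le X j₀
  have h2 : a * (∑ i, (if i = j₀ ∨ (i, j₀) ∈ X then 0 else dot (x i) (x j₀) ^ 2) + n * b) ≤
      a * (ρ + n * b) := by gcongr
  linarith

theorem pairWeight_col' {k : ℕ} (hX : #X ≤ k) :
    ∑ i, pairWeight x X True j₀ e a b i j₀ ≤ 1 + k + ∑ i, e i := by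
  have hX' : (#X : ℝ) ≤ k := by exact_mod_cast hX
  simp only [pairWeight, true_and, if_true, mul_one, Finset.sum_add_distrib, Finset.sum_ite_eq',
    Finset.mem_univ]
  have h1 := sum_mem_col_le X j₀
  linarith

theorem pairWeight_total (he : ∀ i, 0 ≤ e i) (he1 : ∀ i, e i ≤ 1) (ha : 0 ≤ a) (hb : 0 ≤ b) {k : ℕ}
    {φ R : ℝ} (hX : TailBound x φ R k X) {E : ℝ} (hE : ∑ i, e i ≤ E) :
    ∑ i, ∑ v, pairWeight x X J j₀ e a b i v ≤ n + k + E + a * (R ^ 2 + E * n * b) := by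
  have hX' : (#X : ℝ) ≤ k := by exact_mod_cast hX.card_le
  have hle : ∀ i v, pairWeight x X J j₀ e a b i v ≤ (if i = v then 1 else 0) +
      (if (i, v) ∈ X then 1 else 0) + e i * (if v = j₀ then 1 else 0) +
        a * (if i = v ∨ (i, v) ∈ X then 0 else dot (x i) (x v) ^ 2) + a * b * e i := by
    intro i v
    refine (pairWeight_le he ha hb i v).trans ?_
    have h1 := tail_nonneg (x := x) (X := X) i v
    have h2 : e i * (a * (if i = v ∨ (i, v) ∈ X then 0 else dot (x i) (x v) ^ 2)) ≤
      a * (if i = v ∨ (i, v) ∈ X then 0 else dot (x i) (x v) ^ 2) :=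
        mul_le_of_le_one_left (by positivity) (he1 i)
    linarith
  refine (Finset.sum_le_sum fun i _ => Finset.sum_le_sum fun v _ => hle i v).trans ?_
  simp only [Finset.sum_add_distrib, ← Finset.mul_sum, Finset.sum_ite_eq, Finset.sum_ite_eq',
    Finset.mem_univ, if_true, Finset.sum_const, Finset.card_univ, Fintype.card_fin, nsmul_eq_mul,
    mul_one]
  rw [sum_mem_eq]
  have h3 : a * (∑ i, ∑ v, if i = v ∨ (i, v) ∈ X then 0 else dot (x i) (x v) ^ 2) ≤
      a * R ^ 2 := mul_le_mul_of_nonneg_left hX.total ha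
  have h4 : (n : ℝ) * (a * b * ∑ i, e i) ≤ n * (a * b * E) := by gcongr
  linarith

/-- A pair outside the diagonal and `X`, or excluded by `e`, has the weight required by
`pr_reveals`. -/
theorem le_pairWeight (he : ∀ i, 0 ≤ e i) (hb : 0 ≤ b) {G : ℝ} (hG : 0 ≤ G) {φ : ℝ} {α : Fin n → ℝ}
    (hα : ∀ i, α i ^ 2 ≤ 2) (hαe : ∀ i, e i = 1 ∨ α i = 0) (i v : Fin n) :
    1 ≤ pairWeight x X J j₀ e (2 * G / φ ^ 2) b i v ∨
      G / φ ^ 2 * (α i ^ 2 * (dot (x i) (x v) ^ 2 + b)) ≤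
        pairWeight x X J j₀ e (2 * G / φ ^ 2) b i v := by
  have h0 := pairWeight_nonneg (x := x) (X := X) (J := J) (j₀ := j₀) he
    (show 0 ≤ 2 * G / φ ^ 2 by positivity) hb i v
  rcases hαe i with h1 | h1
  · have h2 := tail_nonneg (x := x) (X := X) i v
    rw [pairWeight, h1, one_mul]
    by_cases hJ : J ∧ v = j₀
    · left
      rw [if_pos hJ]
      have : (0 : ℝ) ≤ if i = v then 1 else 0 := by split_ifs <;> norm_num
      have : (0 : ℝ) ≤ if (i, v) ∈ X then 1 else 0 := by split_ifs <;> norm_num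
      linarith
    · rw [if_neg hJ]
      by_cases hiv : i = v ∨ (i, v) ∈ X
      · left
        rw [if_pos hiv]
        have h3 : 0 ≤ 2 * G / φ ^ 2 * (0 + b) := by positivity
        have : (1 : ℝ) ≤ (if i = v then 1 else 0) + if (i, v) ∈ X then 1 else 0 := by
          rcases hiv with h | h
          · rw [if_pos h]; split_ifs <;> norm_num
          · rw [if_pos h]; split_ifs <;> norm_num
        linarith
      · right
        rw [if_neg hiv, if_neg fun h => hiv (Or.inl h), if_neg fun h => hiv (Or.inr h)]
        calc G / φ ^ 2 * (α i ^ 2 * (dot (x i) (x v) ^ 2 + b))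
            ≤ G / φ ^ 2 * (2 * (dot (x i) (x v) ^ 2 + b)) := by gcongr; exact hα i
          _ = _ := by ring
  · right
    rw [h1]
    simpa using h0

end

/-! ### One trial reveals a large pair -/

section
variable {n p M r B m C γ : ℕ}

/-- The random choices of a trial: the sketches for the norms of the rows, those for the detection
of the rows of large correlation norm, and the labels, signs and sketches for the product. -/
abbrev TrialSeeds (n M γ r B m C : ℕ) :=
  (Fin (12 * (γ + 3)) → Fin M) × (((Fin r → Fin M) × Fin M) ×
    (Labels n B m C × Fin M × (Fin r → Fin M)))

/-- The tests of a trial: the plain product, and the products in which the rows on one of the two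
sides get an extra sign given by one bit of their index. -/
abbrev Test (γ : ℕ) := Option (Bool × Fin γ)

/-- The extra sign of the row `i` on the side `side` in a test. -/
def Test.sign (side : Bool) : Test γ → Fin n → ℝ
  | none, _ => 1
  | some (side', b), i => if side' = side ∧ (i : ℕ).testBit b then -1 else 1

theorem Test.sign_sq (side : Bool) (t : Test γ) (i : Fin n) : t.sign side i ^ 2 = 1 := by
  rcases t with _ | ⟨_, _⟩
  · simp [Test.sign]
  · rw [Test.sign]; split_ifs <;> norm_num

variable (g : Fin M → Fin p → ℝ) (s : Fin M → Fin n → ℝ) (x : Fin n → Fin p → ℝ)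
  (sl : Fin r → Fin m) (τ : ℝ)

open Classical in
/-- The weight `0` or `1` of a row on the left side, according to its estimated correlation norm. -/
noncomputable def keep (ω : TrialSeeds n M γ r B m C) (i : Fin n) : ℝ :=
  if rowEst g s x (normEst g x ω.1) ω.2.1 i ^ 2 < τ then 0 else 1

/-- In a cell of the product, the contribution of the pair `(i₀, j₀)` dominates in all tests. -/
def TrialReveals (i₀ j₀ : Fin n) (ω : TrialSeeds n M γ r B m C) : Prop :=
  Reveals g s x sl (fun i => keep g s x τ ω i * scaleOf (normEst g x ω.1 i))
    (fun i => scaleOf (normEst g x ω.1 i)) (Test.sign (γ := γ) false) (Test.sign true) i₀ j₀ ω.2.2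

variable {g s x sl τ}

/-- The bound `480 · 1024 · T²` for the squared correlation norm of a row, relative to `B φ²`, up to
which the row is not treated as one of large norm; here `T` is the number of norm sketches. From
this norm on, `pr_rowEst_good` applies with the threshold `rowThreshold`. -/
def rowFactor (γ : ℕ) : ℕ := 480 * 1024 * (12 * (γ + 3)) ^ 2

/-- The ratio between the squared deviation of a cell and the failure probability of the tests. -/
def testFactor (γ : ℕ) : ℕ := (2 * γ + 1) * 1024 * (12 * (γ + 3)) ^ 2

theorem testFactor_eq (γ : ℕ) : ((testFactor γ : ℕ) : ℝ) =
    Fintype.card (Test γ) * 1024 * ((12 * (γ + 3) : ℕ) : ℝ) ^ 2 := by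
  rw [testFactor]
  simp only [Fintype.card_option, Fintype.card_prod, Fintype.card_bool, Fintype.card_fin]
  push_cast
  ring

theorem dot_comm (u y : Fin p → ℝ) : dot u y = dot y u := by
  simp only [dot, mul_comm]

section
variable [Nonempty (Fin M)] {φ R : ℝ} {k : ℕ} {X : Finset (Fin n × Fin n)} {i₀ j₀ : Fin n}

theorem inv_le_scaleOf_sq {v : ℝ} {T : ℕ} (h : 1 / 2 ≤ v) (h' : v ≤ 8 * T) :
    1 / (8 * (T : ℝ)) ≤ scaleOf v ^ 2 := by
  rw [scaleOf_sq (by linarith)]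
  exact one_div_le_one_div_of_le (by linarith) h'

/-- If the rows of the pair have small correlation norms, a single slot suffices. -/
theorem pr_trialReveals_one_slot (hn : n ≤ 2 ^ γ) (hg : IsFourwise g) (hs : IsFourwise s)
    (hx : ∀ i, dot (x i) (x i) = 1) (h : Regime n k B r (testFactor γ) φ R)
    (hX : TailBound x φ R k X) (hC : C = 100 * testFactor γ * rowFactor γ)
    {sl : Fin r → Fin 1} (hij : i₀ ≠ j₀) (hφ : φ ≤ |dot (x i₀) (x j₀)|)
    (hi : ∑ j, dot (x i₀) (x j) ^ 2 ≤ rowFactor γ * (B * φ ^ 2))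
    (hj : ∑ j, dot (x j₀) (x j) ^ 2 ≤ rowFactor γ * (B * φ ^ 2)) :
    1 / (4 * (C : ℝ) ^ 2) ≤
      pr fun ω : TrialSeeds n M γ r B 1 C => TrialReveals g s x sl 0 i₀ j₀ ω := by
  have hfib : ∀ q, #(fiber sl q) = r := fun q => by
    rw [fiber, Finset.filter_true_of_mem fun l _ => Subsingleton.elim _ _, Finset.card_univ,
      Fintype.card_fin]
  have hr := h.r_pos
  have hG := h.G_pos
  have hH : 0 < rowFactor γ := by rw [rowFactor]; positivity
  have hC2 : 2 ≤ C := by rw [hC]; nlinarith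
  have hC0 : (0 : ℝ) < C := by exact_mod_cast (by omega : 0 < C)
  have : Nonempty (Fin C) := ⟨⟨0, by omega⟩⟩
  have : Nonempty (Fin B) := ⟨⟨0, h.B_pos⟩⟩
  have h1 := pr_prod_ge (A := fun σ : Fin (12 * (γ + 3)) → Fin M =>
      NormGood (12 * (γ + 3)) x i₀ j₀ (normEst g x σ))
    (B := fun σ (ω : ((Fin r → Fin M) × Fin M) × (Labels n B 1 C × Fin M × (Fin r → Fin M))) =>
      TrialReveals g s x sl 0 i₀ j₀ (σ, ω))
    (p := 1 / 2) (q := 1 * (1 / (2 * (C : ℝ) ^ 2))) (by positivity)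
    (pr_normGood hn hg hx i₀ j₀) ?_
  · refine le_trans (le_of_eq ?_) (h1.trans (pr_mono fun ω hω => hω.2))
    field_simp; norm_num
  intro σ hσ
  refine (pr_prod_ge (A := fun _ : (Fin r → Fin M) × Fin M => True)
    (B := fun ω₁ (ω₂ : Labels n B 1 C × Fin M × (Fin r → Fin M)) =>
      TrialReveals g s x sl 0 i₀ j₀ (σ, ω₁, ω₂)) (by positivity) pr_true.ge ?_).trans
      (pr_mono fun ω hω => hω.2)
  intro ω₁ _
  -- With the threshold `0` all rows are kept, so that the estimates `ω₁` do not matter.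
  have hkeep : ∀ ω₂ i, keep (γ := γ) g s x 0 (σ, ω₁, (ω₂ : Labels n B 1 C × Fin M ×
      (Fin r → Fin M))) i = 1 := fun ω₂ i => if_neg (not_lt.2 (sq_nonneg _))
  simp only [TrialReveals, hkeep, one_mul]
  have hscale : ∀ i, scaleOf (normEst g x σ i) ^ 2 ≤ 2 := fun i => scaleOf_sq_le (hσ.lower i)
  have hr' : (0 : ℝ) ≤ 1 / r := by positivity
  have ha : (0 : ℝ) ≤ 2 * (testFactor γ : ℕ) / φ ^ 2 := by positivity
  have he : ∀ i : Fin n, (0 : ℝ) ≤ (fun _ => 1 : Fin n → ℝ) i := fun _ => zero_le_one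
  have he1 : ∀ i : Fin n, (fun _ => 1 : Fin n → ℝ) i ≤ 1 := fun _ => le_rfl
  refine pr_reveals (w := pairWeight x X False j₀ (fun _ => 1) (2 * (testFactor γ : ℕ) / φ ^ 2)
    (1 / r)) (G := (testFactor γ : ℕ)) hg hs hx hr (by positivity : 0 < 12 * (γ + 3))
    (fun q => by rw [hfib]; omega) (fun q => (hfib q).ge) hC2 h.B_pos one_pos
    (Test.sign_sq _) (Test.sign_sq _) hscale hscale hij
    (inv_le_scaleOf_sq (hσ.lower _) hσ.left) (inv_le_scaleOf_sq (hσ.lower _) hσ.right) h.φ_pos hφ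
    (testFactor_eq γ) (pairWeight_nonneg he ha hr')
    (le_pairWeight he hr' (Nat.cast_nonneg _) hscale fun _ => Or.inl rfl) ?_
  have hB : (0 : ℝ) < B := by exact_mod_cast h.B_pos
  have hle : ∀ i v, (if i = v ∨ (i, v) ∈ X then 0 else dot (x i) (x v) ^ 2) ≤
      dot (x i) (x v) ^ 2 := fun i v => by
    split_ifs
    · exact sq_nonneg _
    · exact le_rfl
  have hrow := pairWeight_row (J := False) (j₀ := j₀) he he1 ha hr' hX.card_le (i := i₀)
    ((Finset.sum_le_sum fun v _ => hle i₀ v).trans hi)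
  have hcol := pairWeight_col (j₀ := j₀) he1 ha hr' hX.card_le (ρ := rowFactor γ * (B * φ ^ 2))
    ((Finset.sum_le_sum fun i _ => hle i j₀).trans (by
      simpa only [dot_comm _ (x j₀)] using hj))
  have htot := pairWeight_total (J := False) (j₀ := j₀) he he1 ha hr' hX (E := n) (by simp)
  refine le_trans ?_ (h.total_one_slot (H := (rowFactor γ : ℕ)) (by exact_mod_cast hH) (C := C)
    (by rw [hC]; push_cast; ring))
  gcongr

theorem sq_dot_le_one (hx : ∀ i, dot (x i) (x i) = 1) (i v : Fin n) : dot (x i) (x v) ^ 2 ≤ 1 := by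
  have h := Finset.sum_mul_sq_le_sq_mul_sq univ (x i) (x v)
  have e : ∀ i, ∑ a, x i a ^ 2 = 1 := fun i => by
    rw [← hx i]; exact Finset.sum_congr rfl fun a _ => pow_two _
  rw [e, e, one_mul] at h
  exact h

/-- The squared Frobenius norm of the correlation matrix: the diagonal, the set `X`, and the tail
each contribute at most `B² φ²`. -/
theorem sum_sq_le (h : Regime n k B r (testFactor γ) φ R) (hx : ∀ i, dot (x i) (x i) = 1)
    (hX : TailBound x φ R k X) :
    ∑ i, ∑ j, dot (x i) (x j) ^ 2 ≤ 3 * (B ^ 2 * φ ^ 2) := by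
  have hX' : (#X : ℝ) ≤ k := by exact_mod_cast hX.card_le
  have hle : ∀ i v, dot (x i) (x v) ^ 2 ≤ (if i = v then 1 else 0) + (if (i, v) ∈ X then 1 else 0) +
      (if i = v ∨ (i, v) ∈ X then 0 else dot (x i) (x v) ^ 2) := by
    intro i v
    have := sq_dot_le_one hx i v
    by_cases h1 : i = v
    · rw [if_pos h1, if_pos (Or.inl h1)]
      split_ifs <;> linarith
    · by_cases h2 : (i, v) ∈ X
      · rw [if_neg h1, if_pos h2, if_pos (Or.inr h2)]
        linarith
      · rw [if_neg h1, if_neg h2, if_neg (by tauto)]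
        linarith
  refine (Finset.sum_le_sum fun i _ => Finset.sum_le_sum fun v _ => hle i v).trans ?_
  simp only [Finset.sum_add_distrib, Finset.sum_ite_eq, Finset.mem_univ, if_true, Finset.sum_const,
    Finset.card_univ, Fintype.card_fin, nsmul_eq_mul, mul_one]
  rw [sum_mem_eq]
  have h1 := hX.total
  have h2 : R ^ 2 ≤ B ^ 2 * φ ^ 2 := by
    rw [← mul_pow]; exact pow_le_pow_left₀ h.R_nonneg h.R_le 2
  have h3 := h.le_B
  have h4 := h.k_le
  have h5 := h.B_le_n
  linarith

/-- The threshold for the squared estimates of the correlation norms of the rows. -/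
noncomputable def rowThreshold (B r : ℕ) (φ : ℝ) : ℝ := 960 * r ^ 2 * B * φ ^ 2

/-- The slot of a sketch coordinate. -/
def slotOf (r : ℕ) {m : ℕ} (hm : 0 < m) (l : Fin r) : Fin m := ⟨l % m, Nat.mod_lt _ hm⟩

theorem card_fiber_slotOf {r m : ℕ} (hm : 0 < m) (q : Fin m) :
    r / m ≤ #(fiber (slotOf r hm) q) ∧ #(fiber (slotOf r hm) q) ≤ r / m + 1 := by
  have h1 : #(fiber (slotOf r hm) q) = Nat.count (fun l => l ≡ q [MOD m]) r := by
    rw [Nat.count_eq_card_filter_range]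
    refine Finset.card_bij (fun l _ => (l : ℕ)) ?_ ?_ ?_
    · intro l hl
      have hl' := (Finset.mem_filter.1 hl).2
      refine Finset.mem_filter.2 ⟨Finset.mem_range.2 l.2, ?_⟩
      rw [Nat.ModEq, Nat.mod_eq_of_lt q.2]
      exact congrArg Fin.val hl'
    · intro l _ l' _ h
      exact Fin.ext h
    · intro l hl
      rw [Finset.mem_filter, Finset.mem_range, Nat.ModEq, Nat.mod_eq_of_lt q.2] at hl
      exact ⟨⟨l, hl.1⟩, Finset.mem_filter.2 ⟨Finset.mem_univ _, Fin.ext hl.2⟩, rfl⟩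
  rw [h1, Nat.count_modEq_card _ hm]
  split_ifs <;> omega

/-- If the first row of the pair has a large correlation norm, then it is likely to be one of the at
most `B` rows that are kept on the left. So few rows can all be avoided by the column of `j₀`, and
the slots spread the row of `i₀`. -/
theorem pr_trialReveals_slots (hn : n ≤ 2 ^ γ) (hg : IsFourwise g) (hs : IsFourwise s)
    (hx : ∀ i, dot (x i) (x i) = 1) (h : Regime n k B r (testFactor γ) φ R)
    (hX : TailBound x φ R k X) (hC : C = 100 * testFactor γ * rowFactor γ)
    (hm : 0 < n / B) (hij : i₀ ≠ j₀) (hφ : φ ≤ |dot (x i₀) (x j₀)|)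
    (hi : rowFactor γ * (B * φ ^ 2) ≤ ∑ j, dot (x i₀) (x j) ^ 2) :
    1 / (192 * (C : ℝ) ^ 2) ≤
      pr fun ω : TrialSeeds n M γ r B (n / B) C =>
        TrialReveals g s x (slotOf r hm) (rowThreshold B r φ) i₀ j₀ ω := by
  classical
  set τ := rowThreshold B r φ with hτ
  set m := n / B with hmdef
  have hr := h.r_pos
  have hG := h.G_pos
  have hφ0 := h.φ_pos
  have hn0 := h.n_pos'
  have hB : (0 : ℝ) < B := by exact_mod_cast h.B_pos
  have hr0 : (0 : ℝ) < r := by exact_mod_cast hr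
  have hH : 0 < rowFactor γ := by rw [rowFactor]; positivity
  have hC2 : 2 ≤ C := by rw [hC]; nlinarith
  have hC0 : (0 : ℝ) < C := by exact_mod_cast (by omega : 0 < C)
  have : Nonempty (Fin C) := ⟨⟨0, by omega⟩⟩
  have : Nonempty (Fin B) := ⟨⟨0, h.B_pos⟩⟩
  have : Nonempty (Fin m) := ⟨⟨0, hm⟩⟩
  have hT0 : 0 < 12 * (γ + 3) := by positivity
  have hτ0 : 0 < τ := by rw [hτ, rowThreshold]; positivity
  have hnB : n < B * (m + 1) := by
    rw [hmdef, mul_add_one]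
    have := Nat.div_add_mod n B
    have := Nat.mod_lt n h.B_pos
    omega
  have hBm : B * m ≤ n := Nat.mul_div_le n B
  have hℓ : 0 < r / m := by
    refine Nat.div_pos ?_ hm
    have h1 : n ≤ r * B := by exact_mod_cast h.n_le_r_mul
    by_contra hlt
    push Not at hlt
    have : (r + 1) * B ≤ m * B := Nat.mul_le_mul_right B hlt
    have := h.B_pos
    nlinarith
  -- Rounding `n / B` and `r / m` down loses a factor of at most `2`, as both are at least `1`.
  have hmn : (n : ℝ) ≤ 2 * B * m := by
    have : n ≤ 2 * B * m := by nlinarith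
    exact_mod_cast this
  have hℓr : (r : ℝ) * B ≤ 2 * n * (r / m : ℕ) := by
    have h1 : r < m * (r / m + 1) := by
      rw [mul_add_one]
      have := Nat.div_add_mod r m
      have := Nat.mod_lt r hm
      omega
    have h2 : m * (r / m + 1) ≤ 2 * (m * (r / m)) := by nlinarith
    have : r * B ≤ 2 * n * (r / m) := by
      calc r * B ≤ (2 * (m * (r / m))) * B := Nat.mul_le_mul_right B (h1.le.trans h2)
        _ = 2 * (B * m) * (r / m) := by ring
        _ ≤ _ := by gcongr
    exact_mod_cast this
  have hfib := fun q => card_fiber_slotOf (r := r) hm q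
  have h1 := pr_prod_ge (A := fun σ : Fin (12 * (γ + 3)) → Fin M =>
      NormGood (12 * (γ + 3)) x i₀ j₀ (normEst g x σ))
    (B := fun σ (ω : ((Fin r → Fin M) × Fin M) × (Labels n B m C × Fin M × (Fin r → Fin M))) =>
      TrialReveals g s x (slotOf r hm) τ i₀ j₀ (σ, ω))
    (p := 1 / 2) (q := 1 / 48 * (1 / (2 * (C : ℝ) ^ 2))) (by positivity)
    (pr_normGood hn hg hx i₀ j₀) ?_
  · refine le_trans (le_of_eq ?_) (h1.trans (pr_mono fun ω hω => hω.2))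
    field_simp; norm_num
  intro σ hσ
  refine (pr_prod_ge (A := fun ω₁ : (Fin r → Fin M) × Fin M =>
      τ ≤ rowEst g s x (normEst g x σ) ω₁ i₀ ^ 2 ∧
        #{i | τ ≤ rowEst g s x (normEst g x σ) ω₁ i ^ 2} ≤ B)
    (B := fun ω₁ (ω₂ : Labels n B m C × Fin M × (Fin r → Fin M)) =>
      TrialReveals g s x (slotOf r hm) τ i₀ j₀ (σ, ω₁, ω₂)) (by positivity)
      (pr_rowEst_good hT0 hr h.n_pos h.B_pos hg hs hx hσ hτ0 ?_ ?_) ?_).trans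
      (pr_mono fun ω hω => hω.2)
  -- The constant in `rowFactor` is made for the equality `e1`.
  · have e1 : (r : ℝ) ^ 2 * (rowFactor γ * (B * φ ^ 2)) / (128 * ((12 * (γ + 3) : ℕ) : ℝ) ^ 2) =
        4 * τ := by
      have hT : ((12 * (γ + 3) : ℕ) : ℝ) ≠ 0 := by exact_mod_cast hT0.ne'
      rw [hτ, rowThreshold, rowFactor, Nat.cast_mul, Nat.cast_pow]
      generalize ((12 * (γ + 3) : ℕ) : ℝ) = T at *
      field_simp
      norm_num
    have e2 : 16 * (r : ℝ) * n ≤ 2 * τ := by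
      rw [hτ, rowThreshold]
      have := mul_le_mul_of_nonneg_left h.n_le hr0.le
      nlinarith [mul_nonneg hr0.le hn0.le]
    calc 2 * τ + 16 * r * n ≤ 4 * τ := by linarith
      _ = _ := e1.symm
      _ ≤ _ := by gcongr
  · have e1 := sum_sq_le h hx hX
    have e2 := mul_le_mul_of_nonneg_left h.le_r hr0.le
    calc 48 * (4 * (r : ℝ) ^ 2 * (∑ i, ∑ j, dot (x i) (x j) ^ 2) + 8 * r * n ^ 2)
        ≤ 48 * (4 * (r : ℝ) ^ 2 * (3 * (B ^ 2 * φ ^ 2)) + 8 * (r * (r * B ^ 2 * φ ^ 2))) := by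
          have : 8 * (r : ℝ) * n ^ 2 ≤ 8 * (r * (r * B ^ 2 * φ ^ 2)) := by linarith
          gcongr
      _ = τ * B := by rw [hτ, rowThreshold]; ring
  intro ω₁ hω₁
  set e : Fin n → ℝ := fun i => if rowEst g s x (normEst g x σ) ω₁ i ^ 2 < τ then 0 else 1 with he
  have hkeep : ∀ ω₂ i, keep (γ := γ) g s x τ (σ, ω₁, (ω₂ : Labels n B m C × Fin M ×
      (Fin r → Fin M))) i = e i := fun ω₂ i => by
    simp only [keep, he]
  simp only [TrialReveals, hkeep]
  have hscale : ∀ i, scaleOf (normEst g x σ i) ^ 2 ≤ 2 := fun i => scaleOf_sq_le (hσ.lower i)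
  have he0 : ∀ i, 0 ≤ e i := fun i => by simp only [he]; split_ifs <;> norm_num
  have he1 : ∀ i, e i ≤ 1 := fun i => by simp only [he]; split_ifs <;> norm_num
  have hei₀ : e i₀ = 1 := if_neg (not_lt.2 hω₁.1)
  have hα : ∀ i, (e i * scaleOf (normEst g x σ i)) ^ 2 ≤ 2 := fun i => by
    rw [mul_pow]
    exact (mul_le_of_le_one_left (sq_nonneg _) (pow_le_one₀ (he0 i) (he1 i))).trans (hscale i)
  have hE : ∑ i, e i ≤ B := by
    have e1 : ∑ i, e i = #{i | τ ≤ rowEst g s x (normEst g x σ) ω₁ i ^ 2} := by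
      rw [← Finset.sum_boole]
      refine Finset.sum_congr rfl fun i _ => ?_
      simp only [he]
      split_ifs with h1 h2 h2
      · exact absurd h2 (not_le.2 h1)
      · rfl
      · rfl
      · exact absurd (not_lt.1 h1) h2
    rw [e1]
    exact_mod_cast hω₁.2
  have hℓ' : (0 : ℝ) ≤ 1 / (r / m : ℕ) := by positivity
  have ha : (0 : ℝ) ≤ 2 * (testFactor γ : ℕ) / φ ^ 2 := by positivity
  refine pr_reveals (w := pairWeight x X True j₀ e (2 * (testFactor γ : ℕ) / φ ^ 2)
    (1 / (r / m : ℕ))) (G := (testFactor γ : ℕ)) hg hs hx hℓ hT0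
    (fun q => (hfib q).2.trans (by omega)) (fun q => (hfib q).1) hC2 h.B_pos hm
    (Test.sign_sq _) (Test.sign_sq _) hα hscale hij
    (by rw [hei₀, one_mul]; exact inv_le_scaleOf_sq (hσ.lower _) hσ.left)
    (inv_le_scaleOf_sq (hσ.lower _) hσ.right) hφ0 hφ
    (testFactor_eq γ) (pairWeight_nonneg he0 ha hℓ')
    (le_pairWeight he0 hℓ' (Nat.cast_nonneg _) hα fun i => ?_) ?_
  · simp only [he]
    split_ifs
    · exact Or.inr (zero_mul _)
    · exact Or.inl rfl
  have htail : ∑ v, (if i₀ = v ∨ (i₀, v) ∈ X then 0 else dot (x i₀) (x v) ^ 2) ≤ n * φ ^ 2 := by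
    have : ∀ v ∈ univ, (if i₀ = v ∨ (i₀, v) ∈ X then 0 else dot (x i₀) (x v) ^ 2) ≤ φ ^ 2 := by
      intro v _
      split_ifs with hv
      · positivity
      · exact hX.entry _ _ (fun h => hv (Or.inl h)) fun h => hv (Or.inr h)
    simpa using Finset.sum_le_card_nsmul univ _ _ this
  have hrow := pairWeight_row (J := True) (j₀ := j₀) he0 he1 ha hℓ' hX.card_le (i := i₀) htail
  have hcol := pairWeight_col' (x := x) (j₀ := j₀) (e := e) (a := 2 * (testFactor γ : ℕ) / φ ^ 2)
    (b := 1 / (r / m : ℕ)) hX.card_le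
  have htot := pairWeight_total (J := True) (j₀ := j₀) he0 he1 ha hℓ' hX le_rfl
  refine le_trans ?_ (h.total_slots (C := C) hE (by
    rw [hC]
    exact_mod_cast Nat.le_mul_of_pos_right _ hH) hm hℓ hmn hℓr)
  gcongr

end

end

/-! ### The correlation matrix as a Gram matrix of unit vectors -/

section
variable {n p : ℕ} {A : Matrix (Fin n) (Fin p) ℝ}

/-- The centred rows, scaled to norm `1`. -/
noncomputable def unitRow (A : Matrix (Fin n) (Fin p) ℝ) (i : Fin n) (j : Fin p) : ℝ :=
  centered A i j / Real.sqrt (dot (centered A i) (centered A i))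

theorem sampleCov_eq (A : Matrix (Fin n) (Fin p) ℝ) (i j : Fin n) :
    sampleCov A i j = 1 / ((p : ℝ) - 1) * dot (centered A i) (centered A j) := by
  simp [sampleCov, Matrix.mul_apply, dot]

theorem dot_centered_pos {i : Fin n} (h : sampleCov A i i ≠ 0) :
    0 < dot (centered A i) (centered A i) := by
  refine lt_of_le_of_ne (dot_self_nonneg _) fun h0 => h ?_
  rw [sampleCov_eq, ← h0, mul_zero]

theorem dof_pos {i : Fin n} (h : sampleCov A i i ≠ 0) : 0 < 1 / ((p : ℝ) - 1) := by
  rw [sampleCov_eq] at h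
  rcases p with _ | _ | p
  · exact absurd (by simp [dot]) h
  · exact absurd (by simp) h
  · push_cast
    rw [one_div_pos]
    have : (0 : ℝ) ≤ p := Nat.cast_nonneg p
    linarith

theorem dot_div_div (u y : Fin p → ℝ) (a b : ℝ) :
    dot (fun j => u j / a) (fun j => y j / b) = dot u y / (a * b) := by
  simp only [dot, Finset.sum_div, div_mul_div_comm]

theorem dot_unitRow_self {i : Fin n} (h : sampleCov A i i ≠ 0) :
    dot (unitRow A i) (unitRow A i) = 1 := by
  have h1 := dot_centered_pos h
  rw [show unitRow A i = fun j => centered A i j / _ from rfl, dot_div_div,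
    Real.mul_self_sqrt h1.le, div_self h1.ne']

theorem sampleCorr_eq_dot (hA : ∀ i, sampleCov A i i ≠ 0) (i j : Fin n) :
    sampleCorr A i j = dot (unitRow A i) (unitRow A j) := by
  have hi := dot_centered_pos (hA i)
  have hj := dot_centered_pos (hA j)
  have hd := dof_pos (hA i)
  rw [show unitRow A i = fun t => centered A i t / _ from rfl,
    show unitRow A j = fun t => centered A j t / _ from rfl, dot_div_div, sampleCorr,
    Matrix.mul_diagonal, Matrix.diagonal_mul, sampleCov_eq, sampleCov_eq, sampleCov_eq,
    Real.sqrt_mul hd.le, Real.sqrt_mul hd.le]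
  set c := 1 / ((p : ℝ) - 1)
  have e : c = Real.sqrt c * Real.sqrt c := (Real.mul_self_sqrt hd.le).symm
  have hc := Real.sqrt_pos.2 hd
  have h1 := Real.sqrt_pos.2 hi
  have h2 := Real.sqrt_pos.2 hj
  rw [mul_inv, mul_inv]
  nth_rewrite 2 [e]
  field_simp

/-- If at most `k` entries are large, the entries outside the top `k` are at most `φ`. -/
theorem tailBound_of_isTop (hA : ∀ i, sampleCov A i i ≠ 0) {φ R : ℝ} (hR : 0 ≤ R)
    {k : ℕ} (hlarge : #(large (sampleCorr A) φ) ≤ k) {X : Finset (Fin n × Fin n)}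
    (hX : IsTop (sampleCorr A) k X) (hF : frobenius (removeEntries (sampleCorr A) X) ≤ R) :
    TailBound (unitRow A) φ R k X := by
  refine ⟨hX.2.1.trans_le (min_le_left _ _), fun i v hiv hv => ?_, ?_⟩
  · rw [← sampleCorr_eq_dot hA, ← sq_abs]
    refine pow_le_pow_left₀ (abs_nonneg _) ?_ 2
    by_contra! hlt
    have hoff : (i, v) ∈ (univ : Finset (Fin n)).offDiag := by simpa using hiv
    have htop : ∀ e ∈ X, |sampleCorr A i v| ≤ |sampleCorr A e.1 e.2| :=
      fun e he => hX.2.2 e he (i, v) hoff hv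
    have hsub : insert (i, v) X ⊆ large (sampleCorr A) φ := by
      intro e he
      rw [Finset.mem_insert] at he
      rcases he with rfl | he
      · rw [large, Finset.mem_filter]
        exact ⟨hoff, hlt.le⟩
      · rw [large, Finset.mem_filter]
        exact ⟨hX.1 he, hlt.le.trans (htop e he)⟩
    have hcard := Finset.card_insert_of_notMem hv
    have h1 : #X + 1 ≤ k := hcard ▸ (Finset.card_le_card hsub).trans hlarge
    have h2 : #X + 1 ≤ #(univ : Finset (Fin n)).offDiag :=
      hcard ▸ Finset.card_le_card (Finset.insert_subset hoff hX.1)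
    have h3 := hX.2.1
    generalize #(univ : Finset (Fin n)).offDiag = N at h2 h3
    omega
  · have h1 : ∑ i, ∑ j, removeEntries (sampleCorr A) X i j ^ 2 ≤ R ^ 2 := by
      rw [frobenius] at hF
      exact (Real.sqrt_le_left hR).1 hF
    refine le_trans (le_of_eq ?_) h1
    refine Finset.sum_congr rfl fun i _ => Finset.sum_congr rfl fun v _ => ?_
    rw [removeEntries, Matrix.of_apply, sampleCorr_eq_dot hA]
    split_ifs <;> simp

/-- The sketch of a centred row is a sketch of the row itself, with a centred test vector. -/
theorem sum_centered_mul (A : Matrix (Fin n) (Fin p) ℝ) (u : Fin p → ℝ) (i : Fin n) :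
    ∑ j, (u j - 1 / (p : ℝ) * ∑ j', u j') * A i j = dot u (centered A i) := by
  simp only [dot, centered, sampleMean, Matrix.sub_apply, Matrix.of_apply, sub_mul, mul_sub,
    Finset.sum_sub_distrib, ← Finset.sum_mul, ← Finset.mul_sum]
  ring

theorem dot_unitRow (u : Fin p → ℝ) {i : Fin n} (h : sampleCov A i i ≠ 0) :
    dot u (centered A i) =
      Real.sqrt (dot (centered A i) (centered A i)) * dot u (unitRow A i) := by
  have h1 := Real.sqrt_pos.2 (dot_centered_pos h)
  change ∑ j, u j * centered A i j =
    Real.sqrt (dot (centered A i) (centered A i)) * ∑ j, u j * unitRow A i j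
  rw [Finset.mul_sum]
  refine Finset.sum_congr rfl fun j _ => ?_
  rw [unitRow, mul_left_comm, mul_div_cancel₀ _ h1.ne']

end

/-! ### The claimed size and the dimensions of the products -/

section
variable {θ φ R : ℝ} {n k G : ℕ}

/-- The inequalities between the claimed size and the dimensions `β` and `ν` of the product before
rounding. -/
theorem sizeBound_facts (h0 : 0 ≤ θ) (hn : 0 < n) (hφ : 0 < φ)
    (hR : 0 ≤ R) (hkR : 0 < k ∨ 0 < R) :
    ∃ β ν : ℝ, outerDim θ n k φ R = ⌈β⌉₊ ∧ innerDim θ n k φ R = ⌈ν⌉₊ ∧ 0 < β ∧ 0 < ν ∧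
      (k : ℝ) ≤ β ∧ R ≤ β * φ ∧ (n : ℝ) ^ 2 ≤ ν * β ^ 2 * φ ^ 2 ∧
      β ^ 2 + 2 * n * ν ≤ 2 * sizeBound θ n k φ R := by
  have hn' : (1 : ℝ) ≤ n := by exact_mod_cast hn
  have hn0 : (0 : ℝ) < n := by linarith
  have hk : (0 : ℝ) ≤ k := Nat.cast_nonneg k
  have hD : 0 < (k : ℝ) ^ 2 * φ ^ 2 + R ^ 2 := by
    rcases hkR with h | h
    · have : (0 : ℝ) < k := by exact_mod_cast h
      positivity
    · positivity
  have hkR' : 0 < (k : ℝ) + R / φ := by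
    rcases hkR with h | h
    · have : (0 : ℝ) < k := by exact_mod_cast h
      positivity
    · positivity
  set P := (n : ℝ) ^ θ with hP
  have hP1 : 1 ≤ P := Real.one_le_rpow hn' h0
  have hP0 : 0 < P := by linarith
  have e1 : (n : ℝ) ^ (2 * θ) = P ^ 2 := by
    rw [hP, ← Real.rpow_natCast, ← Real.rpow_mul hn0.le]; congr 1; push_cast; ring
  have e2 : (n : ℝ) ^ (2 - 2 * θ) = n ^ 2 / P ^ 2 := by
    rw [Real.rpow_sub hn0, e1]; norm_num
  have e3 : (n : ℝ) ^ (3 - 2 * θ) = n ^ 3 / P ^ 2 := by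
    rw [Real.rpow_sub hn0, e1]; norm_num
  refine ⟨P * (k + R / φ), n ^ 2 / P ^ 2 * (1 / (k ^ 2 * φ ^ 2 + R ^ 2)), rfl, by
    rw [innerDim, e2], by positivity, by positivity, ?_, ?_, ?_, ?_⟩
  · have : 0 ≤ R / φ := by positivity
    nlinarith
  · have : P * (k + R / φ) * φ = P * (k * φ + R) := by field_simp
    rw [this]
    have : 0 ≤ k * φ := by positivity
    nlinarith
  · have : (n : ℝ) ^ 2 / P ^ 2 * (1 / (k ^ 2 * φ ^ 2 + R ^ 2)) * (P * (k + R / φ)) ^ 2 * φ ^ 2 =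
        n ^ 2 * ((k * φ + R) ^ 2 / (k ^ 2 * φ ^ 2 + R ^ 2)) := by
      field_simp
    rw [this]
    refine le_mul_of_one_le_right (by positivity) ?_
    rw [one_le_div hD]
    have : 0 ≤ k * φ * R := by positivity
    nlinarith
  · rw [sizeBound, e1, e3]
    have h5 : (P * (k + R / φ)) ^ 2 ≤ 2 * (P ^ 2 * (k ^ 2 + R ^ 2 / φ ^ 2)) := by
      have : ((k : ℝ) + R / φ) ^ 2 ≤ 2 * (k ^ 2 + R ^ 2 / φ ^ 2) := by
        rw [← div_pow]; nlinarith [sq_nonneg ((k : ℝ) - R / φ)]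
      calc (P * (k + R / φ)) ^ 2 = P ^ 2 * (k + R / φ) ^ 2 := by ring
        _ ≤ P ^ 2 * (2 * (k ^ 2 + R ^ 2 / φ ^ 2)) := by gcongr
        _ = _ := by ring
    have h6 : 2 * n * (n ^ 2 / P ^ 2 * (1 / ((k : ℝ) ^ 2 * φ ^ 2 + R ^ 2))) =
        2 * (n ^ 3 / P ^ 2 * (1 / ((k : ℝ) ^ 2 * φ ^ 2 + R ^ 2))) := by ring
    linarith

/-- The claimed size is at least `n ^ (3/2)`, by the inequality of the arithmetic and the geometric
mean. -/
theorem n_le_sizeBound (h0 : 0 ≤ θ) (hn : 0 < n) (hφ : 0 < φ) (hφ1 : φ ≤ 1)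
    (hR : 0 ≤ R) (hkR : 0 < k ∨ 0 < R) : (n : ℝ) ^ 3 ≤ sizeBound θ n k φ R ^ 2 := by
  obtain ⟨β, ν, -, -, hβ, hν, -, -, h2, h3⟩ := sizeBound_facts h0 hn hφ hR hkR
  have hn0 : (0 : ℝ) < n := by exact_mod_cast hn
  have h4 : (n : ℝ) ^ 2 ≤ ν * β ^ 2 := by
    have : φ ^ 2 ≤ 1 := pow_le_one₀ hφ.le hφ1
    have h5 : 0 ≤ ν * β ^ 2 := by positivity
    nlinarith
  have h5 : (β ^ 2 + 2 * n * ν) ^ 2 ≤ (2 * sizeBound θ n k φ R) ^ 2 := by gcongr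
  have h6 : (n : ℝ) * n ^ 2 ≤ n * (ν * β ^ 2) := by gcongr
  nlinarith [sq_nonneg (β ^ 2 - 2 * n * ν)]

/-- If the claimed size is less than `n²` by the factor `(100 G)²`, the dimensions of the product
satisfy the requirements of the trials. -/
theorem regime_of_le (h0 : 0 ≤ θ) (hn : 0 < n) (hφ : 0 < φ) (hφ1 : φ ≤ 1)
    (hR : 0 ≤ R) (hkR : 0 < k ∨ 0 < R) (hG : 0 < G)
    (h : (100 * G : ℝ) ^ 2 * sizeBound θ n k φ R ≤ n ^ 2) :
    Regime n k (outerDim θ n k φ R) (innerDim θ n k φ R) G φ R := by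
  have hcube := n_le_sizeBound h0 hn hφ hφ1 hR hkR
  obtain ⟨β, ν, hB, hr, hβ, hν, h2, h3, h4, h5⟩ := sizeBound_facts h0 hn hφ hR hkR
  rw [hB, hr]
  have hn0 : (0 : ℝ) < n := by exact_mod_cast hn
  have hG1 : (1 : ℝ) ≤ G := by exact_mod_cast hG
  have hβB : β ≤ (⌈β⌉₊ : ℝ) := Nat.le_ceil β
  have hνr : ν ≤ (⌈ν⌉₊ : ℝ) := Nat.le_ceil ν
  have hB1 : (⌈β⌉₊ : ℝ) ≤ β + 1 := (Nat.ceil_lt_add_one hβ.le).le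
  set S := sizeBound θ n k φ R
  set q : ℝ := 100 * G with hq
  have hq1 : 1 ≤ q := by rw [hq]; linarith
  have hS : 0 ≤ S := by nlinarith [sq_nonneg β, mul_nonneg hn0.le hν.le]
  have hqβ : q * β ≤ 2 * n := by
    refine le_of_sq_le_sq ?_ (by positivity)
    nlinarith [mul_nonneg hn0.le hν.le, mul_le_mul_of_nonneg_left
      (show β ^ 2 ≤ 2 * S by nlinarith [mul_nonneg hn0.le hν.le]) (sq_nonneg q)]
  have hqn : q ≤ n := by
    have h6 : (q ^ 2 * S) ^ 2 ≤ ((n : ℝ) ^ 2) ^ 2 := by gcongr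
    have h7 : q ^ 4 * (n : ℝ) ^ 3 ≤ n * n ^ 3 := by
      calc q ^ 4 * (n : ℝ) ^ 3 ≤ q ^ 4 * S ^ 2 := by gcongr
        _ = (q ^ 2 * S) ^ 2 := by ring
        _ ≤ _ := h6
        _ = _ := by ring
    have h8 := le_of_mul_le_mul_right h7 (by positivity)
    refine le_trans ?_ h8
    exact le_self_pow₀ hq1 (by norm_num)
  have hnν : ν * q ^ 2 ≤ n := by
    refine le_of_mul_le_mul_right (?_ : ν * q ^ 2 * n ≤ n * n) hn0
    nlinarith [mul_le_mul_of_nonneg_left (show n * ν ≤ S by nlinarith [sq_nonneg β])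
      (sq_nonneg q)]
  refine ⟨hn, hG, hφ, hφ1, hR, h2.trans hβB, h3.trans (by gcongr), ?_, ?_, h4.trans (by gcongr)⟩
  · nlinarith
  · refine le_trans ?_ (show β ^ 2 * φ ^ 2 ≤ _ by gcongr)
    have hν1 : ν ≤ n := by
      nlinarith [mul_le_mul_of_nonneg_left (one_le_pow₀ hq1 (n := 2)) hν.le]
    refine le_of_mul_le_mul_left (?_ : ν * (n : ℝ) ≤ ν * (β ^ 2 * φ ^ 2)) hν
    nlinarith

theorem outerDim_sq_le (h0 : 0 ≤ θ) (hn : 0 < n) (hφ : 0 < φ) (hφ1 : φ ≤ 1)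
    (hR : 0 ≤ R) (hkR : 0 < k ∨ 0 < R) :
    (n : ℝ) ≤ sizeBound θ n k φ R ∧
      (outerDim θ n k φ R : ℝ) ^ 2 ≤ 6 * sizeBound θ n k φ R ∧
      (n : ℝ) * innerDim θ n k φ R ≤ 2 * sizeBound θ n k φ R := by
  have hcube := n_le_sizeBound h0 hn hφ hφ1 hR hkR
  obtain ⟨β, ν, hB, hr, hβ, hν, h2, h3, h4, h5⟩ := sizeBound_facts h0 hn hφ hR hkR
  rw [hB, hr]
  have hn0 : (1 : ℝ) ≤ n := by exact_mod_cast hn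
  have hB1 : (⌈β⌉₊ : ℝ) ≤ β + 1 := (Nat.ceil_lt_add_one hβ.le).le
  have hr1 : (⌈ν⌉₊ : ℝ) ≤ ν + 1 := (Nat.ceil_lt_add_one hν.le).le
  set S := sizeBound θ n k φ R
  have hnν : 0 ≤ n * ν := by positivity
  have hS : 0 ≤ S := by nlinarith [sq_nonneg β]
  have hnS : (n : ℝ) ≤ S := by
    refine le_of_sq_le_sq ((?_ : (n : ℝ) ^ 2 ≤ n ^ 3).trans hcube) hS
    exact pow_le_pow_right₀ hn0 (by norm_num)
  refine ⟨hnS, ?_, ?_⟩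
  · calc (⌈β⌉₊ : ℝ) ^ 2 ≤ (β + 1) ^ 2 := by gcongr
      _ ≤ 2 * β ^ 2 + 2 := by nlinarith [sq_nonneg (β - 1)]
      _ ≤ _ := by nlinarith
  · calc (n : ℝ) * ⌈ν⌉₊ ≤ n * (ν + 1) := by gcongr
      _ ≤ _ := by nlinarith [sq_nonneg β]

end

/-! ### Lists of operations over finite index types -/

/-- The position of an element of a finite type in the arrays. -/
noncomputable def code {α : Type*} [Fintype α] (a : α) : ℕ := Fintype.equivFin α a

theorem code_lt {α : Type*} [Fintype α] (a : α) : code a < Fintype.card α :=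
  (Fintype.equivFin α a).2

theorem code_inj {α : Type*} [Fintype α] {a b : α} : code a = code b ↔ a = b := by
  rw [code, code, Fin.val_inj, EmbeddingLike.apply_eq_iff_eq]

open Classical in
/-- The list of the items `f j`, for the `j` with property `P`. -/
noncomputable def ops {J X : Type*} [Fintype J] (P : J → Prop) (f : J → X) : List X :=
  (univ.filter P).toList.map f

section
variable {J X : Type*} [Fintype J] {P : J → Prop} {f : J → X}

theorem length_ops_le : (ops P f).length ≤ Fintype.card J := by
  classical
  rw [ops, List.length_map, Finset.length_toList]
  exact Finset.card_le_univ _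

theorem mem_ops {y : X} : y ∈ ops P f ↔ ∃ j, P j ∧ f j = y := by
  simp [ops]

open Classical in
theorem sum_ops {R : Type*} [AddCommMonoid R] (φ : X → R) :
    ((ops P f).map φ).sum = ∑ j, if P j then φ (f j) else 0 := by
  rw [ops, List.map_map, Finset.sum_map_toList, Finset.sum_filter]
  rfl

end

theorem mulAdd_fold (D A B : ℕ) (hA : A ≠ D) (hB : B ≠ D) (l : List (ℕ × ℕ × ℕ)) (m : Mem) :
    ∃ m', l.foldl (fun m x => mulAddEff D A B x m) m = m' ∧
      m'.out = m.out ∧ m'.words = m.words ∧ (∀ E, E ≠ D → m'.reals E = m.reals E) ∧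
      ∀ z, m'.reals D z = m.reals D z +
        (l.map fun x => if x.1 = z then m.reals A x.2.1 * m.reals B x.2.2 else 0).sum := by
  refine ⟨_, foldl_mulAdd hA hB _ m, rfl, rfl, fun E hE => Function.update_of_ne hE _ _,
    fun z => ?_⟩
  dsimp only
  rw [Function.update_self]

section
variable {J : Type*} [Fintype J]

theorem mask_ops {d c : J → ℕ} (hd : Function.Injective d) (m : Mem) :
    ∃ f : ℕ → ℝ, (ops (fun _ => True) fun j => (d j, c j)).foldl (fun m x => maskEff x m) m =
        ⟨m.out, m.words, Function.update m.reals 7 f⟩ ∧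
      ∀ j, f (d j) = if m.reals 6 (d j) * m.reals 6 (d j) < m.reals 1 (c j) then 0 else 1 := by
  obtain ⟨f, h1, h2, -⟩ := foldl_mask (ops (fun _ => True) fun j => (d j, c j)) m
    fun x hx y hy h => by
      obtain ⟨j, -, rfl⟩ := mem_ops.1 hx
      obtain ⟨j', -, rfl⟩ := mem_ops.1 hy
      rw [hd h]
  exact ⟨f, h1, fun j => h2 (d j, c j) (mem_ops.2 ⟨j, trivial, rfl⟩)⟩

theorem copy_ops {D A : ℕ} (hA : A ≠ D) {d a : J → ℕ} (hd : Function.Injective d) (m : Mem) :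
    ∃ f : ℕ → ℝ, (ops (fun _ => True) fun j => (d j, a j)).foldl (fun m x => copyEff D A x m) m =
        ⟨m.out, m.words, Function.update m.reals D f⟩ ∧
      (∀ j, f (d j) = m.reals A (a j)) ∧ ∀ z, (∀ j, d j ≠ z) → f z = m.reals D z := by
  obtain ⟨f, h1, h2, h3⟩ := foldl_copy hA (ops (fun _ => True) fun j => (d j, a j)) m
    fun x hx y hy h => by
      obtain ⟨j, -, rfl⟩ := mem_ops.1 hx
      obtain ⟨j', -, rfl⟩ := mem_ops.1 hy
      rw [hd h]
  refine ⟨f, h1, fun j => h2 (d j, a j) (mem_ops.2 ⟨j, trivial, rfl⟩), fun z hz => h3 z ?_⟩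
  intro hm
  obtain ⟨y, hy, hyz⟩ := List.mem_map.1 hm
  obtain ⟨j, -, rfl⟩ := mem_ops.1 hy
  exact hz j hyz

end

/-- The data of the multiplication number `ρ`, of a `B × r` by an `r × B` matrix. The
factors and the product are at the positions `code (ρ, a, b)` of the arrays `9`, `10` and `14`. -/
noncomputable def roundOf {Q : Type*} [Fintype Q] (B r : ℕ) (ρ : Q) : RoundData where
  left := ops (fun _ => True) fun j : Fin B × Fin r => ((j.1 : ℕ) * r + j.2, code (ρ, j.1, j.2))
  right := ops (fun _ => True) fun j : Fin r × Fin B => ((j.1 : ℕ) * B + j.2, code (ρ, j.1, j.2))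
  dims := (B, r)
  prod := ops (fun _ => True) fun j : Fin B × Fin B => (code (ρ, j.1, j.2), (j.1 : ℕ) * B + j.2)

theorem mul_add_inj {a b : ℕ} :
    Function.Injective fun j : Fin a × Fin b => (j.1 : ℕ) * b + j.2 := by
  rintro ⟨i, j⟩ ⟨i', j'⟩ h
  simp only at h
  have hb : 0 < b := j.pos
  have h1 : (i : ℕ) = i' := by
    have := congrArg (· / b) h
    simpa [Nat.add_comm _ (j : ℕ), Nat.add_comm _ (j' : ℕ), Nat.add_mul_div_right _ _ hb,
      Nat.div_eq_of_lt j.2, Nat.div_eq_of_lt j'.2] using this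
  have h2 : (j : ℕ) = j' := by rw [h1] at h; omega
  rw [Prod.mk.injEq]
  exact ⟨Fin.ext h1, Fin.ext h2⟩

theorem roundOf_eff {Q : Type*} [Fintype Q] {B r : ℕ} (ρ : Q) (m : Mem) :
    ((roundOf B r ρ).eff m).out = m.out ∧ ((roundOf B r ρ).eff m).words = m.words ∧
      (∀ A, A < 11 → ((roundOf B r ρ).eff m).reals A = m.reals A) ∧
      (∀ a b : Fin B, ((roundOf B r ρ).eff m).reals 14 (code (ρ, a, b)) =
        ∑ l : Fin r, m.reals 9 (code (ρ, a, l)) * m.reals 10 (code (ρ, l, b))) ∧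
      ∀ ρ', ρ' ≠ ρ → ∀ a b : Fin B, ((roundOf B r ρ).eff m).reals 14 (code (ρ', a, b)) =
        m.reals 14 (code (ρ', a, b)) := by
  obtain ⟨f, hf, hf1, -⟩ := copy_ops (D := 11) (A := 9) (by norm_num)
    (a := fun j : Fin B × Fin r => code (ρ, j.1, j.2)) (mul_add_inj (a := B) (b := r)) m
  set m₁ : Mem := ⟨m.out, m.words, Function.update m.reals 11 f⟩ with hm₁
  obtain ⟨f', hf', hf1', -⟩ := copy_ops (D := 12) (A := 10) (by norm_num)
    (a := fun j : Fin r × Fin B => code (ρ, j.1, j.2)) (mul_add_inj (a := r) (b := B)) m₁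
  set m₂ : Mem := ⟨m₁.out, m₁.words, Function.update m₁.reals 12 f'⟩ with hm₂
  obtain ⟨f'', hf'', hf1'', hf2''⟩ := copy_ops (D := 14) (A := 13) (by norm_num)
    (d := fun j : Fin B × Fin B => code (ρ, j.1, j.2))
    (a := fun j : Fin B × Fin B => (j.1 : ℕ) * B + j.2)
    (fun j j' h => by
      have := code_inj.1 h
      simpa [Prod.ext_iff] using this) (matmulEff (B, r) m₂)
  have he : (roundOf B r ρ).eff m =
      ⟨m.out, m.words, Function.update (matmulEff (B, r) m₂).reals 14 f''⟩ := by
    rw [RoundData.eff, roundOf]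
    simp only
    rw [hf, hf', hf'']
    rfl
  rw [he]
  refine ⟨rfl, rfl, fun A hA => ?_, fun a b => ?_, fun ρ' hρ a b => ?_⟩
  · simp only [matmulEff, hm₂, hm₁]
    rw [Function.update_of_ne (by omega), Function.update_of_ne (by omega),
      Function.update_of_ne (by omega), Function.update_of_ne (by omega)]
  · dsimp only
    rw [Function.update_self, hf1'' (a, b)]
    have hB : 0 < B := a.pos
    have hlt : (a : ℕ) * B + b < B * B := by
      have := a.2
      have := b.2
      nlinarith
    have hdiv : ((a : ℕ) * B + b) / B = a := by
      rw [Nat.add_comm, Nat.add_mul_div_right _ _ hB, Nat.div_eq_of_lt b.2, Nat.zero_add]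
    have hmod : ((a : ℕ) * B + b) % B = b := by
      rw [Nat.add_comm, Nat.add_mul_mod_self_right, Nat.mod_eq_of_lt b.2]
    simp only [matmulEff, Function.update_self, mulArr, if_pos hlt, hdiv, hmod]
    rw [Finset.sum_range]
    refine Finset.sum_congr rfl fun l _ => ?_
    have e1 := hf1 (a, l)
    have e2 := hf1' (l, b)
    simp only at e1 e2
    rw [hm₂]
    simp only
    rw [Function.update_self, e2, hm₁]
    simp only
    rw [Function.update_of_ne (show (11 : ℕ) ≠ 12 by norm_num),
      Function.update_of_ne (show (10 : ℕ) ≠ 11 by norm_num), Function.update_self, e1]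
  · dsimp only
    rw [Function.update_self, hf2'' _ fun j h => hρ (congrArg Prod.fst (code_inj.1 h)).symm]
    simp only [matmulEff, hm₂, hm₁]
    rw [Function.update_of_ne (by omega), Function.update_of_ne (by omega),
      Function.update_of_ne (by omega)]

theorem rounds_eff {Q : Type*} [Fintype Q] {B r : ℕ} (l : List Q) (m : Mem) :
    ((l.map (roundOf B r)).foldl (fun m x => x.eff m) m).out = m.out ∧
      ((l.map (roundOf B r)).foldl (fun m x => x.eff m) m).words = m.words ∧
      ∀ ρ, (ρ ∈ l ∨ ∀ a b : Fin B, m.reals 14 (code (ρ, a, b)) =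
          ∑ l : Fin r, m.reals 9 (code (ρ, a, l)) * m.reals 10 (code (ρ, l, b))) → ∀ a b : Fin B,
        ((l.map (roundOf B r)).foldl (fun m x => x.eff m) m).reals 14 (code (ρ, a, b)) =
          ∑ l : Fin r, m.reals 9 (code (ρ, a, l)) * m.reals 10 (code (ρ, l, b)) := by
  classical
  induction l generalizing m with
  | nil => simp
  | cons q l ih =>
    obtain ⟨h1, h2, h3, h4, h5⟩ := roundOf_eff (B := B) (r := r) q m
    obtain ⟨i1, i2, i3⟩ := ih ((roundOf B r q).eff m)
    rw [h3 9 (by norm_num), h3 10 (by norm_num)] at i3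
    simp only [List.map_cons, List.foldl_cons]
    refine ⟨i1.trans h1, i2.trans h2, fun ρ hρ => i3 ρ ?_⟩
    by_cases hq : ρ = q
    · right
      rw [hq]
      exact h4
    · rcases hρ with hρ | hρ
      · exact Or.inl ((List.mem_cons.1 hρ).resolve_left hq)
      · exact Or.inr fun a b => by rw [h5 ρ hq, hρ]

/-! ### The data of the query -/

theorem sum_ite_fiber {J L R : Type*} [AddCommMonoid R] [Fintype J] [Fintype L] (e : L → J)
    (he : Function.Injective e) {P : J → Prop} [DecidablePred P]
    (hP : ∀ j, P j → ∃ l, e l = j) (f : J → R) :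
    ∑ j, (if P j then f j else 0) = ∑ l, if P (e l) then f (e l) else 0 :=
  (Fintype.sum_of_injective e he _ _ (fun _ hj => if_neg fun h => hj (hP _ h)) fun _ => rfl).symm

open Classical in
/-- The position of a sign among the fixed reals, which begin with `1` and `-1`. -/
noncomputable def signIdx (v : ℝ) : ℕ := if v = 1 then 0 else 1

/-- The counters of a row in a trial: those for the norm, for the correlation norm of the row, and
for the product. -/
abbrev Coord (γ r : ℕ) := Fin (12 * (γ + 3)) ⊕ (Fin r ⊕ Fin r)

section
variable {ι : Type} [Fintype ι] {n M γ r B C : ℕ} (m : ι → ℕ) (sl : ∀ t, Fin r → Fin (m t))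
  (swap : ι → Bool) (thr : ι → ℕ) (s : Fin M → Fin n → ℝ)
  (ω : ∀ t, TrialSeeds n M γ r B (m t) C)

/-- The data of the query for the trials `ι`: `m t` is the number of slots of the trial `t`, `thr t`
the position of its threshold among the fixed reals, and `swap t` says whether the row of the left
side comes second in the output. In each trial, every cell of the product yields an output pair,
which starts as `(0, 0)`; if a test changes the sign of the cell, then `2 ^ b` is added for the
bit `b` of the test to the index that belongs to the side of the test. -/
noncomputable def queryData : QueryData where
  init := List.replicate (Fintype.card (ι × Fin B × Fin B)) (0, 0)
  norm := ops (fun _ => True) fun j : ι × Fin n × Fin (12 * (γ + 3)) =>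
    (code (j.1, j.2.1), code (j.1, j.2.1, (Sum.inl j.2.2 : Coord γ r)),
      code (j.1, j.2.1, (Sum.inl j.2.2 : Coord γ r)))
  invSqrt := ops (fun _ => True) fun j : ι × Fin n => code j
  scale := ops (fun _ => True) fun j : ι × Fin n × (Fin r ⊕ Fin r) =>
    (code j, code (j.1, j.2.1, (Sum.inr j.2.2 : Coord γ r)), code (j.1, j.2.1))
  signSum := ops (fun _ => True) fun j : ι × Fin n × Fin r =>
    (code (j.1, j.2.2), code (j.1, j.2.1, (Sum.inl j.2.2 : Fin r ⊕ Fin r)),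
      signIdx (s (ω j.1).2.1.2 j.2.1))
  estimate := ops (fun _ => True) fun j : ι × Fin n × Fin r =>
    (code (j.1, j.2.1), code (j.1, j.2.1, (Sum.inl j.2.2 : Fin r ⊕ Fin r)), code (j.1, j.2.2))
  mask := ops (fun _ => True) fun j : ι × Fin n => (code j, thr j.1)
  masked := ops (fun _ => True) fun j : ι × Fin n × Fin r =>
    (code j, code (j.1, j.2.1, (Sum.inr j.2.2 : Fin r ⊕ Fin r)), code (j.1, j.2.1))
  left := ops (fun j : (ι × Test γ) × Fin n × Fin r => (ω j.1.1).2.2.1.isLeft j.2.1) fun j =>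
    (code (j.1, (ω j.1.1).2.2.1.bucketL j.2.1 (sl j.1.1 j.2.2), j.2.2),
      code (j.1.1, j.2.1, j.2.2),
      signIdx (j.1.2.sign false j.2.1 * s (ω j.1.1).2.2.2.1 j.2.1))
  right := ops (fun j : (ι × Test γ) × Fin n × Fin r => (ω j.1.1).2.2.1.isRight j.2.1 ∧
      (ω j.1.1).2.2.1.slot j.2.1 = sl j.1.1 j.2.2) fun j =>
    (code (j.1, j.2.2, (ω j.1.1).2.2.1.bucketR j.2.1),
      code (j.1.1, j.2.1, (Sum.inr j.2.2 : Fin r ⊕ Fin r)),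
      signIdx (j.1.2.sign true j.2.1 * s (ω j.1.1).2.2.2.1 j.2.1))
  rounds := (univ : Finset (ι × Test γ)).toList.map (roundOf B r)
  compare := ops (fun _ => True) fun j : ι × (Bool × Fin γ) × Fin B × Fin B =>
    (code ((j.1, (none : Test γ)), j.2.2.1, j.2.2.2),
      code ((j.1, (some j.2.1 : Test γ)), j.2.2.1, j.2.2.2), code (j.1, j.2.2.1, j.2.2.2),
      (if j.2.1.1 = swap j.1 then 2 ^ (j.2.1.2 : ℕ) else 0),
      if j.2.1.1 = swap j.1 then 0 else 2 ^ (j.2.1.2 : ℕ))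

/-! The numbers that the query computes from the counters `x`. -/

variable (x : ι × Fin n × Coord γ r → ℝ)

/-- The estimate of the squared norm of the centred row. -/
def normVal (t : ι) (i : Fin n) : ℝ := ∑ u, x (t, i, Sum.inl u) * x (t, i, Sum.inl u)

/-- The sketches of the row, divided by the estimate of its norm. -/
noncomputable def scaledVal (t : ι) (i : Fin n) (e : Fin r ⊕ Fin r) : ℝ :=
  x (t, i, Sum.inr e) * scaleOf (normVal x t i)

/-- The estimate of the correlation norm of the row. -/
noncomputable def rowVal (t : ι) (i : Fin n) : ℝ :=
  ∑ l, scaledVal x t i (Sum.inl l) *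
    ∑ j, scaledVal x t j (Sum.inl l) * s (ω t).2.1.2 j

open Classical in
/-- The weight `0` or `1` of the row on the left side, for the thresholds `θ`. -/
noncomputable def maskVal (θ : ι → ℝ) (t : ι) (i : Fin n) : ℝ :=
  if rowVal m s ω x t i * rowVal m s ω x t i < θ t then 0 else 1

open Classical in
/-- The entry `(a, b)` of the product for the test `q`. -/
noncomputable def cellVal (θ : ι → ℝ) (t : ι) (q : Test γ) (a b : Fin B) : ℝ :=
  ∑ l, (∑ i, if (ω t).2.2.1.isLeft i ∧ (ω t).2.2.1.bucketL i (sl t l) = a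
      then (scaledVal x t i (Sum.inr l) * maskVal m s ω x θ t i) *
        (q.sign false i * s (ω t).2.2.2.1 i) else 0) *
    ∑ v, if ((ω t).2.2.1.isRight v ∧ (ω t).2.2.1.slot v = sl t l) ∧ (ω t).2.2.1.bucketR v = b
      then scaledVal x t v (Sum.inr l) * (q.sign true v * s (ω t).2.2.2.1 v) else 0

variable {m sl swap thr s ω x}

open Classical in
set_option maxHeartbeats 1000000 in
/-- The output of the query, if it starts with the counters `x`, the signs `1` and `-1` as first two
fixed reals, and otherwise empty real arrays. -/
theorem queryData_eff {W : ℕ → ℕ → ℕ} {Y : ℕ → ℕ → ℝ} (hs : ∀ κ i, s κ i ^ 2 = 1)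
    (hY0 : ∀ c, Y 0 (code c) = x c)
    (hY1 : Y 1 0 = 1) (hY1' : Y 1 1 = -1) (hY : ∀ A, 2 ≤ A → ∀ z, Y A z = 0) :
    ((queryData m sl swap thr s ω).eff ⟨0, W, Y⟩).out = Fintype.card (ι × Fin B × Fin B) ∧
    ∀ t a b, ((queryData m sl swap thr s ω).eff ⟨0, W, Y⟩).words 1 (code (t, a, b)) =
        (∑ q : Bool × Fin γ, if cellVal m sl s ω x (fun t => Y 1 (thr t)) t none a b *
          cellVal m sl s ω x (fun t => Y 1 (thr t)) t (some q) a b < 0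
            then if q.1 = swap t then 2 ^ (q.2 : ℕ) else 0 else 0) ∧
      ((queryData m sl swap thr s ω).eff ⟨0, W, Y⟩).words 2 (code (t, a, b)) =
        (∑ q : Bool × Fin γ, if cellVal m sl s ω x (fun t => Y 1 (thr t)) t none a b *
          cellVal m sl s ω x (fun t => Y 1 (thr t)) t (some q) a b < 0
            then if q.1 = swap t then 0 else 2 ^ (q.2 : ℕ) else 0) := by
  have hsign : ∀ v : ℝ, v ^ 2 = 1 → Y 1 (signIdx v) = v := by
    intro v hv
    rw [signIdx]
    rcases eq_or_eq_neg_of_sq_eq_sq v 1 (by rw [hv, one_pow]) with h | h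
    · rw [if_pos h, hY1, h]
    · rw [if_neg (by rw [h]; norm_num), hY1', h]
  set q := queryData m sl swap thr s ω with hq
  rw [QueryData.eff]
  obtain ⟨a1, a2, -, -, a5⟩ := foldl_emit q.init ⟨0, W, Y⟩
  generalize q.init.foldl (fun m x => emitEff x m) ⟨0, W, Y⟩ = m₀ at *
  dsimp only at a1 a2 a5
  obtain ⟨m₁, b1, b2, b3, b4, b5⟩ := mulAdd_fold 2 0 0 (by norm_num) (by norm_num) q.norm m₀
  rw [b1, foldl_invSqrt]
  generalize hm₂ : (⟨m₁.out, m₁.words, Function.update m₁.reals 3 fun z =>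
      if z ∈ q.invSqrt then 1 / Real.sqrt (m₁.reals 2 z) else m₁.reals 3 z⟩ : Mem) = m₂
  obtain ⟨m₃, d1, d2, d3, d4, d5⟩ := mulAdd_fold 4 0 3 (by norm_num) (by norm_num) q.scale m₂
  obtain ⟨m₄, e1, e2, e3, e4, e5⟩ := mulAdd_fold 5 4 1 (by norm_num) (by norm_num) q.signSum m₃
  obtain ⟨m₅, f1, f2, f3, f4, f5⟩ := mulAdd_fold 6 4 5 (by norm_num) (by norm_num) q.estimate m₄
  obtain ⟨h, g1, g2⟩ := mask_ops (d := fun j : ι × Fin n => code j) (c := fun j => thr j.1)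
    (fun _ _ h => code_inj.1 h) m₅
  replace g1 : q.mask.foldl (fun m x => maskEff x m) m₅ = _ := g1
  rw [d1, e1, f1, g1]
  generalize hm₆ : (⟨m₅.out, m₅.words, Function.update m₅.reals 7 h⟩ : Mem) = m₆
  obtain ⟨m₇, i1, i2, i3, i4, i5⟩ := mulAdd_fold 8 4 7 (by norm_num) (by norm_num) q.masked m₆
  obtain ⟨m₈, j1, j2, j3, j4, j5⟩ := mulAdd_fold 9 8 1 (by norm_num) (by norm_num) q.left m₇
  obtain ⟨m₉, k1, k2, k3, k4, k5⟩ := mulAdd_fold 10 4 1 (by norm_num) (by norm_num) q.right m₈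
  obtain ⟨l1, l2, l3⟩ := rounds_eff (B := B) (r := r) (univ : Finset (ι × Test γ)).toList m₉
  have hrounds : q.rounds = (univ : Finset (ι × Test γ)).toList.map (roundOf B r) := rfl
  rw [i1, j1, k1, hrounds]
  generalize ((univ : Finset (ι × Test γ)).toList.map (roundOf B r)).foldl
    (fun m x => x.eff m) m₉ = m₁₀ at *
  obtain ⟨n1, n2, n3⟩ := foldl_compare q.compare m₁₀
  -- Which arrays are unchanged up to which phase.
  have r2 : m₂.reals 0 = Y 0 ∧ m₂.reals 1 = Y 1 ∧ (∀ z, z ∈ q.invSqrt →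
      m₂.reals 3 z = 1 / Real.sqrt (m₁.reals 2 z)) ∧ (∀ A, 4 ≤ A → m₂.reals A = Y A) ∧
      m₂.out = m₀.out ∧ m₂.words = m₀.words := by
    rw [← hm₂]
    refine ⟨?_, ?_, fun z hz => ?_, fun A hA => ?_, b2, b3⟩ <;> dsimp only
    · rw [Function.update_of_ne (by norm_num), b4 0 (by norm_num), a2]
    · rw [Function.update_of_ne (by norm_num), b4 1 (by norm_num), a2]
    · rw [Function.update_self, if_pos hz]
    · rw [Function.update_of_ne (by omega), b4 A (by omega), a2]
  obtain ⟨p0, p1, p3, pA, pout, pwords⟩ := r2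
  have s1 : m₆.reals 1 = Y 1 ∧ m₆.reals 4 = m₃.reals 4 ∧ m₆.reals 7 = h ∧
      (∀ A, 8 ≤ A → m₆.reals A = Y A) ∧ m₆.out = m₀.out ∧ m₆.words = m₀.words := by
    rw [← hm₆]
    refine ⟨?_, ?_, by dsimp only; rw [Function.update_self], fun A hA => ?_,
      by rw [f2, e2, d2, pout], by rw [f3, e3, d3, pwords]⟩ <;> dsimp only
    · rw [Function.update_of_ne (by norm_num), f4 1 (by norm_num), e4 1 (by norm_num),
        d4 1 (by norm_num), p1]
    · rw [Function.update_of_ne (by norm_num), f4 4 (by norm_num), e4 4 (by norm_num)]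
    · rw [Function.update_of_ne (by omega), f4 A (by omega), e4 A (by omega), d4 A (by omega),
        pA A (by omega)]
  obtain ⟨s1, s4, s7, sA, sout, swords⟩ := s1
  -- The contents of the arrays, phase by phase.
  have c1 : ∀ t i, m₁.reals 2 (code (t, i)) = normVal x t i := by
    intro t i
    rw [b5, a2, hY 2 le_rfl, zero_add]
    simp only [hq, queryData, sum_ops, code_inj, if_true, hY0]
    rw [sum_ite_fiber (fun u => (t, i, u)) (fun u u' h => by simpa using h)]
    · simp [normVal]
    · rintro ⟨t', i', l'⟩ hj
      simp only [Prod.mk.injEq] at hj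
      obtain ⟨rfl, rfl⟩ := hj
      exact ⟨_, rfl⟩
  have c2 : ∀ t i, m₂.reals 3 (code (t, i)) = scaleOf (normVal x t i) := by
    intro t i
    rw [p3 _ (mem_ops.2 ⟨(t, i), trivial, rfl⟩), c1, scaleOf]
  have c3 : ∀ t i e, m₃.reals 4 (code (t, i, e)) = scaledVal x t i e := by
    intro t i e
    rw [d5, pA 4 (by norm_num), hY 4 (by norm_num), zero_add]
    simp only [hq, queryData, sum_ops, code_inj, if_true, p0, hY0, c2]
    rw [Finset.sum_ite_eq' univ (t, i, e), if_pos (Finset.mem_univ _)]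
    rfl
  have c4 : ∀ t l, m₄.reals 5 (code (t, l)) =
      ∑ j, scaledVal x t j (Sum.inl l) * s (ω t).2.1.2 j := by
    intro t l
    rw [e5, d4 5 (by norm_num), pA 5 (by norm_num), hY 5 (by norm_num), zero_add]
    simp only [hq, queryData, sum_ops, code_inj, if_true, c3, d4 1 (by norm_num), p1,
      hsign _ (hs _ _)]
    rw [sum_ite_fiber (fun j => (t, j, l)) (fun u u' h => by simpa using h)]
    · simp
    · rintro ⟨t', i', l'⟩ hj
      simp only [Prod.mk.injEq] at hj
      obtain ⟨rfl, rfl⟩ := hj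
      exact ⟨_, rfl⟩
  have c5 : ∀ t i, m₅.reals 6 (code (t, i)) = rowVal m s ω x t i := by
    intro t i
    rw [f5, e4 6 (by norm_num), d4 6 (by norm_num), pA 6 (by norm_num), hY 6 (by norm_num),
      zero_add]
    simp only [hq, queryData, sum_ops, code_inj, if_true, c4, e4 4 (by norm_num), c3]
    rw [sum_ite_fiber (fun u => (t, i, u)) (fun u u' h => by simpa using h)]
    · simp [rowVal]
    · rintro ⟨t', i', l'⟩ hj
      simp only [Prod.mk.injEq] at hj
      obtain ⟨rfl, rfl⟩ := hj
      exact ⟨_, rfl⟩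
  have c6 : ∀ t i, m₆.reals 7 (code (t, i)) =
      maskVal m s ω x (fun t => Y 1 (thr t)) t i := by
    intro t i
    have h5 : m₅.reals 1 = Y 1 := by
      rw [f4 1 (by norm_num), e4 1 (by norm_num), d4 1 (by norm_num), p1]
    rw [s7, g2 (t, i), h5]
    simp only [c5, maskVal]
  have c7 : ∀ t i l, m₇.reals 8 (code (t, i, l)) = scaledVal x t i (Sum.inr l) *
      maskVal m s ω x (fun t => Y 1 (thr t)) t i := by
    intro t i l
    rw [i5, sA 8 (by norm_num), hY 8 (by norm_num), zero_add]
    simp only [hq, queryData, sum_ops, code_inj, if_true, s4, c3, c6]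
    rw [Finset.sum_ite_eq' univ (t, i, l), if_pos (Finset.mem_univ _)]
  have c8 : ∀ (ρ : ι × Test γ) a l, m₉.reals 9 (code (ρ, a, l)) = ∑ i,
      if (ω ρ.1).2.2.1.isLeft i ∧ (ω ρ.1).2.2.1.bucketL i (sl ρ.1 l) = a
      then (scaledVal x ρ.1 i (Sum.inr l) * maskVal m s ω x (fun t => Y 1 (thr t)) ρ.1 i) *
        (ρ.2.sign false i * s (ω ρ.1).2.2.2.1 i) else 0 := by
    intro ρ a l
    rw [k4 9 (by norm_num), j5, i4 9 (by norm_num), sA 9 (by norm_num), hY 9 (by norm_num),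
      zero_add]
    have hs' : ∀ (t : ι) (q : Test γ) i, Y 1 (signIdx (q.sign false i * s (ω t).2.2.2.1 i)) =
        q.sign false i * s (ω t).2.2.2.1 i := fun t q i => hsign _ (by
      rw [mul_pow, Test.sign_sq, hs, one_mul])
    simp only [hq, queryData, sum_ops, code_inj, c7, i4 1 (by norm_num), s1, hs', ← ite_and]
    rw [sum_ite_fiber (fun i => (ρ, i, l)) (fun u u' h => by simpa using h)]
    · refine Finset.sum_congr rfl fun i _ => ?_
      simp
    · rintro j hj
      simp only [Prod.mk.injEq] at hj
      exact ⟨j.2.1, by ext <;> simp [hj]⟩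
  have c9 : ∀ (ρ : ι × Test γ) l b, m₉.reals 10 (code (ρ, l, b)) = ∑ v,
      if ((ω ρ.1).2.2.1.isRight v ∧ (ω ρ.1).2.2.1.slot v = sl ρ.1 l) ∧
        (ω ρ.1).2.2.1.bucketR v = b
      then scaledVal x ρ.1 v (Sum.inr l) * (ρ.2.sign true v * s (ω ρ.1).2.2.2.1 v) else 0 := by
    intro ρ l b
    rw [k5, j4 10 (by norm_num), i4 10 (by norm_num), sA 10 (by norm_num), hY 10 (by norm_num),
      zero_add]
    have hs' : ∀ (t : ι) (q : Test γ) i, Y 1 (signIdx (q.sign true i * s (ω t).2.2.2.1 i)) =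
        q.sign true i * s (ω t).2.2.2.1 i := fun t q i => hsign _ (by
      rw [mul_pow, Test.sign_sq, hs, one_mul])
    simp only [hq, queryData, sum_ops, code_inj, j4 4 (by norm_num), i4 4 (by norm_num), s4, c3,
      j4 1 (by norm_num), i4 1 (by norm_num), s1, hs', ← ite_and]
    rw [sum_ite_fiber (fun i => (ρ, i, l)) (fun u u' h => by simpa using h)]
    · refine Finset.sum_congr rfl fun i _ => ?_
      simp
    · rintro j hj
      simp only [Prod.mk.injEq] at hj
      exact ⟨j.2.1, by ext <;> simp [hj]⟩
  have c10 : ∀ t q a b, m₁₀.reals 14 (code ((t, q), a, b)) =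
      cellVal m sl s ω x (fun t => Y 1 (thr t)) t q a b := by
    intro t q a b
    rw [l3 (t, q) (Or.inl (by simp))]
    simp only [c8, c9, cellVal]
  have hwords : ∀ (t : ι) (a b : Fin B), m₁₀.words 1 (code (t, a, b)) = 0 ∧
      m₁₀.words 2 (code (t, a, b)) = 0 := by
    intro t a b
    rw [l2, k3, j3, i3, swords]
    have hlen : code (t, a, b) < q.init.length := by
      rw [show q.init = List.replicate (Fintype.card (ι × Fin B × Fin B)) (0, 0) from rfl,
        List.length_replicate]
      exact code_lt _
    have := a5 _ hlen
    simp only [hq, queryData, List.getElem_replicate, zero_add] at this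
    exact this
  refine ⟨?_, fun t a b => ⟨?_, ?_⟩⟩
  · rw [n1, l1, k2, j2, i2, sout, a1]
    simp [hq, queryData]
  · rw [n2, (hwords t a b).1, zero_add]
    simp only [hq, queryData, sum_ops, code_inj, if_true, c10]
    rw [sum_ite_fiber (fun u => (t, u, a, b)) (fun u u' h => by simpa using h)]
    · refine Finset.sum_congr rfl fun u _ => ?_
      simp
    · rintro j hj
      simp only [Prod.mk.injEq] at hj
      exact ⟨j.2.1, by ext <;> simp [hj]⟩
  · rw [n3, (hwords t a b).2, zero_add]
    simp only [hq, queryData, sum_ops, code_inj, if_true, c10]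
    rw [sum_ite_fiber (fun u => (t, u, a, b)) (fun u u' h => by simpa using h)]
    · refine Finset.sum_congr rfl fun u _ => ?_
      simp
    · rintro j hj
      simp only [Prod.mk.injEq] at hj
      exact ⟨j.2.1, by ext <;> simp [hj]⟩

end

/-! ### The output of a successful trial -/

theorem sum_testBit_mod (i γ : ℕ) :
    ∑ b : Fin γ, (if i.testBit b then 2 ^ (b : ℕ) else 0) = i % 2 ^ γ := by
  induction γ with
  | zero => simp [Nat.mod_one]
  | succ γ ih =>
    rw [Fin.sum_univ_castSucc]
    simp only [Fin.val_castSucc, Fin.val_last]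
    rw [ih, Nat.mod_pow_succ, ← Nat.toNat_testBit]
    cases i.testBit γ <;> simp

theorem sum_testBit {i γ : ℕ} (h : i < 2 ^ γ) :
    ∑ b : Fin γ, (if i.testBit b then 2 ^ (b : ℕ) else 0) = i := by
  rw [sum_testBit_mod, Nat.mod_eq_of_lt h]

theorem mul_pos_of_abs_sub_lt {P c : ℝ} (h : |P - c| < |c|) : 0 < P * c := by
  have h1 := sq_lt_sq.2 h
  nlinarith [sq_nonneg P]

section
variable {ι : Type} {n p M γ r B C : ℕ} {m : ι → ℕ} {sl : ∀ t, Fin r → Fin (m t)}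
  {swap : ι → Bool} {thr : ι → ℕ} {g : Fin M → Fin p → ℝ} {s : Fin M → Fin n → ℝ}
  {ω : ∀ t, TrialSeeds n M γ r B (m t) C} {x : ι × Fin n × Coord γ r → ℝ}
  {y : Fin n → Fin p → ℝ} {c : Fin n → ℝ}

/-- The counters `x` are the sketches of the vectors `c i • y i`. For a unit vector `y i` and the
norm `c i` of a centred row, `c i` cancels when the sketches are divided by the estimated norm. -/
structure AreSketches (g : Fin M → Fin p → ℝ) (ω : ∀ t, TrialSeeds n M γ r B (m t) C)
    (x : ι × Fin n × Coord γ r → ℝ) (y : Fin n → Fin p → ℝ) (c : Fin n → ℝ) : Prop where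
  pos : ∀ i, 0 < c i
  norm : ∀ t i u, x (t, i, Sum.inl u) = c i * dot (g ((ω t).1 u)) (y i)
  row : ∀ t i l, x (t, i, Sum.inr (Sum.inl l)) = c i * dot (g ((ω t).2.1.1 l)) (y i)
  main : ∀ t i l, x (t, i, Sum.inr (Sum.inr l)) = c i * dot (g ((ω t).2.2.2.2 l)) (y i)

theorem AreSketches.normVal (h : AreSketches g ω x y c) (t : ι) (i : Fin n) :
    normVal x t i = c i ^ 2 * normEst g y (ω t).1 i := by
  rw [CorrOutliers.normVal, normEst, Finset.mul_sum]
  refine Finset.sum_congr rfl fun u _ => ?_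
  rw [h.norm]
  ring

theorem AreSketches.scaleOf (h : AreSketches g ω x y c) (t : ι) (i : Fin n) :
    c i * scaleOf (CorrOutliers.normVal x t i) = scaleOf (normEst g y (ω t).1 i) := by
  have hc := h.pos i
  rw [h.normVal, CorrOutliers.scaleOf, CorrOutliers.scaleOf, Real.sqrt_mul (sq_nonneg _),
    Real.sqrt_sq hc.le, ← mul_div_assoc, mul_one, div_mul_eq_div_div, div_self hc.ne']

theorem AreSketches.scaledVal_inl (h : AreSketches g ω x y c) (t : ι) (i : Fin n) (l : Fin r) :
    scaledVal x t i (Sum.inl l) =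
      CorrOutliers.scaleOf (normEst g y (ω t).1 i) * dot (g ((ω t).2.1.1 l)) (y i) := by
  rw [scaledVal, h.row, ← h.scaleOf]
  ring

theorem AreSketches.scaledVal_inr (h : AreSketches g ω x y c) (t : ι) (i : Fin n) (l : Fin r) :
    scaledVal x t i (Sum.inr l) =
      CorrOutliers.scaleOf (normEst g y (ω t).1 i) * dot (g ((ω t).2.2.2.2 l)) (y i) := by
  rw [scaledVal, h.main, ← h.scaleOf]
  ring

theorem AreSketches.rowVal (h : AreSketches g ω x y c) (t : ι) (i : Fin n) :
    rowVal m s ω x t i = rowEst g s y (normEst g y (ω t).1) (ω t).2.1 i := by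
  simp only [CorrOutliers.rowVal, rowEst, h.scaledVal_inl, dot, est, Finset.mul_sum]
  rw [Finset.sum_comm]
  refine Finset.sum_congr rfl fun j _ => Finset.sum_congr rfl fun l _ => ?_
  simp only [← Finset.mul_sum]
  ring

theorem AreSketches.maskVal (h : AreSketches g ω x y c) (θ : ι → ℝ) (t : ι) (i : Fin n) :
    maskVal m s ω x θ t i = keep g s y (θ t) (ω t) i := by
  simp only [CorrOutliers.maskVal, keep, h.rowVal, pow_two]

theorem AreSketches.cellVal (h : AreSketches g ω x y c) (θ : ι → ℝ) (t : ι) (q : Test γ)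
    (a b : Fin B) : cellVal m sl s ω x θ t q a b =
      cellValue g s y (sl t) (ω t).2.2.1
        (fun i => keep g s y (θ t) (ω t) i * CorrOutliers.scaleOf (normEst g y (ω t).1 i))
        (fun i => CorrOutliers.scaleOf (normEst g y (ω t).1 i))
        (q.sign false) (q.sign true) (ω t).2.2.2 a b := by
  rw [CorrOutliers.cellVal, cellValue]
  refine Finset.sum_congr rfl fun l _ => ?_
  congr 1
  · refine Finset.sum_congr rfl fun i _ => ?_
    rw [h.scaledVal_inr, h.maskVal]
    congr 1
    ring
  · refine Finset.sum_congr rfl fun v _ => ?_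
    rw [h.scaledVal_inr]
    congr 1
    · exact propext (by tauto)
    · ring

variable [Fintype ι]

/-- The query reads the bits of the indices of a revealed pair off the signs of its cell. -/
theorem queryData_output (hn : n ≤ 2 ^ γ) {W : ℕ → ℕ → ℕ} {Y : ℕ → ℕ → ℝ}
    (hs : ∀ κ i, s κ i ^ 2 = 1) (hY0 : ∀ z, Y 0 (code z) = x z)
    (hY1 : Y 1 0 = 1) (hY1' : Y 1 1 = -1) (hY : ∀ A, 2 ≤ A → ∀ z, Y A z = 0)
    (h : AreSketches g ω x y c) {t : ι} {i₀ j₀ : Fin n}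
    (hrev : TrialReveals g s y (sl t) (Y 1 (thr t)) i₀ j₀ (ω t)) :
    ∃ z < ((queryData m sl swap thr s ω).eff ⟨0, W, Y⟩).out,
      ((queryData m sl swap thr s ω).eff ⟨0, W, Y⟩).words 1 z =
          ((if swap t then j₀ else i₀ : Fin n) : ℕ) ∧
        ((queryData m sl swap thr s ω).eff ⟨0, W, Y⟩).words 2 z =
          ((if swap t then i₀ else j₀ : Fin n) : ℕ) := by
  obtain ⟨a, b, d, hd⟩ := hrev
  obtain ⟨e1, e2⟩ := queryData_eff (m := m) (sl := sl) (swap := swap) (thr := thr) (ω := ω) (W := W)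
    hs hY0 hY1 hY1' hY
  refine ⟨code (t, a, b), by rw [e1]; exact code_lt _, ?_⟩
  obtain ⟨e3, e4⟩ := e2 t a b
  have h0 := mul_pos_of_abs_sub_lt (hd none)
  -- The sign of the cell changes in a test exactly if the tested bit of the index is `1`.
  have hkey : ∀ q : Bool × Fin γ,
      (CorrOutliers.cellVal m sl s ω x (fun t => Y 1 (thr t)) t none a b *
      CorrOutliers.cellVal m sl s ω x (fun t => Y 1 (thr t)) t (some q) a b < 0) ↔
        (if q.1 then (j₀ : ℕ) else i₀).testBit q.2 = true := by
    intro q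
    rw [h.cellVal, h.cellVal]
    have h1 := mul_pos_of_abs_sub_lt (hd (some q))
    generalize cellValue g s y (sl t) (ω t).2.2.1 _ _ (Test.sign false (some q)) _ _ a b = P at *
    generalize cellValue g s y (sl t) (ω t).2.2.1 _ _ (Test.sign false none) _ _ a b = P₀ at *
    have hpos : 0 < (P₀ * P) * ((Test.sign false (some q) i₀ * Test.sign true (some q) j₀) *
        d ^ 2) := by
      have := mul_pos h0 h1
      simp only [Test.sign, one_mul] at this ⊢
      calc 0 < _ := this
        _ = _ := by ring
    have hd2 : 0 < d ^ 2 := by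
      refine lt_of_le_of_ne (sq_nonneg d) fun h => ?_
      rw [← h, mul_zero, mul_zero] at hpos
      exact lt_irrefl _ hpos
    obtain ⟨side, bit⟩ := q
    have hsg : Test.sign false (some (side, bit)) i₀ * Test.sign true (some (side, bit)) j₀ =
        if (if side then (j₀ : ℕ) else i₀).testBit bit then -1 else 1 := by
      cases side <;> simp [Test.sign]
    rw [hsg] at hpos
    dsimp only
    by_cases hb : (if side then (j₀ : ℕ) else i₀).testBit bit = true
    · rw [if_pos hb] at hpos
      refine iff_of_true ?_ hb
      by_contra hcon
      push Not at hcon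
      nlinarith [mul_nonneg hcon hd2.le]
    · rw [if_neg hb, one_mul] at hpos
      refine iff_of_false ?_ hb
      exact not_lt.2 (pos_of_mul_pos_left hpos hd2.le).le
  have hi := sum_testBit (i₀.2.trans_le hn)
  have hj := sum_testBit (j₀.2.trans_le hn)
  rw [e3, e4]
  simp only [hkey, Fintype.sum_prod_type, Fintype.sum_bool]
  cases hsw : swap t <;> simp [hi, hj]

end

/-! ### Sketches with given memory contents -/

section
variable {n p : ℕ} {Ω Cnt : Type} [Fintype Ω] [Nonempty Ω] [Fintype Cnt]

/-- The linear sketch with seeds `Ω`, stored integers `words` padded to length `N`, fixed reals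
`params`, and counters `Cnt`; the vectors `col` may depend on the stored integers. -/
noncomputable def sketchOf (words : Ω → List ℕ) (N : ℕ) {q : ℕ} (params : Fin q → ℝ)
    (col : (ℕ → ℕ) → Fin n → Fin p → Cnt → ℝ) : LinearSketch n p where
  numSeeds := Fintype.card Ω
  numSeeds_pos := Fintype.card_pos
  numWords := N
  numParams := q
  numCounters := Fintype.card Cnt
  words σ t := (words ((Fintype.equivFin Ω).symm σ)).getD t 0
  params := params
  column w i j c := col (fun t => if h : t < N then w ⟨t, h⟩ else 0) i j
    ((Fintype.equivFin Cnt).symm c)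

/-- The counters are linear in the matrix that the stream describes. -/
theorem counters_eq (S : LinearSketch n p) (σ : Fin S.numSeeds) (us : List (Update n p))
    (c : Fin S.numCounters) :
    S.counters σ us c = ∑ i, ∑ j, streamMatrix us i j * S.column (S.words σ) i j c := by
  have h : ∀ (us : List (Update n p)) (A : Matrix (Fin n) (Fin p) ℝ) (x : Fin S.numCounters → ℝ),
      x c = ∑ i, ∑ j, A i j * S.column (S.words σ) i j c →
      us.foldl (fun x u => x + u.amount • S.column (S.words σ) u.row u.col) x c =
        ∑ i, ∑ j, us.foldl (fun M u => M + Matrix.single u.row u.col u.amount) A i j *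
          S.column (S.words σ) i j c := by
    intro us
    induction us with
    | nil => exact fun A x h => h
    | cons u us ih =>
      intro A x h
      rw [List.foldl_cons, List.foldl_cons]
      refine ih _ _ ?_
      simp only [Pi.add_apply, Pi.smul_apply, smul_eq_mul, Matrix.add_apply, add_mul,
        Finset.sum_add_distrib, h]
      congr 1
      rw [Finset.sum_eq_single u.row, Finset.sum_eq_single u.col]
      · simp
      · intro j _ hj; simp [hj.symm]
      · simp
      · intro i _ hi
        refine Finset.sum_eq_zero fun j _ => ?_
        simp [hi.symm]
      · simp
  exact h us 0 0 (by simp)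

variable {words : Ω → List ℕ} {N q : ℕ} {params : Fin q → ℝ}
  {col : (ℕ → ℕ) → Fin n → Fin p → Cnt → ℝ}

theorem sketchOf_words_ext (hN : ∀ ω, (words ω).length ≤ N)
    (σ : Fin (sketchOf words N params col).numSeeds) :
    (fun t => if h : t < N then (sketchOf words N params col).words σ ⟨t, h⟩ else 0) =
      fun t => (words ((Fintype.equivFin Ω).symm σ)).getD t 0 := by
  funext t
  split_ifs with h
  · rfl
  · rw [List.getD_eq_default]
    exact (hN _).trans (not_lt.1 h)

theorem sketchOf_warr (hN : ∀ ω, (words ω).length ≤ N)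
    (σ : Fin (sketchOf words N params col).numSeeds) (us : List (Update n p)) :
    ((sketchOf words N params col).memory σ us).warr 0 =
      fun t => (words ((Fintype.equivFin Ω).symm σ)).getD t 0 := by
  rw [← sketchOf_words_ext (params := params) (col := col) hN σ]
  funext t
  simp only [LinearSketch.memory, true_and]
  rfl

theorem sketchOf_rarr (hN : ∀ ω, (words ω).length ≤ N)
    (σ : Fin (sketchOf words N params col).numSeeds) (us : List (Update n p)) (c : Cnt) :
    ((sketchOf words N params col).memory σ us).rarr 0 (code c) =
      ∑ i, ∑ j, streamMatrix us i j *
        col (fun t => (words ((Fintype.equivFin Ω).symm σ)).getD t 0) i j c := by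
  have h : code c < (sketchOf words N params col).numCounters := code_lt c
  simp only [LinearSketch.memory, true_and, dif_pos h]
  rw [counters_eq, ← sketchOf_words_ext (params := params) (col := col) hN σ]
  refine Finset.sum_congr rfl fun i _ => Finset.sum_congr rfl fun j _ => ?_
  congr 1
  change col _ i j ((Fintype.equivFin Cnt).symm ⟨code c, h⟩) = _
  congr 1
  exact (Fintype.equivFin Cnt).symm_apply_apply c

theorem sketchOf_rarr_one (σ : Fin (sketchOf words N params col).numSeeds)
    (us : List (Update n p)) (t : Fin q) :
    ((sketchOf words N params col).memory σ us).rarr 1 t = params t := by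
  have h : (t : ℕ) < (sketchOf words N params col).numParams := t.2
  simp only [LinearSketch.memory, one_ne_zero, false_and, dite_false, true_and, dif_pos h]
  rfl

theorem memory_rarr_of_two_le (S : LinearSketch n p) (σ : Fin S.numSeeds) (us : List (Update n p))
    {A : ℕ} (hA : 2 ≤ A) (t : ℕ) : (S.memory σ us).rarr A t = 0 := by
  simp only [LinearSketch.memory]
  rw [dif_neg (by omega), dif_neg (by omega)]

theorem sketchOf_prob (E : Fin (sketchOf words N params col).numSeeds → Prop) :
    (sketchOf words N params col).prob E = pr fun ω : Ω => E (Fintype.equivFin Ω ω) := by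
  rw [pr_eq_card, LinearSketch.prob]
  congr 2
  exact Nat.card_congr ((Fintype.equivFin Ω).subtypeEquiv fun ω => Iff.rfl).symm

/-- The stored integers: the position of the data of the query, the seeds of the sketch, and the
data of the query. -/
def storedWords (seeds : List ℕ) (d : QueryData) : List ℕ :=
  (seeds.length + 1) :: (seeds ++ d.enc)

theorem holds_getD (l : List ℕ) : Holds (fun t => l.getD t 0) 0 l := fun k h => by
  simp [h]

/-- The query program on a sketch that stores the data `d ω`. -/
theorem sketchOf_run {seeds : Ω → List ℕ} {d : Ω → QueryData}
    (hN : ∀ ω, (storedWords (seeds ω) (d ω)).length ≤ N) (Mul : ℕ → ℕ → ℕ)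
    (us : List (Update n p))
    (σ : Fin (sketchOf (fun ω => storedWords (seeds ω) (d ω)) N params col).numSeeds) :
    let S := sketchOf (fun ω => storedWords (seeds ω) (d ω)) N params col
    let dω := d ((Fintype.equivFin Ω).symm σ)
    let m := dω.eff ⟨0, (S.memory σ us).warr, (S.memory σ us).rarr⟩
    ∃ s t, Exec Mul queryProg (S.memory σ us) s t ∧ s.wreg 0 = m.out ∧ s.warr = m.words ∧
      s.wreg 0 ≤ t ∧
      t ≤ 40 * dω.enc.length + (dω.rounds.map fun x => Mul x.dims.1 x.dims.2).sum := by
  intro S dω m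
  have hw := sketchOf_warr (params := params) (col := col) hN σ us
  have h := holds_getD (storedWords (seeds ((Fintype.equivFin Ω).symm σ)) dω)
  rw [storedWords, holds_cons, holds_append] at h
  refine queryProg_spec Mul (S.memory σ us) dω rfl ?_
  change (S.memory σ us).warr 0 = _ at hw
  rw [hw]
  have h0 : (storedWords (seeds ((Fintype.equivFin Ω).symm σ)) dω).getD 0 0 =
      0 + 1 + (seeds ((Fintype.equivFin Ω).symm σ)).length := by
    simp only [storedWords, List.getD_cons_zero]
    omega
  change Holds (fun t => (storedWords (seeds ((Fintype.equivFin Ω).symm σ)) dω).getD t 0)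
    ((storedWords (seeds ((Fintype.equivFin Ω).symm σ)) dω).getD 0 0) dω.enc
  rw [h0]
  exact h.2.2

end

theorem encList_le {α : Type*} {enc : α → List ℕ} {l : List α} {Z : ℕ} (hl : l.length ≤ Z)
    (h : ∀ x ∈ l, ∀ w ∈ enc x, w ≤ Z) : ∀ w ∈ encList enc l, w ≤ Z := by
  intro w hw
  rw [encList, List.mem_cons, List.mem_flatMap] at hw
  rcases hw with rfl | ⟨x, hx, hw⟩
  · exact hl
  · exact h x hx w hw

theorem length_encList_le {α : Type*} {enc : α → List ℕ} {l : List α} {A Z : ℕ}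
    (hl : l.length ≤ A) (h : ∀ x ∈ l, (enc x).length ≤ Z) :
    (encList enc l).length ≤ 1 + A * Z := by
  rw [encList, List.length_cons, List.length_flatMap, Nat.add_comm]
  refine Nat.add_le_add_left ?_ 1
  have := List.sum_le_card_nsmul (l.map fun x => (enc x).length) Z (by
    intro y hy
    obtain ⟨x, hx, rfl⟩ := List.mem_map.1 hy
    exact h x hx)
  rw [List.length_map, smul_eq_mul] at this
  exact this.trans (Nat.mul_le_mul_right Z hl)

theorem getD_le {l : List ℕ} {Z : ℕ} (h : ∀ w ∈ l, w ≤ Z) (t : ℕ) : l.getD t 0 ≤ Z := by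
  by_cases ht : t < l.length
  · rw [List.getD_eq_getElem _ _ ht]
    exact h _ (List.getElem_mem ht)
  · rw [List.getD_eq_default _ _ (not_lt.1 ht)]
    exact Nat.zero_le Z

/-! ### The sketch that lists all pairs -/

section
variable {n p : ℕ}

/-- The data with which the query just outputs all pairs. -/
noncomputable def allPairs (n : ℕ) : QueryData where
  init := ops (fun _ => True) fun e : Fin n × Fin n => ((e.1 : ℕ), (e.2 : ℕ))
  norm := []
  invSqrt := []
  scale := []
  signSum := []
  estimate := []
  mask := []
  masked := []
  left := []
  right := []
  rounds := []
  compare := []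

theorem allPairs_length (n : ℕ) : (allPairs n).enc.length ≤ 12 + n * n * 2 := by
  have h : (encList enc2 (allPairs n).init).length ≤ 1 + n * n * 2 :=
    length_encList_le (length_ops_le.trans (by simp)) fun x _ => by simp [enc2]
  simp only [QueryData.enc, List.length_append]
  simp only [allPairs, encList, List.length_cons, List.length_nil, List.flatMap_nil] at h ⊢
  omega

theorem allPairs_le (hn : 0 < n) : ∀ w ∈ (allPairs n).enc, w ≤ n * n := by
  have h : ∀ w ∈ encList enc2 (allPairs n).init, w ≤ n * n := by
    refine encList_le (length_ops_le.trans (by simp)) fun x hx w hw => ?_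
    obtain ⟨e, -, rfl⟩ := mem_ops.1 hx
    have h1 := e.1.2
    have h2 := e.2.2
    simp only [enc2, List.mem_cons, List.not_mem_nil, or_false] at hw
    rcases hw with rfl | rfl <;> nlinarith
  intro w hw
  have h0 : (0 : ℕ) ≤ n * n := Nat.zero_le _
  rw [QueryData.enc, List.mem_append] at hw
  rcases hw with hw | hw
  · exact h w hw
  · simp [allPairs, encList] at hw
    omega

/-- The sketch without counters that stores all pairs of rows. -/
noncomputable def allPairsSketch (n p : ℕ) : LinearSketch n p :=
  sketchOf (Ω := Unit) (Cnt := Empty) (fun _ => storedWords [] (allPairs n)) (13 + n * n * 2)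
    (q := 0) Fin.elim0 fun _ _ _ => Empty.elim

theorem allPairsSketch_size (n p : ℕ) : (allPairsSketch n p).size = 13 + n * n * 2 := by
  simp [LinearSketch.size, allPairsSketch, sketchOf]

theorem storedWords_length (seeds : List ℕ) (d : QueryData) :
    (storedWords seeds d).length = 1 + seeds.length + d.enc.length := by
  simp [storedWords]
  omega

theorem allPairsSketch_words_le (hn : 0 < n) (σ t) : (allPairsSketch n p).words σ t ≤ n * n := by
  refine getD_le (fun w hw => ?_) _
  simp only [storedWords, List.length_nil, List.nil_append, List.mem_cons] at hw
  rcases hw with rfl | hw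
  · nlinarith
  · exact allPairs_le hn w hw

theorem allPairsSketch_run (Mul : ℕ → ℕ → ℕ) (us : List (Update n p)) (σ) :
    ∃ s t, Exec Mul queryProg ((allPairsSketch n p).memory σ us) s t ∧ s.wreg 0 ≤ t ∧
      t ≤ 40 * (12 + n * n * 2) ∧ ∀ e : Fin n × Fin n, Outputs s e := by
  obtain ⟨s, t, h1, h2, h3, h4, h5⟩ := sketchOf_run (Ω := Unit) (Cnt := Empty)
    (seeds := fun _ => []) (d := fun _ => allPairs n) (N := 13 + n * n * 2)
    (params := (Fin.elim0 : Fin 0 → ℝ)) (col := fun _ _ _ => Empty.elim) (fun _ => by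
      have := allPairs_length n
      rw [storedWords_length, List.length_nil]
      omega) Mul us σ
  refine ⟨s, t, h1, h4, ?_, fun e => ?_⟩
  · have := allPairs_length n
    simp only [show (allPairs n).rounds = [] from rfl, List.map_nil, List.sum_nil] at h5
    omega
  · have heff : ∀ m, (allPairs n).eff m = (allPairs n).init.foldl (fun m x => emitEff x m) m :=
      fun _ => rfl
    rw [heff] at h2 h3
    obtain ⟨e1, -, -, -, e5⟩ := foldl_emit (allPairs n).init
      ⟨0, ((allPairsSketch n p).memory σ us).warr, ((allPairsSketch n p).memory σ us).rarr⟩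
    have he : ((e.1 : ℕ), (e.2 : ℕ)) ∈ (allPairs n).init := mem_ops.2 ⟨e, trivial, rfl⟩
    obtain ⟨z, hz, hze⟩ := List.mem_iff_getElem.1 he
    obtain ⟨e6, e7⟩ := e5 z hz
    rw [hze, zero_add] at e6 e7
    refine ⟨z, ?_, ?_, ?_⟩
    · rw [h2]
      exact hz.trans_eq ((zero_add _).symm.trans e1.symm)
    · rw [h3]
      exact e6
    · rw [h3]
      exact e7

end

/-! ### The length of the data of the query -/

/-- The factor by which the number of stored integers exceeds `n * r + B * B`, for `I` trials. -/
def trialFactor (I γ : ℕ) : ℕ := I * (2 * γ + 1) * (12 * (γ + 3))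

/-- Bounds for the number of elements of the index types of the query. -/
structure CardBounds (I n r B γ Z : ℕ) : Prop where
  norm : I * (n * (12 * (γ + 3))) ≤ Z
  row : I * (n * r) ≤ Z
  test : I * (2 * γ + 1) * (n * r) ≤ Z
  round : I * (2 * γ + 1) * (B * r) ≤ Z
  prod : I * (2 * γ + 1) * (B * B) ≤ Z
  compare : I * (2 * γ * (B * B)) ≤ Z

theorem cardBounds {I n r B γ : ℕ} (hr : 0 < r) (hBn : B ≤ n) :
    CardBounds I n r B γ (trialFactor I γ * (n * r + B * B)) := by
  have h1 : I * (12 * (γ + 3)) ≤ trialFactor I γ := by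
    rw [trialFactor]
    exact Nat.mul_le_mul_right _ (Nat.le_mul_of_pos_right _ (by omega))
  have h2 : I * (2 * γ + 1) ≤ trialFactor I γ := Nat.le_mul_of_pos_right _ (by omega)
  have h3 : I ≤ I * (2 * γ + 1) := Nat.le_mul_of_pos_right _ (by omega)
  have h4 : n * r ≤ n * r + B * B := Nat.le_add_right _ _
  have h5 : B * B ≤ n * r + B * B := Nat.le_add_left _ _
  have h6 : n ≤ n * r := Nat.le_mul_of_pos_right _ hr
  have h7 : B * r ≤ n * r := Nat.mul_le_mul_right _ hBn
  refine ⟨?_, ?_, ?_, ?_, ?_, ?_⟩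
  · calc I * (n * (12 * (γ + 3))) = I * (12 * (γ + 3)) * n := by ring
      _ ≤ _ := Nat.mul_le_mul h1 (h6.trans h4)
  · exact Nat.mul_le_mul (h3.trans h2) h4
  · exact Nat.mul_le_mul h2 h4
  · exact Nat.mul_le_mul h2 (h7.trans h4)
  · exact Nat.mul_le_mul h2 h5
  · calc I * (2 * γ * (B * B)) = I * (2 * γ) * (B * B) := by ring
      _ ≤ _ := Nat.mul_le_mul ((Nat.mul_le_mul_left _ (by omega)).trans h2) h5

section
variable {ι : Type} [Fintype ι] {n M γ r B C : ℕ} {m : ι → ℕ} {sl : ∀ t, Fin r → Fin (m t)}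
  {swap : ι → Bool} {thr : ι → ℕ} {s : Fin M → Fin n → ℝ}
  {ω : ∀ t, TrialSeeds n M γ r B (m t) C} {Z : ℕ}

theorem mem_enc2 {x : ℕ × ℕ} {w : ℕ} : w ∈ enc2 x ↔ w = x.1 ∨ w = x.2 := by simp [enc2]

theorem mem_enc3 {x : ℕ × ℕ × ℕ} {w : ℕ} : w ∈ enc3 x ↔ w = x.1 ∨ w = x.2.1 ∨ w = x.2.2 := by
  simp [enc3]

theorem mem_enc5 {x : ℕ × ℕ × ℕ × ℕ × ℕ} {w : ℕ} : w ∈ enc5 x ↔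
    w = x.1 ∨ w = x.2.1 ∨ w = x.2.2.1 ∨ w = x.2.2.2.1 ∨ w = x.2.2.2.2 := by
  simp [enc5]

theorem roundOf_length {Q : Type*} [Fintype Q] (ρ : Q) :
    (roundOf B r ρ).enc.length ≤ 5 + 4 * (B * r) + 2 * (B * B) := by
  have h1 : (encList enc2 (roundOf B r ρ).left).length ≤ 1 + B * r * 2 :=
    length_encList_le (length_ops_le.trans (by simp)) fun x _ => by simp [enc2]
  have h2 : (encList enc2 (roundOf B r ρ).right).length ≤ 1 + B * r * 2 :=
    length_encList_le (length_ops_le.trans (by simp [Nat.mul_comm])) fun x _ => by simp [enc2]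
  have h3 : (encList enc2 (roundOf B r ρ).prod).length ≤ 1 + B * B * 2 :=
    length_encList_le (length_ops_le.trans (by simp)) fun x _ => by simp [enc2]
  simp only [RoundData.enc, List.length_append]
  simp only [enc2, List.length_cons, List.length_nil]
  omega

theorem queryData_length (h : CardBounds (Fintype.card ι) n r B γ Z) (hZ : 1 ≤ Z) (hr : 0 < r)
    (hB : 0 < B) : (queryData m sl swap thr s ω).enc.length ≤ 80 * Z := by
  obtain ⟨c1, c2, c3, c4, c5, c6⟩ := h
  set I := Fintype.card ι with hI
  have c7 : I * n ≤ Z := le_trans (Nat.mul_le_mul_left _ (Nat.le_mul_of_pos_right _ hr)) c2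
  have c8 : I * (B * B) ≤ Z :=
    le_trans (Nat.mul_le_mul_right _ (Nat.le_mul_of_pos_right _ (by omega))) c5
  have c9 : I * (2 * γ + 1) ≤ Z :=
    le_trans (Nat.le_mul_of_pos_right _ (Nat.mul_pos hB hr)) c4
  have k2 : ∀ x : ℕ × ℕ, (enc2 x).length ≤ 2 := fun x => by simp [enc2]
  have k3 : ∀ x : ℕ × ℕ × ℕ, (enc3 x).length ≤ 3 := fun x => by simp [enc3]
  have k5 : ∀ x : ℕ × ℕ × ℕ × ℕ × ℕ, (enc5 x).length ≤ 5 := fun x => by simp [enc5]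
  set d := queryData m sl swap thr s ω with hd
  have l1 : (encList enc2 d.init).length ≤ 1 + Z * 2 :=
    length_encList_le (by simpa [hd, queryData, ← hI] using c8) fun x _ => k2 x
  have l2 : (encList enc3 d.norm).length ≤ 1 + Z * 3 :=
    length_encList_le (length_ops_le.trans (by simpa [← hI] using c1)) fun x _ => k3 x
  have l3 : (encList (fun x => [x]) d.invSqrt).length ≤ 1 + Z * 1 :=
    length_encList_le (length_ops_le.trans (by simpa [← hI] using c7)) fun x _ => by simp
  have l4 : (encList enc3 d.scale).length ≤ 1 + (2 * Z) * 3 :=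
    length_encList_le (length_ops_le.trans (by
      simp only [Fintype.card_prod, Fintype.card_sum, Fintype.card_fin, ← hI]
      linarith [show I * (n * (r + r)) = 2 * (I * (n * r)) by ring])) fun x _ => k3 x
  have l5 : (encList enc3 d.signSum).length ≤ 1 + Z * 3 :=
    length_encList_le (length_ops_le.trans (by simpa [← hI] using c2)) fun x _ => k3 x
  have l6 : (encList enc3 d.estimate).length ≤ 1 + Z * 3 :=
    length_encList_le (length_ops_le.trans (by simpa [← hI] using c2)) fun x _ => k3 x
  have l7 : (encList enc2 d.mask).length ≤ 1 + Z * 2 :=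
    length_encList_le (length_ops_le.trans (by simpa [← hI] using c7)) fun x _ => k2 x
  have l8 : (encList enc3 d.masked).length ≤ 1 + Z * 3 :=
    length_encList_le (length_ops_le.trans (by simpa [← hI] using c2)) fun x _ => k3 x
  have hT : Fintype.card (Test γ) = 2 * γ + 1 := by simp
  have l9 : (encList enc3 d.left).length ≤ 1 + Z * 3 :=
    length_encList_le (length_ops_le.trans (by
      simpa only [Fintype.card_prod, Fintype.card_fin, ← hI, hT] using c3)) fun x _ => k3 x
  have l10 : (encList enc3 d.right).length ≤ 1 + Z * 3 :=
    length_encList_le (length_ops_le.trans (by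
      simpa only [Fintype.card_prod, Fintype.card_fin, ← hI, hT] using c3)) fun x _ => k3 x
  have l11 : (encList RoundData.enc d.rounds).length ≤
      1 + (I * (2 * γ + 1)) * (5 + 4 * (B * r) + 2 * (B * B)) := by
    refine length_encList_le ?_ fun x hx => ?_
    · simp only [hd, queryData, List.length_map, Finset.length_toList, Finset.card_univ,
        Fintype.card_prod, ← hI, hT]
      exact le_rfl
    · obtain ⟨ρ, -, rfl⟩ := List.mem_map.1 hx
      exact roundOf_length ρ
  have l12 : (encList enc5 d.compare).length ≤ 1 + Z * 5 :=
    length_encList_le (length_ops_le.trans (by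
      simpa only [Fintype.card_prod, Fintype.card_fin, ← hI, Fintype.card_bool] using c6))
      fun x _ => k5 x
  have l11' : (I * (2 * γ + 1)) * (5 + 4 * (B * r) + 2 * (B * B)) ≤ 11 * Z := by
    calc (I * (2 * γ + 1)) * (5 + 4 * (B * r) + 2 * (B * B)) = 5 * (I * (2 * γ + 1)) +
          4 * (I * (2 * γ + 1) * (B * r)) + 2 * (I * (2 * γ + 1) * (B * B)) := by ring
      _ ≤ 5 * Z + 4 * Z + 2 * Z := by gcongr
      _ = _ := by ring
  simp only [QueryData.enc, List.length_append]
  omega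

theorem queryData_le (h : CardBounds (Fintype.card ι) n r B γ Z) (hr : 0 < r)
    (hn : 0 < n) (hB : 0 < B) (hι : 0 < Fintype.card ι) (hthr : ∀ t, thr t ≤ 3) {Z' : ℕ}
    (hZ3 : 3 ≤ Z') (hZ : 3 * Z ≤ Z') (hγ : 2 ^ γ ≤ Z') :
    ∀ w ∈ (queryData m sl swap thr s ω).enc, w ≤ Z' := by
  obtain ⟨c1, c2, c3, c4, c5, c6⟩ := h
  set I := Fintype.card ι with hI
  have c7 : I * n ≤ Z := le_trans (Nat.mul_le_mul_left _ (Nat.le_mul_of_pos_right _ hr)) c2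
  have c7' : I * r ≤ Z := le_trans (Nat.mul_le_mul_left _ (Nat.le_mul_of_pos_left _ hn)) c2
  have c8 : I * (B * B) ≤ Z :=
    le_trans (Nat.mul_le_mul_right _ (Nat.le_mul_of_pos_right _ (by omega))) c5
  have c9 : I * (2 * γ + 1) ≤ Z :=
    le_trans (Nat.le_mul_of_pos_right _ (Nat.mul_pos hB hr)) c4
  have hk : 0 < I * (2 * γ + 1) := Nat.mul_pos hι (by omega)
  have c10 : B * r ≤ Z := le_trans (Nat.le_mul_of_pos_left _ hk) c4
  have c11 : B * B ≤ Z := le_trans (Nat.le_mul_of_pos_left _ hk) c5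
  have c12 : B ≤ Z := (Nat.le_mul_of_pos_right _ hB).trans c11
  have c13 : r ≤ Z := (Nat.le_mul_of_pos_left _ hB).trans c10
  have hT : Fintype.card (Test γ) = 2 * γ + 1 := by simp
  have v1 : ∀ a : ι × Fin n, code a ≤ Z' := fun a => (code_lt a).le.trans (by
    simp only [Fintype.card_prod, Fintype.card_fin, ← hI]; omega)
  have v2 : ∀ a : ι × Fin n × Coord γ r, code a ≤ Z' := fun a => (code_lt a).le.trans (by
    simp only [Fintype.card_prod, Fintype.card_sum, Fintype.card_fin, ← hI]
    linarith [show I * (n * (12 * (γ + 3) + (r + r))) = I * (n * (12 * (γ + 3))) +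
      2 * (I * (n * r)) by ring])
  have v3 : ∀ a : ι × Fin n × (Fin r ⊕ Fin r), code a ≤ Z' := fun a => (code_lt a).le.trans (by
    simp only [Fintype.card_prod, Fintype.card_sum, Fintype.card_fin, ← hI]
    linarith [show I * (n * (r + r)) = 2 * (I * (n * r)) by ring])
  have v4 : ∀ a : ι × Fin r, code a ≤ Z' := fun a => (code_lt a).le.trans (by
    simp only [Fintype.card_prod, Fintype.card_fin, ← hI]; omega)
  have v5 : ∀ a : ι × Fin n × Fin r, code a ≤ Z' := fun a => (code_lt a).le.trans (by
    simp only [Fintype.card_prod, Fintype.card_fin, ← hI]; omega)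
  have v6 : ∀ a : (ι × Test γ) × Fin B × Fin r, code a ≤ Z' := fun a => (code_lt a).le.trans (by
    rw [Fintype.card_prod, Fintype.card_prod, Fintype.card_prod, hT, Fintype.card_fin,
      Fintype.card_fin, ← hI]
    omega)
  have v7 : ∀ a : (ι × Test γ) × Fin r × Fin B, code a ≤ Z' := fun a => (code_lt a).le.trans (by
    rw [Fintype.card_prod, Fintype.card_prod, Fintype.card_prod, hT, Fintype.card_fin,
      Fintype.card_fin, Nat.mul_comm r B, ← hI]
    omega)
  have v8 : ∀ a : (ι × Test γ) × Fin B × Fin B, code a ≤ Z' := fun a => (code_lt a).le.trans (by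
    rw [Fintype.card_prod, Fintype.card_prod, Fintype.card_prod, hT, Fintype.card_fin, ← hI]
    omega)
  have v9 : ∀ a : ι × Fin B × Fin B, code a ≤ Z' := fun a => (code_lt a).le.trans (by
    simp only [Fintype.card_prod, Fintype.card_fin, ← hI]; omega)
  have v10 : ∀ v, signIdx v ≤ Z' := fun v => by rw [signIdx]; split_ifs <;> omega
  have v11 : ∀ {a b : ℕ} (i : Fin a) (j : Fin b), (i : ℕ) * b + j ≤ a * b := by
    intro a b i j
    have h1 : ((i : ℕ) + 1) * b ≤ a * b := Nat.mul_le_mul_right _ i.2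
    have h2 := j.2
    rw [Nat.add_mul, Nat.one_mul] at h1
    omega
  have v12 : ∀ b : Fin γ, 2 ^ (b : ℕ) ≤ Z' := fun b =>
    (Nat.pow_le_pow_right (by norm_num) b.2.le).trans hγ
  set d := queryData m sl swap thr s ω with hd
  have l1 : ∀ w ∈ encList enc2 d.init, w ≤ Z' := by
    refine encList_le ?_ fun x hx w hw => ?_
    · simp only [hd, queryData, List.length_replicate, Fintype.card_prod, Fintype.card_fin, ← hI]
      omega
    · rw [List.eq_of_mem_replicate hx, mem_enc2] at hw
      omega
  have l2 : ∀ w ∈ encList enc3 d.norm, w ≤ Z' := by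
    refine encList_le (length_ops_le.trans (by simp [← hI]; omega)) fun x hx w hw => ?_
    obtain ⟨j, -, rfl⟩ := mem_ops.1 hx
    rcases mem_enc3.1 hw with rfl | rfl | rfl
    exacts [v1 _, v2 _, v2 _]
  have l3 : ∀ w ∈ encList (fun x => [x]) d.invSqrt, w ≤ Z' := by
    refine encList_le (length_ops_le.trans (by simp [← hI]; omega)) fun x hx w hw => ?_
    obtain ⟨j, -, rfl⟩ := mem_ops.1 hx
    rw [List.mem_singleton] at hw
    exact hw ▸ v1 _
  have l4 : ∀ w ∈ encList enc3 d.scale, w ≤ Z' := by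
    refine encList_le (length_ops_le.trans (by
      simp only [Fintype.card_prod, Fintype.card_sum, Fintype.card_fin, ← hI]
      linarith [show I * (n * (r + r)) = 2 * (I * (n * r)) by ring])) fun x hx w hw => ?_
    obtain ⟨j, -, rfl⟩ := mem_ops.1 hx
    rcases mem_enc3.1 hw with rfl | rfl | rfl
    exacts [v3 _, v2 _, v1 _]
  have l5 : ∀ w ∈ encList enc3 d.signSum, w ≤ Z' := by
    refine encList_le (length_ops_le.trans (by simp [← hI]; omega)) fun x hx w hw => ?_
    obtain ⟨j, -, rfl⟩ := mem_ops.1 hx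
    rcases mem_enc3.1 hw with rfl | rfl | rfl
    exacts [v4 _, v3 _, v10 _]
  have l6 : ∀ w ∈ encList enc3 d.estimate, w ≤ Z' := by
    refine encList_le (length_ops_le.trans (by simp [← hI]; omega)) fun x hx w hw => ?_
    obtain ⟨j, -, rfl⟩ := mem_ops.1 hx
    rcases mem_enc3.1 hw with rfl | rfl | rfl
    exacts [v1 _, v3 _, v4 _]
  have l7 : ∀ w ∈ encList enc2 d.mask, w ≤ Z' := by
    refine encList_le (length_ops_le.trans (by simp [← hI]; omega)) fun x hx w hw => ?_
    obtain ⟨j, -, rfl⟩ := mem_ops.1 hx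
    rcases mem_enc2.1 hw with rfl | rfl
    exacts [v1 _, (hthr _).trans hZ3]
  have l8 : ∀ w ∈ encList enc3 d.masked, w ≤ Z' := by
    refine encList_le (length_ops_le.trans (by simp [← hI]; omega)) fun x hx w hw => ?_
    obtain ⟨j, -, rfl⟩ := mem_ops.1 hx
    rcases mem_enc3.1 hw with rfl | rfl | rfl
    exacts [v5 _, v3 _, v1 _]
  have l9 : ∀ w ∈ encList enc3 d.left, w ≤ Z' := by
    refine encList_le (length_ops_le.trans (by
      rw [Fintype.card_prod, Fintype.card_prod, Fintype.card_prod, hT, Fintype.card_fin,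
        Fintype.card_fin, ← hI]
      omega)) fun x hx w hw => ?_
    obtain ⟨j, -, rfl⟩ := mem_ops.1 hx
    rcases mem_enc3.1 hw with rfl | rfl | rfl
    exacts [v6 _, v5 _, v10 _]
  have l10 : ∀ w ∈ encList enc3 d.right, w ≤ Z' := by
    refine encList_le (length_ops_le.trans (by
      rw [Fintype.card_prod, Fintype.card_prod, Fintype.card_prod, hT, Fintype.card_fin,
        Fintype.card_fin, ← hI]
      omega)) fun x hx w hw => ?_
    obtain ⟨j, -, rfl⟩ := mem_ops.1 hx
    rcases mem_enc3.1 hw with rfl | rfl | rfl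
    exacts [v7 _, v3 _, v10 _]
  have l11 : ∀ w ∈ encList RoundData.enc d.rounds, w ≤ Z' := by
    refine encList_le ?_ fun x hx w hw => ?_
    · simp only [hd, queryData, List.length_map, Finset.length_toList, Finset.card_univ]
      rw [Fintype.card_prod, hT, ← hI]
      omega
    · obtain ⟨ρ, -, rfl⟩ := List.mem_map.1 hx
      have hmain : (∀ w ∈ encList enc2 (roundOf B r ρ).left, w ≤ Z') ∧
          (∀ w ∈ encList enc2 (roundOf B r ρ).right, w ≤ Z') ∧
          ∀ w ∈ encList enc2 (roundOf B r ρ).prod, w ≤ Z' := by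
        refine ⟨?_, ?_, ?_⟩
        · refine encList_le (length_ops_le.trans (by simp; omega)) fun x hx w hw => ?_
          obtain ⟨j, -, rfl⟩ := mem_ops.1 hx
          rcases mem_enc2.1 hw with rfl | rfl
          exacts [(v11 j.1 j.2).trans (by omega), v6 _]
        · refine encList_le (length_ops_le.trans (by simp [Nat.mul_comm r B]; omega))
            fun x hx w hw => ?_
          obtain ⟨j, -, rfl⟩ := mem_ops.1 hx
          rcases mem_enc2.1 hw with rfl | rfl
          exacts [(v11 j.1 j.2).trans (by rw [Nat.mul_comm]; omega), v7 _]
        · refine encList_le (length_ops_le.trans (by simp; omega)) fun x hx w hw => ?_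
          obtain ⟨j, -, rfl⟩ := mem_ops.1 hx
          rcases mem_enc2.1 hw with rfl | rfl
          exacts [v8 _, (v11 j.1 j.2).trans (by omega)]
      simp only [RoundData.enc, List.mem_append, mem_enc2] at hw
      rcases hw with hw | hw | hw | hw
      · exact hmain.1 w hw
      · exact hmain.2.1 w hw
      · simp only [roundOf] at hw
        omega
      · exact hmain.2.2 w hw
  have l12 : ∀ w ∈ encList enc5 d.compare, w ≤ Z' := by
    refine encList_le (length_ops_le.trans (by
      simp only [Fintype.card_prod, Fintype.card_fin, ← hI, Fintype.card_bool]
      omega)) fun x hx w hw => ?_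
    obtain ⟨j, -, rfl⟩ := mem_ops.1 hx
    rcases mem_enc5.1 hw with rfl | rfl | rfl | rfl | rfl
    · exact v8 _
    · exact v8 _
    · exact v9 _
    · dsimp only
      split_ifs
      exacts [v12 _, Nat.zero_le _]
    · dsimp only
      split_ifs
      exacts [Nat.zero_le _, v12 _]
  intro w hw
  simp only [QueryData.enc, List.mem_append] at hw
  rcases hw with hw | hw | hw | hw | hw | hw | hw | hw | hw | hw | hw | hw
  exacts [l1 w hw, l2 w hw, l3 w hw, l4 w hw, l5 w hw, l6 w hw, l7 w hw, l8 w hw, l9 w hw,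
    l10 w hw, l11 w hw, l12 w hw]

end

/-! ### Independent repetitions -/

/-- If `T` independent trials of one variant `v` have success probability at least `q`, all trials
fail with probability at most `exp (-q T)`. -/
theorem pr_not_exists_trial_le {T : ℕ} {Ω : Fin 3 × Fin T → Type} [∀ t, Fintype (Ω t)]
    [∀ t, Nonempty (Ω t)] (good : ∀ t, Ω t → Prop) {q : ℝ} {v : Fin 3}
    (h : ∀ j, q ≤ pr (good (v, j))) :
    pr (fun ω : ∀ t, Ω t => ¬ ∃ t, good t (ω t)) ≤ Real.exp (-(q * T)) := by
  classical
  have h1 : pr (fun ω : ∀ t, Ω t => ¬ ∃ t, good t (ω t)) ≤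
      pr fun ω : ∀ t, Ω t => ∀ t, (t.1 = v → ¬ good t (ω t)) :=
    pr_mono fun ω hω t _ hg => hω ⟨t, hg⟩
  rw [pr_pi fun t (ω : Ω t) => t.1 = v → ¬ good t ω, Fintype.prod_prod_type] at h1
  refine h1.trans ?_
  have h2 : ∀ v', ∏ j : Fin T, pr (fun ω : Ω (v', j) => v' = v → ¬ good (v', j) ω) ≤
      if v' = v then Real.exp (-(q * T)) else 1 := by
    intro v'
    split_ifs with hv
    · subst hv
      have h3 : ∀ j, pr (fun ω : Ω (v', j) => v' = v' → ¬ good (v', j) ω) ≤ Real.exp (-q) := by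
        intro j
        refine (pr_mono fun ω hω => hω rfl).trans ?_
        rw [pr_not]
        have := h j
        have := Real.one_sub_le_exp_neg q
        linarith
      refine (Finset.prod_le_prod (fun j _ => pr_nonneg _) fun j _ => h3 j).trans (le_of_eq ?_)
      rw [Finset.prod_const, Finset.card_univ, Fintype.card_fin, ← Real.exp_nat_mul]
      congr 1
      ring
    · exact Finset.prod_le_one (fun j _ => pr_nonneg _) fun j _ => pr_le_one _
  refine (Finset.prod_le_prod (fun v' _ => Finset.prod_nonneg fun j _ => pr_nonneg _)
    fun v' _ => h2 v').trans (le_of_eq ?_)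
  rw [Finset.prod_ite_eq' univ v, if_pos (Finset.mem_univ v)]

theorem pr_forall_ge {Ω ι : Type*} [Fintype Ω] [Nonempty Ω] (S : Finset ι) (p : ι → Ω → Prop)
    {δ : ℝ} (h : ∀ e ∈ S, pr (fun ω => ¬ p e ω) ≤ δ) :
    1 - #S * δ ≤ pr fun ω => ∀ e ∈ S, p e ω := by
  have h1 : pr (fun ω => ¬ ∀ e ∈ S, p e ω) ≤ #S * δ := by
    refine (pr_mono (q := fun ω => ∃ e ∈ S, ¬ p e ω) fun ω hω => by push Not at hω; exact hω).trans
      ((pr_exists_le S fun e ω => ¬ p e ω).trans ?_)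
    rw [← nsmul_eq_mul]
    exact Finset.sum_le_card_nsmul _ _ _ h
  rw [pr_not] at h1
  linarith

/-- The number of classes of the rows; a row is on the left side, and on the right side, with
probability `1 / numClasses γ` each. -/
def numClasses (γ : ℕ) : ℕ := 100 * testFactor γ * rowFactor γ

/-- The number of repetitions of each of the three variants of a trial. With the success probability
`1 / (192 C²)` of a trial, all fail with probability at most `e ^ (-5 γ) ≤ n ^ (-5)`, which allows
for a union bound over `n ^ 2` pairs. -/
def numReps (γ : ℕ) : ℕ := 960 * numClasses γ ^ 2 * γ

theorem numClasses_pos (γ : ℕ) : 0 < numClasses γ := by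
  rw [numClasses, testFactor, rowFactor]; positivity

theorem exp_reps_le {n γ : ℕ} (hn : 0 < n) (hγ : n ≤ 2 ^ γ) :
    Real.exp (-(1 / (192 * (numClasses γ : ℝ) ^ 2) * numReps γ)) ≤ 1 / (n : ℝ) ^ 5 := by
  have hC : (0 : ℝ) < numClasses γ := by exact_mod_cast numClasses_pos γ
  have hn0 : (0 : ℝ) < n := by exact_mod_cast hn
  have h1 : 1 / (192 * (numClasses γ : ℝ) ^ 2) * numReps γ = (5 : ℕ) * γ := by
    rw [numReps]; push_cast; field_simp; ring
  have h2 : (n : ℝ) ≤ Real.exp γ := by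
    have h3 : (n : ℝ) ≤ 2 ^ γ := by exact_mod_cast hγ
    have h4 : (2 : ℝ) ≤ Real.exp 1 := by have := Real.add_one_le_exp (1 : ℝ); linarith
    calc (n : ℝ) ≤ 2 ^ γ := h3
      _ ≤ Real.exp 1 ^ γ := pow_le_pow_left₀ (by norm_num) h4 γ
      _ = Real.exp γ := by rw [← Real.exp_nat_mul, mul_one]
  rw [h1, Real.exp_neg, ← one_div]
  refine one_div_le_one_div_of_le (by positivity) ?_
  rw [Real.exp_nat_mul]
  exact pow_le_pow_left₀ hn0.le h2 5

/-! ### The trials of the sketch -/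

section
variable {n p k M r B γ T : ℕ}

/-- In a trial of the variant `0` there is a single slot and no restriction on the left side. In the
variants `1` and `2` there are `n / B` slots, and the left side is restricted to rows of large
correlation norm; in the variant `2` the left row of a pair is its second one. -/
def numSlots (n B : ℕ) (t : Fin 3 × Fin T) : ℕ := if t.1 = 0 then 1 else n / B

theorem numSlots_pos (h : 0 < n / B) (t : Fin 3 × Fin T) : 0 < numSlots n B t := by
  rw [numSlots]; split_ifs
  · exact one_pos
  · exact h

/-- The position of the threshold among the fixed reals: the variant `0` uses the threshold `0`,
which keeps all rows, the others use `rowThreshold`. -/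
def thresholdIdx (t : Fin 3 × Fin T) : ℕ := if t.1 = 0 then 2 else 3

/-- Whether the row on the left side comes second in the output. -/
def isSwapped (t : Fin 3 × Fin T) : Bool := decide (t.1 = 2)

theorem pr_trialReveals_of_slots {m C : ℕ} [Nonempty (Fin M)] {g : Fin M → Fin p → ℝ}
    {s : Fin M → Fin n → ℝ} {x : Fin n → Fin p → ℝ} {φ R : ℝ} {X : Finset (Fin n × Fin n)}
    (hn : n ≤ 2 ^ γ) (hg : IsFourwise g) (hs : IsFourwise s)
    (hx : ∀ i, dot (x i) (x i) = 1) (h : Regime n k B r (testFactor γ) φ R)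
    (hX : TailBound x φ R k X) (hC : C = numClasses γ)
    (hm : 0 < m) (hmB : m = n / B) {i₀ j₀ : Fin n} (hij : i₀ ≠ j₀) (hφ : φ ≤ |dot (x i₀) (x j₀)|)
    (hi : rowFactor γ * (B * φ ^ 2) ≤ ∑ j, dot (x i₀) (x j) ^ 2) :
    1 / (192 * (C : ℝ) ^ 2) ≤
      pr fun ω : TrialSeeds n M γ r B m C =>
        TrialReveals g s x (slotOf r hm) (rowThreshold B r φ) i₀ j₀ ω := by
  subst hmB
  exact pr_trialReveals_slots hn hg hs hx h hX hC hm hij hφ hi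

theorem pr_trialReveals_of_one_slot {m C : ℕ} [Nonempty (Fin M)] {g : Fin M → Fin p → ℝ}
    {s : Fin M → Fin n → ℝ} {x : Fin n → Fin p → ℝ} {φ R : ℝ} {X : Finset (Fin n × Fin n)}
    (hn : n ≤ 2 ^ γ) (hg : IsFourwise g) (hs : IsFourwise s)
    (hx : ∀ i, dot (x i) (x i) = 1) (h : Regime n k B r (testFactor γ) φ R)
    (hX : TailBound x φ R k X) (hC : C = numClasses γ)
    (hm : 0 < m) (hm1 : m = 1) {i₀ j₀ : Fin n} (hij : i₀ ≠ j₀) (hφ : φ ≤ |dot (x i₀) (x j₀)|)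
    (hi : ∑ j, dot (x i₀) (x j) ^ 2 ≤ rowFactor γ * (B * φ ^ 2))
    (hj : ∑ j, dot (x j₀) (x j) ^ 2 ≤ rowFactor γ * (B * φ ^ 2)) :
    1 / (192 * (C : ℝ) ^ 2) ≤
      pr fun ω : TrialSeeds n M γ r B m C => TrialReveals g s x (slotOf r hm) 0 i₀ j₀ ω := by
  subst hm1
  refine le_trans ?_ (pr_trialReveals_one_slot hn hg hs hx h hX hC hij hφ hi hj)
  have : (0 : ℝ) < C := by rw [hC]; exact_mod_cast numClasses_pos γ
  refine one_div_le_one_div_of_le (by positivity) ?_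
  gcongr
  norm_num

/-- Some variant of the trials is likely to reveal a given large pair. -/
theorem exists_variant {C : ℕ} [Nonempty (Fin M)] {g : Fin M → Fin p → ℝ}
    {s : Fin M → Fin n → ℝ} {x : Fin n → Fin p → ℝ} {φ R : ℝ} {X : Finset (Fin n × Fin n)}
    (hn : n ≤ 2 ^ γ) (hg : IsFourwise g) (hs : IsFourwise s)
    (hx : ∀ i, dot (x i) (x i) = 1) (h : Regime n k B r (testFactor γ) φ R)
    (hX : TailBound x φ R k X) (hC : C = numClasses γ) (hB : 0 < n / B)
    {θ : Fin 3 × Fin T → ℝ} (hθ : ∀ t, θ t = if t.1 = 0 then 0 else rowThreshold B r φ)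
    {i₀ j₀ : Fin n} (hij : i₀ ≠ j₀) (hφ : φ ≤ |dot (x i₀) (x j₀)|) :
    ∃ v : Fin 3, ∀ j : Fin T, 1 / (192 * (C : ℝ) ^ 2) ≤
      pr fun ω : TrialSeeds n M γ r B (numSlots n B (v, j)) C =>
        TrialReveals g s x (slotOf r (numSlots_pos hB (v, j))) (θ (v, j))
          (if isSwapped (v, j) then j₀ else i₀) (if isSwapped (v, j) then i₀ else j₀) ω := by
  by_cases hi : ∑ j, dot (x i₀) (x j) ^ 2 ≤ rowFactor γ * (B * φ ^ 2)
  · by_cases hj : ∑ j, dot (x j₀) (x j) ^ 2 ≤ rowFactor γ * (B * φ ^ 2)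
    · refine ⟨0, fun j => ?_⟩
      rw [hθ]
      exact pr_trialReveals_of_one_slot hn hg hs hx h hX hC _ rfl hij hφ hi hj
    · refine ⟨2, fun j => ?_⟩
      rw [hθ]
      exact pr_trialReveals_of_slots hn hg hs hx h hX hC _ rfl hij.symm
        (by rwa [dot_comm]) (not_le.1 hj).le
  · refine ⟨1, fun j => ?_⟩
    rw [hθ]
    exact pr_trialReveals_of_slots hn hg hs hx h hX hC _ rfl hij hφ (not_le.1 hi).le

end

/-! ### The sketch of the correlation matrix -/

section
variable {n p k M r B γ T C : ℕ}

/-- The random choices of `T` trials of each of the three variants. -/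
abbrev SketchSeeds (n M r B γ T C : ℕ) :=
  ∀ t : Fin 3 × Fin T, TrialSeeds n M γ r B (numSlots n B t) C

/-- The seed of the random signs that are used for a counter. -/
def seedOf (ω : SketchSeeds n M r B γ T C) (t : Fin 3 × Fin T) : Coord γ r → Fin M
  | .inl u => (ω t).1 u
  | .inr (.inl l) => (ω t).2.1.1 l
  | .inr (.inr l) => (ω t).2.2.2.2 l

/-- The seeds of the random signs for the counters, as a list of stored integers. -/
noncomputable def seedWords (ω : SketchSeeds n M r B γ T C) : List ℕ :=
  List.ofFn fun q : Fin (Fintype.card ((Fin 3 × Fin T) × Coord γ r)) =>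
    (seedOf ω ((Fintype.equivFin _).symm q).1 ((Fintype.equivFin _).symm q).2 : ℕ)

theorem seedWords_length (ω : SketchSeeds n M r B γ T C) :
    (seedWords ω).length = Fintype.card ((Fin 3 × Fin T) × Coord γ r) := List.length_ofFn

theorem lt_of_mem_seedWords {ω : SketchSeeds n M r B γ T C} {w : ℕ} (h : w ∈ seedWords ω) :
    w < M := by
  obtain ⟨q, rfl⟩ := List.mem_ofFn.1 h
  exact Fin.is_lt _

theorem getD_seedWords (ω : SketchSeeds n M r B γ T C) (d : QueryData)
    (c : (Fin 3 × Fin T) × Coord γ r) :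
    (storedWords (seedWords ω) d).getD (1 + code c) 0 = seedOf ω c.1 c.2 := by
  have h : code c < (seedWords ω).length := (code_lt c).trans_eq (seedWords_length ω).symm
  rw [storedWords, Nat.add_comm 1 (code c), List.getD_cons_succ, List.getD_append _ _ _ _ h,
    List.getD_eq_getElem _ _ h]
  simp only [seedWords, List.getElem_ofFn]
  have : (Fintype.equivFin _).symm ⟨code c, code_lt c⟩ = c :=
    (Fintype.equivFin _).symm_apply_apply c
  rw [this]

/-- The sign vector of the seed `q`; it is `0` if `q` is not a seed. -/
noncomputable def signVec (g : Fin M → Fin p → ℝ) (q : ℕ) : Fin p → ℝ :=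
  if h : q < M then g ⟨q, h⟩ else 0

/-- The counters of a row hold the inner products of the centred row with random sign vectors. The
mean is subtracted from the sign vector instead of the row, which makes the sketch linear. -/
noncomputable def counterColumn (g : Fin M → Fin p → ℝ) (w : ℕ → ℕ) (i : Fin n) (j : Fin p)
    (c : (Fin 3 × Fin T) × Fin n × Coord γ r) : ℝ :=
  if i = c.2.1 then
    signVec g (w (1 + code (c.1, c.2.2))) j -
      1 / (p : ℝ) * ∑ j', signVec g (w (1 + code (c.1, c.2.2))) j'
  else 0

/-- The parameters of the sketch are positive, and there are at most `n` buckets. -/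
structure SketchShape (n r B T : ℕ) : Prop where
  T_pos : 0 < T
  r_pos : 0 < r
  B_pos : 0 < B
  B_le : B ≤ n

theorem SketchShape.div_pos (h : SketchShape n r B T) : 0 < n / B := Nat.div_pos h.B_le h.B_pos

theorem SketchShape.n_pos (h : SketchShape n r B T) : 0 < n := h.B_pos.trans_le h.B_le

/-- The data of the query for `T` trials of each of the three variants. -/
noncomputable def trialData (h : SketchShape n r B T) (s : Fin M → Fin n → ℝ)
    (ω : SketchSeeds n M r B γ T C) : QueryData :=
  queryData (numSlots n B) (fun t => slotOf r (numSlots_pos h.div_pos t)) isSwapped thresholdIdx s ω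

/-- The order of magnitude of the size of the sketch. -/
def sketchScale (n r B γ T : ℕ) : ℕ := trialFactor (3 * T) γ * (n * r + B * B)

/-- The linear sketch that runs `T` trials of each of the three variants. -/
noncomputable def correlationSketch (γ C : ℕ) [Nonempty (SketchSeeds n M r B γ T C)]
    (h : SketchShape n r B T) (g : Fin M → Fin p → ℝ) (s : Fin M → Fin n → ℝ) (φ : ℝ) :
    LinearSketch n p :=
  sketchOf (Ω := SketchSeeds n M r B γ T C) (Cnt := (Fin 3 × Fin T) × Fin n × Coord γ r)
    (fun ω => storedWords (seedWords ω) (trialData h s ω))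
    (100 * sketchScale n r B γ T) ![1, -1, 0, rowThreshold B r φ] (counterColumn g)

theorem card_trials (T : ℕ) : Fintype.card (Fin 3 × Fin T) = 3 * T := by simp

theorem SketchShape.cardBounds (h : SketchShape n r B T) :
    CardBounds (Fintype.card (Fin 3 × Fin T)) n r B γ (sketchScale n r B γ T) := by
  rw [card_trials]
  exact CorrOutliers.cardBounds h.r_pos h.B_le

theorem SketchShape.scale_pos (h : SketchShape n r B T) : 0 < sketchScale n r B γ T := by
  have h1 := h.T_pos
  have h2 := Nat.mul_pos h.n_pos h.r_pos
  rw [sketchScale, trialFactor]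
  positivity

theorem SketchShape.card_counters_le (h : SketchShape n r B T) :
    Fintype.card ((Fin 3 × Fin T) × Fin n × Coord γ r) ≤ 3 * sketchScale n r B γ T := by
  have h1 := (h.cardBounds (γ := γ)).norm
  have h2 := (h.cardBounds (γ := γ)).row
  rw [Fintype.card_prod]
  generalize Fintype.card (Fin 3 × Fin T) = I at *
  simp only [Fintype.card_prod, Fintype.card_sum, Fintype.card_fin]
  linarith [show I * (n * (12 * (γ + 3) + (r + r))) =
    I * (n * (12 * (γ + 3))) + 2 * (I * (n * r)) by ring]

theorem SketchShape.card_seeds_le (h : SketchShape n r B T) :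
    Fintype.card ((Fin 3 × Fin T) × Coord γ r) ≤ 3 * sketchScale n r B γ T := by
  refine le_trans ?_ (h.card_counters_le (γ := γ))
  simp only [Fintype.card_prod, Fintype.card_fin]
  exact Nat.mul_le_mul_left _ (Nat.le_mul_of_pos_left _ h.n_pos)

theorem SketchShape.trialData_length (h : SketchShape n r B T) (s : Fin M → Fin n → ℝ)
    (ω : SketchSeeds n M r B γ T C) :
    (trialData h s ω).enc.length ≤ 80 * sketchScale n r B γ T :=
  queryData_length h.cardBounds h.scale_pos h.r_pos h.B_pos

theorem SketchShape.storedWords_length_le (h : SketchShape n r B T) (s : Fin M → Fin n → ℝ)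
    (ω : SketchSeeds n M r B γ T C) :
    (storedWords (seedWords ω) (trialData h s ω)).length ≤ 100 * sketchScale n r B γ T := by
  have h1 := h.trialData_length s ω
  have h2 := h.card_seeds_le (γ := γ)
  have h3 := h.scale_pos (γ := γ)
  rw [storedWords_length, seedWords_length]
  omega

theorem trialData_rounds_sum (h : SketchShape n r B T) (s : Fin M → Fin n → ℝ)
    (ω : SketchSeeds n M r B γ T C) (Mul : ℕ → ℕ → ℕ) :
    ((trialData h s ω).rounds.map fun x => Mul x.dims.1 x.dims.2).sum =
      3 * T * (2 * γ + 1) * Mul B r := by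
  have h : (trialData h s ω).rounds =
    (univ : Finset ((Fin 3 × Fin T) × Test γ)).toList.map (roundOf B r) := rfl
  rw [h, List.map_map]
  have h2 : ((fun x : RoundData => Mul x.dims.1 x.dims.2) ∘
      roundOf (Q := (Fin 3 × Fin T) × Test γ) B r) = fun _ => Mul B r := rfl
  rw [h2, List.map_const', List.sum_replicate, Finset.length_toList, Finset.card_univ,
    Fintype.card_prod, card_trials, smul_eq_mul]
  simp only [Fintype.card_option, Fintype.card_prod, Fintype.card_bool, Fintype.card_fin]

section
variable [Nonempty (SketchSeeds n M r B γ T C)] (h : SketchShape n r B T) (g : Fin M → Fin p → ℝ)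
  (s : Fin M → Fin n → ℝ) (φ : ℝ)

theorem correlationSketch_size :
    (correlationSketch γ C h g s φ).size = 100 * sketchScale n r B γ T + 4 +
      Fintype.card ((Fin 3 × Fin T) × Fin n × Coord γ r) := rfl

theorem correlationSketch_words_le {Z' : ℕ} (hM : M ≤ Z')
    (hZ : 4 * sketchScale n r B γ T ≤ Z') (hγ : 2 ^ γ ≤ Z') (σ t) :
    (correlationSketch γ C h g s φ).words σ t ≤ Z' := by
  have h2 := h.card_seeds_le (γ := γ)
  have h3 := h.scale_pos (γ := γ)
  change (storedWords (seedWords _) (trialData h s _)).getD _ 0 ≤ Z'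
  refine getD_le (fun w hw => ?_) _
  rw [storedWords, List.mem_cons, List.mem_append] at hw
  rcases hw with rfl | hw | hw
  · rw [seedWords_length]
    omega
  · exact (lt_of_mem_seedWords hw).le.trans hM
  · refine queryData_le (Z := sketchScale n r B γ T) h.cardBounds h.r_pos h.n_pos h.B_pos ?_
      (fun t => ?_) (by omega) (by omega) hγ w hw
    · rw [card_trials]
      have := h.T_pos
      omega
    · rw [thresholdIdx]
      split_ifs <;> norm_num

theorem correlationSketch_run (Mul : ℕ → ℕ → ℕ) (us : List (Update n p))
    (σ : Fin (correlationSketch γ C h g s φ).numSeeds) :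
    let S := correlationSketch γ C h g s φ
    let m := (trialData h s
        ((Fintype.equivFin (SketchSeeds n M r B γ T C)).symm σ)).eff
      ⟨0, (S.memory σ us).warr, (S.memory σ us).rarr⟩
    ∃ s t, Exec Mul queryProg (S.memory σ us) s t ∧ s.wreg 0 = m.out ∧ s.warr = m.words ∧
      s.wreg 0 ≤ t ∧
      t ≤ 3200 * sketchScale n r B γ T + 3 * T * (2 * γ + 1) * Mul B r := by
  intro S m
  obtain ⟨s', t, h1, h2, h3, h4, h5⟩ := sketchOf_run (Cnt := (Fin 3 × Fin T) × Fin n × Coord γ r)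
    (h.storedWords_length_le (C := C) (γ := γ) s) Mul us σ
    (params := ![1, -1, 0, rowThreshold B r φ]) (col := counterColumn g)
  refine ⟨s', t, h1, h2, h3, h4, h5.trans ?_⟩
  rw [trialData_rounds_sum]
  have := h.trialData_length s ((Fintype.equivFin (SketchSeeds n M r B γ T C)).symm σ)
  omega

theorem correlationSketch_rarr_one (us : List (Update n p))
    (σ : Fin (correlationSketch γ C h g s φ).numSeeds) (t : Fin 4) :
    ((correlationSketch γ C h g s φ).memory σ us).rarr 1 t =
      (![1, -1, 0, rowThreshold B r φ] : Fin 4 → ℝ) t :=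
  sketchOf_rarr_one σ us t

/-- The counters of the sketch are sketches of the normalized rows of the data. -/
theorem areSketches_correlationSketch (us : List (Update n p))
    (hA : ∀ i, sampleCov (streamMatrix us) i i ≠ 0)
    (σ : Fin (correlationSketch γ C h g s φ).numSeeds) :
    AreSketches g ((Fintype.equivFin (SketchSeeds n M r B γ T C)).symm σ)
      (fun c : (Fin 3 × Fin T) × Fin n × Coord γ r =>
        ((correlationSketch γ C h g s φ).memory σ us).rarr 0 (code c))
      (unitRow (streamMatrix us)) fun i =>
        √(dot (centered (streamMatrix us) i) (centered (streamMatrix us) i)) := by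
  set ω := (Fintype.equivFin (SketchSeeds n M r B γ T C)).symm σ with hω
  have key : ∀ t i d, ((correlationSketch γ C h g s φ).memory σ us).rarr 0 (code (t, i, d)) =
      √(dot (centered (streamMatrix us) i) (centered (streamMatrix us) i)) *
        dot (g (seedOf ω t d)) (unitRow (streamMatrix us) i) := by
    intro t i d
    refine (sketchOf_rarr (h.storedWords_length_le (C := C) (γ := γ) s) σ us _).trans ?_
    rw [← dot_unitRow _ (hA i), ← sum_centered_mul, ← hω]
    simp only [counterColumn, getD_seedWords ω (trialData h s ω) (t, d)]
    rw [Finset.sum_eq_single i]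
    · refine Finset.sum_congr rfl fun j _ => ?_
      rw [if_pos rfl, mul_comm]
      simp only [signVec, Fin.is_lt, dif_pos, Fin.eta]
    · intro i' _ hi'
      simp only [if_neg hi', mul_zero, Finset.sum_const_zero]
    · exact fun hi => absurd (Finset.mem_univ i) hi
  exact ⟨fun i => Real.sqrt_pos.2 (dot_centered_pos (hA i)), fun t i u => key t i _,
    fun t i l => key t i _, fun t i l => key t i _⟩

end

/-- The sketch finds all large correlations with high probability. -/
theorem correlationSketch_prob [Nonempty (Fin M)] [∀ t : Fin 3 × Fin (numReps γ),
      Nonempty (TrialSeeds n M γ r B (numSlots n B t) (numClasses γ))]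
    (h : SketchShape n r B (numReps γ)) {g : Fin M → Fin p → ℝ} {s : Fin M → Fin n → ℝ}
    (hg : IsFourwise g) (hs : IsFourwise s) {φ R : ℝ} (hn : n ≤ 2 ^ γ)
    (hreg : Regime n k B r (testFactor γ) φ R) (Mul : ℕ → ℕ → ℕ) (us : List (Update n p))
    (hA : ∀ i, sampleCov (streamMatrix us) i i ≠ 0)
    {X : Finset (Fin n × Fin n)} (hX : TailBound (unitRow (streamMatrix us)) φ R k X) :
    1 - 1 / (n : ℝ) ^ 3 ≤ (correlationSketch γ (numClasses γ) h g s φ).prob fun σ =>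
      ∃ s' t, Exec Mul queryProg ((correlationSketch γ (numClasses γ) h g s φ).memory σ us) s' t ∧
        ∀ e ∈ large (sampleCorr (streamMatrix us)) φ, Outputs s' e := by
  set S := correlationSketch γ (numClasses γ) h g s φ with hS
  set A := streamMatrix us with hA'
  let θ : Fin 3 × Fin (numReps γ) → ℝ := fun t => if t.1 = 0 then 0 else rowThreshold B r φ
  let good : Fin n × Fin n → ∀ t : Fin 3 × Fin (numReps γ),
      TrialSeeds n M γ r B (numSlots n B t) (numClasses γ) → Prop := fun e t ω =>
    TrialReveals g s (unitRow A) (slotOf r (numSlots_pos h.div_pos t)) (θ t)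
      (if isSwapped t then e.2 else e.1) (if isSwapped t then e.1 else e.2) ω
  have hn0 : (0 : ℝ) < n := by exact_mod_cast h.n_pos
  have hprob : 1 - 1 / (n : ℝ) ^ 3 ≤ pr fun ω : SketchSeeds n M r B γ (numReps γ) (numClasses γ) =>
      ∀ e ∈ large (sampleCorr A) φ, ∃ t, good e t (ω t) := by
    refine le_trans ?_ (pr_forall_ge (large (sampleCorr A) φ)
      (fun e (ω : SketchSeeds n M r B γ (numReps γ) (numClasses γ)) => ∃ t, good e t (ω t))
      (δ := 1 / (n : ℝ) ^ 5) fun e he => ?_)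
    · have hcard : (#(large (sampleCorr A) φ) : ℝ) ≤ (n : ℝ) ^ 2 := by
        have := Finset.card_le_univ (large (sampleCorr A) φ)
        rw [Fintype.card_prod, Fintype.card_fin] at this
        rw [pow_two]
        exact_mod_cast this
      have h1 : (n : ℝ) ^ 2 * (1 / (n : ℝ) ^ 5) = 1 / (n : ℝ) ^ 3 := by
        field_simp
      rw [← h1]
      gcongr
    · obtain ⟨he1, he2⟩ := Finset.mem_filter.1 he
      rw [sampleCorr_eq_dot hA] at he2
      obtain ⟨v, hv⟩ := exists_variant (T := numReps γ) (θ := θ) hn hg hs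
        (fun i => dot_unitRow_self (hA i)) hreg hX rfl h.div_pos (fun t => rfl)
        (Finset.mem_offDiag.1 he1).2.2 he2
      exact (pr_not_exists_trial_le (good e) hv).trans (exp_reps_le h.n_pos hn)
  refine hprob.trans ?_
  rw [hS, correlationSketch, sketchOf_prob]
  refine pr_mono fun ω hω => ?_
  obtain ⟨s', t', h1, h2, h3, -, -⟩ := correlationSketch_run h g s φ Mul us
    (Fintype.equivFin (SketchSeeds n M r B γ (numReps γ) (numClasses γ)) ω)
  refine ⟨s', t', h1, fun e he => ?_⟩
  obtain ⟨t, ht⟩ := hω e he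
  have hsk := areSketches_correlationSketch h g s φ us hA
    (Fintype.equivFin (SketchSeeds n M r B γ (numReps γ) (numClasses γ)) ω)
  rw [Equiv.symm_apply_apply] at h2 h3 hsk
  have hparam := correlationSketch_rarr_one h g s φ us
    (Fintype.equivFin (SketchSeeds n M r B γ (numReps γ) (numClasses γ)) ω)
  have hθ : (S.memory (Fintype.equivFin (SketchSeeds n M r B γ (numReps γ) (numClasses γ)) ω)
      us).rarr 1 (thresholdIdx t) = θ t := by
    simp only [thresholdIdx, θ]
    split_ifs
    · exact hparam 2
    · exact hparam 3
  have hrev : TrialReveals g s (unitRow A) (slotOf r (numSlots_pos h.div_pos t))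
      ((S.memory (Fintype.equivFin (SketchSeeds n M r B γ (numReps γ) (numClasses γ)) ω)
        us).rarr 1 (thresholdIdx t))
      (if isSwapped t then e.2 else e.1) (if isSwapped t then e.1 else e.2) (ω t) := by
    rw [hθ]
    exact ht
  obtain ⟨z, hz, hz1, hz2⟩ := queryData_output (swap := isSwapped) (thr := thresholdIdx)
    (sl := fun t => slotOf r (numSlots_pos h.div_pos t)) hn
    (fun κ i => by rw [pow_two]; exact hs.sq κ i) (fun _ => rfl) (hparam 0) (hparam 1)
    (fun a ha z => memory_rarr_of_two_le _ _ us ha z) hsk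
    (t := t) (W := (S.memory (Fintype.equivFin
      (SketchSeeds n M r B γ (numReps γ) (numClasses γ)) ω) us).warr) hrev
  refine ⟨z, hz.trans_eq h2.symm, ?_, ?_⟩
  · rw [h3]
    refine hz1.trans ?_
    cases isSwapped t <;> rfl
  · rw [h3]
    refine hz2.trans ?_
    cases isSwapped t <;> rfl

end

/-! ### Polylogarithmic factors and the choice of the sketch -/

/-- `f` grows at most polynomially. It will be applied to a number `γ` of bits of order `log n`. -/
def PolyBound (f : ℕ → ℕ) : Prop := ∃ K c : ℕ, ∀ γ, f γ ≤ K * (γ + 3) ^ c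

theorem PolyBound.const (a : ℕ) : PolyBound fun _ => a := ⟨a, 0, fun _ => by simp⟩

theorem PolyBound.id : PolyBound fun γ => γ := ⟨1, 1, fun γ => by simp⟩

theorem PolyBound.mul {f g : ℕ → ℕ} (hf : PolyBound f) (hg : PolyBound g) :
    PolyBound fun γ => f γ * g γ := by
  obtain ⟨K, c, hK⟩ := hf
  obtain ⟨L, d, hL⟩ := hg
  refine ⟨K * L, c + d, fun γ => (Nat.mul_le_mul (hK γ) (hL γ)).trans_eq ?_⟩
  rw [pow_add]
  ring

theorem PolyBound.add {f g : ℕ → ℕ} (hf : PolyBound f) (hg : PolyBound g) :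
    PolyBound fun γ => f γ + g γ := by
  obtain ⟨K, c, hK⟩ := hf
  obtain ⟨L, d, hL⟩ := hg
  refine ⟨K + L, c + d, fun γ => ?_⟩
  have h1 : (γ + 3) ^ c ≤ (γ + 3) ^ (c + d) := Nat.pow_le_pow_right (by omega) (by omega)
  have h2 : (γ + 3) ^ d ≤ (γ + 3) ^ (c + d) := Nat.pow_le_pow_right (by omega) (by omega)
  rw [Nat.add_mul]
  exact Nat.add_le_add ((hK γ).trans (Nat.mul_le_mul_left _ h1))
    ((hL γ).trans (Nat.mul_le_mul_left _ h2))

theorem PolyBound.pow {f : ℕ → ℕ} (hf : PolyBound f) (a : ℕ) : PolyBound fun γ => f γ ^ a := by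
  induction a with
  | zero => simpa using PolyBound.const 1
  | succ a ih => simpa only [pow_succ] using ih.mul hf

/-- The polylogarithmic factor in the bounds for the size and the running time. -/
def logFactor (γ : ℕ) : ℕ :=
  25600 * trialFactor (3 * numReps γ) γ + 560 * (100 * testFactor γ) ^ 2

theorem le_logFactor_mul {s : ℝ} (hs : 0 ≤ s) (γ : ℕ) :
    25600 * (trialFactor (3 * numReps γ) γ * s) ≤ logFactor γ * s ∧
    560 * ((100 * (testFactor γ : ℝ)) ^ 2 * s) ≤ logFactor γ * s := by
  rw [logFactor]
  generalize trialFactor (3 * numReps γ) γ = F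
  generalize testFactor γ = G
  have h1 : 0 ≤ (F : ℝ) * s := mul_nonneg (Nat.cast_nonneg F) hs
  have h2 : 0 ≤ (100 * (G : ℝ)) ^ 2 * s := mul_nonneg (sq_nonneg _) hs
  push_cast
  constructor <;> linarith

theorem polyBound_logFactor : PolyBound logFactor := by
  have hbit := ((PolyBound.const 2).mul PolyBound.id).add (PolyBound.const 1)
  have hsk := (PolyBound.const 12).mul (PolyBound.id.add (PolyBound.const 3))
  have htest : PolyBound testFactor := (hbit.mul (PolyBound.const 1024)).mul (hsk.pow 2)
  have hrow : PolyBound rowFactor := (PolyBound.const (480 * 1024)).mul (hsk.pow 2)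
  have hcl : PolyBound numClasses := ((PolyBound.const 100).mul htest).mul hrow
  have hrep : PolyBound numReps := ((PolyBound.const 960).mul (hcl.pow 2)).mul PolyBound.id
  have htrial : PolyBound fun γ => trialFactor (3 * numReps γ) γ :=
    (((PolyBound.const 3).mul hrep).mul hbit).mul hsk
  exact ((PolyBound.const 25600).mul htrial).add
    ((PolyBound.const 560).mul (((PolyBound.const 100).mul htest).pow 2))

/-- The number of bits of a row index. -/
def numBits (n : ℕ) : ℕ := Nat.log 2 n + 1

theorem numBits_add_le {n : ℕ} (hn : 0 < n) : ((numBits n + 3 : ℕ) : ℝ) ≤ 4 * (1 + Real.log n) := by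
  have h1 : ((Nat.log 2 n : ℕ) : ℝ) * Real.log 2 ≤ Real.log n := by
    rw [← Real.log_pow]
    refine Real.log_le_log (by positivity) ?_
    exact_mod_cast Nat.pow_log_le_self 2 hn.ne'
  have h2 := Real.log_two_gt_d9
  have h3 : (0 : ℝ) ≤ (Nat.log 2 n : ℕ) := Nat.cast_nonneg _
  rw [numBits]
  push_cast
  nlinarith

theorem exists_logFactor_le : ∃ (K : ℝ) (c : ℕ), 0 < K ∧ 8 ≤ c ∧ ∀ n : ℕ, 0 < n →
    (logFactor (numBits n) : ℝ) ≤ K * (1 + Real.log n) ^ c := by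
  obtain ⟨K, c, h⟩ := polyBound_logFactor
  -- The summand `8` makes the exponent serve for the stored integers, too: these are at most
  -- `(n + p + size + 2) ^ 8`.
  refine ⟨(K + 1) * 4 ^ (c + 8), c + 8, by positivity, by omega, fun n hn => ?_⟩
  have h1 := numBits_add_le hn
  have h2 : (1 : ℝ) ≤ ((numBits n + 3 : ℕ) : ℝ) := by exact_mod_cast Nat.le_add_left 1 _
  calc (logFactor (numBits n) : ℝ) ≤ ((K * (numBits n + 3) ^ c : ℕ) : ℝ) := by
        exact_mod_cast h (numBits n)
    _ = K * ((numBits n + 3 : ℕ) : ℝ) ^ c := by push_cast; ring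
    _ ≤ (K + 1) * ((numBits n + 3 : ℕ) : ℝ) ^ (c + 8) :=
        mul_le_mul (by linarith) (pow_le_pow_right₀ h2 (by omega)) (by positivity) (by positivity)
    _ ≤ (K + 1) * (4 * (1 + Real.log n)) ^ (c + 8) := by gcongr
    _ = _ := by rw [mul_pow]; ring

theorem LinearSketch.prob_eq_one {n p : ℕ} (S : LinearSketch n p) {E : Fin S.numSeeds → Prop}
    (h : ∀ σ, E σ) : S.prob E = 1 := by
  have hS : (S.numSeeds : ℝ) ≠ 0 := by exact_mod_cast S.numSeeds_pos.ne'
  rw [LinearSketch.prob, Nat.card_congr (Equiv.subtypeUnivEquiv h), Nat.card_eq_fintype_card,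
    Fintype.card_fin, div_self hS]

/-- The guarantees of the sketch, with the polylogarithmic factor `L` and with stored integers of
`O(a log (n + p + size))` bits. -/
structure IsGoodSketch {n p : ℕ} (S : LinearSketch n p) (k : ℕ) (φ R s L : ℝ) (B r a : ℕ) :
    Prop where
  size_le : (S.size : ℝ) ≤ L * s
  words_le : ∀ ω t, S.words ω t ≤ (n + p + S.size + 2) ^ a
  run : ∀ (Mul : ℕ → ℕ → ℕ) (us : List (Update n p)) (ω : Fin S.numSeeds),
    ∃ (s' : State) (t : ℕ), Exec Mul queryProg (S.memory ω us) s' t ∧ s'.wreg 0 ≤ t ∧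
      (t : ℝ) ≤ L * (s + (Mul B r : ℝ))
  prob : ∀ (Mul : ℕ → ℕ → ℕ) (us : List (Update n p)),
    (∀ i, sampleCov (streamMatrix us) i i ≠ 0) →
    #(large (sampleCorr (streamMatrix us)) φ) ≤ k →
    ∀ X : Finset (Fin n × Fin n), IsTop (sampleCorr (streamMatrix us)) k X →
      frobenius (removeEntries (sampleCorr (streamMatrix us)) X) ≤ R →
      1 - 1 / (n : ℝ) ^ 3 ≤ S.prob fun ω => ∃ (s' : State) (t : ℕ),
        Exec Mul queryProg (S.memory ω us) s' t ∧
          ∀ e ∈ large (sampleCorr (streamMatrix us)) φ, Outputs s' e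

theorem IsGoodSketch.mono {n p k B r a a' : ℕ} {S : LinearSketch n p} {φ R s L L' : ℝ}
    (h : IsGoodSketch S k φ R s L B r a) (hs : 0 ≤ s) (hL : L ≤ L') (ha : a ≤ a') :
    IsGoodSketch S k φ R s L' B r a' where
  size_le := h.size_le.trans (by gcongr)
  words_le ω t := (h.words_le ω t).trans (Nat.pow_le_pow_right (by omega) ha)
  run Mul us ω := by
    obtain ⟨s', t, h1, h2, h3⟩ := h.run Mul us ω
    exact ⟨s', t, h1, h2, h3.trans (by gcongr)⟩
  prob := h.prob

/-- If the bound for the size is of order `n²` up to polylogarithmic factors, all pairs of rows can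
be listed. -/
theorem isGoodSketch_allPairsSketch {n p k B r : ℕ} {φ R s : ℝ} (hn : 0 < n) (hs : 0 ≤ s)
    (h : (n : ℝ) ^ 2 < (100 * (testFactor (numBits n) : ℝ)) ^ 2 * s) :
    IsGoodSketch (allPairsSketch n p) k φ R s (logFactor (numBits n)) B r 8 where
  size_le := by
    rw [allPairsSketch_size]
    have h1 : 15 * (n : ℝ) ^ 2 ≤ logFactor (numBits n) * s := by
      linarith [(le_logFactor_mul hs (numBits n)).2, sq_nonneg (n : ℝ)]
    refine le_trans ?_ h1
    have h2 : (1 : ℝ) ≤ n := by exact_mod_cast hn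
    push_cast
    nlinarith
  words_le ω t := by
    refine (allPairsSketch_words_le hn ω t).trans ?_
    calc n * n = n ^ 2 := (pow_two n).symm
      _ ≤ (n + p + (allPairsSketch n p).size + 2) ^ 2 := Nat.pow_le_pow_left (by omega) 2
      _ ≤ _ := Nat.pow_le_pow_right (by omega) (by norm_num)
  run Mul us ω := by
    obtain ⟨s', t, h1, h2, h3, -⟩ := allPairsSketch_run Mul us ω
    refine ⟨s', t, h1, h2, ?_⟩
    have h4 : (1 : ℝ) ≤ n := by exact_mod_cast hn
    have h5 : (t : ℝ) ≤ 40 * (12 + n * n * 2) := by exact_mod_cast h3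
    have h6 : 560 * (n : ℝ) ^ 2 ≤ logFactor (numBits n) * s := by
      linarith [(le_logFactor_mul hs (numBits n)).2, sq_nonneg (n : ℝ)]
    have h7 : (0 : ℝ) ≤ (logFactor (numBits n) : ℝ) * (Mul B r : ℝ) :=
      mul_nonneg (Nat.cast_nonneg _) (Nat.cast_nonneg _)
    nlinarith
  prob Mul us _ _ _ _ _ := by
    rw [LinearSketch.prob_eq_one]
    · have : (0 : ℝ) ≤ 1 / (n : ℝ) ^ 3 := by positivity
      linarith
    · intro σ
      obtain ⟨s', t, h1, -, -, h2⟩ := allPairsSketch_run Mul us σ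
      exact ⟨s', t, h1, fun e _ => h2 e⟩

/-- If the bound for the size is less than `n²` by a polylogarithmic factor, the sketch that runs
the trials has the claimed guarantees. -/
theorem exists_isGoodSketch {n k : ℕ} (p : ℕ) {θ φ R : ℝ} (hθ : 0 ≤ θ) (hn : 0 < n) (hφ : 0 < φ)
    (hφ1 : φ ≤ 1) (hR : 0 ≤ R) (hkR : 0 < k ∨ 0 < R)
    (h : (100 * (testFactor (numBits n) : ℝ)) ^ 2 * sizeBound θ n k φ R ≤ (n : ℝ) ^ 2) :
    ∃ S : LinearSketch n p, IsGoodSketch S k φ R (sizeBound θ n k φ R) (logFactor (numBits n))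
      (outerDim θ n k φ R) (innerDim θ n k φ R) 8 := by
  set γ := numBits n with hγ
  set B := outerDim θ n k φ R with hB
  set r := innerDim θ n k φ R with hr
  obtain ⟨b1, b2, b3⟩ := outerDim_sq_le hθ hn hφ hφ1 hR hkR
  have hreg : Regime n k B r (testFactor γ) φ R :=
    regime_of_le hθ hn hφ hφ1 hR hkR (by rw [testFactor]; positivity) h
  have hn2 : n ≤ 2 ^ γ := (Nat.lt_pow_succ_log_self one_lt_two n).le
  have h2n : 2 ^ γ ≤ 2 * n := by
    rw [hγ, numBits, pow_succ, mul_comm]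
    exact Nat.mul_le_mul_left 2 (Nat.pow_log_le_self 2 hn.ne')
  have hT : 0 < numReps γ := by
    have := numClasses_pos γ
    have : 0 < γ := Nat.succ_pos _
    rw [numReps]
    positivity
  rw [← hB] at b2
  rw [← hr] at b3
  clear_value γ B r
  have hsh : SketchShape n r B (numReps γ) :=
    ⟨hT, hreg.r_pos, hreg.B_pos, by exact_mod_cast hreg.B_le_n⟩
  obtain ⟨M, g, hM, hM', hg⟩ := exists_isFourwise (n + p)
  have : NeZero M := ⟨hM.ne'⟩
  have : NeZero B := ⟨hreg.B_pos.ne'⟩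
  have : NeZero (numClasses γ) := ⟨(numClasses_pos γ).ne'⟩
  have : ∀ t : Fin 3 × Fin (numReps γ), NeZero (numSlots n B t) :=
    fun t => ⟨(numSlots_pos hsh.div_pos t).ne'⟩
  have : ∀ t : Fin 3 × Fin (numReps γ),
      Nonempty (TrialSeeds n M γ r B (numSlots n B t) (numClasses γ)) := fun t => inferInstance
  -- One family of signs serves for the rows and the columns.
  have hgp : IsFourwise fun (ω : Fin M) (j : Fin p) => g ω (Fin.natAdd n j) :=
    hg.comp (Fin.natAdd_injective p n)
  have hgn : IsFourwise fun (ω : Fin M) (i : Fin n) => g ω (Fin.castAdd p i) :=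
    hg.comp (Fin.castAdd_injective n p)
  have hscale : (sketchScale n r B γ (numReps γ) : ℝ) ≤
      trialFactor (3 * numReps γ) γ * (8 * sizeBound θ n k φ R) := by
    rw [sketchScale]
    push_cast
    refine mul_le_mul_of_nonneg_left ?_ (Nat.cast_nonneg _)
    nlinarith
  have hs0 : 0 ≤ sizeBound θ n k φ R := (Nat.cast_nonneg n).trans b1
  have hsize := correlationSketch_size (C := numClasses γ) (γ := γ) hsh
    (fun (ω : Fin M) (j : Fin p) => g ω (Fin.natAdd n j))
    (fun (ω : Fin M) (i : Fin n) => g ω (Fin.castAdd p i)) φ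
  have hcnt := hsh.card_counters_le (γ := γ)
  have hsc := hsh.scale_pos (γ := γ)
  refine ⟨correlationSketch γ (numClasses γ) hsh
    (fun (ω : Fin M) (j : Fin p) => g ω (Fin.natAdd n j))
    (fun (ω : Fin M) (i : Fin n) => g ω (Fin.castAdd p i)) φ, ?_, ?_, ?_, ?_⟩
  · rw [hsize]
    have h1 : 100 * sketchScale n r B γ (numReps γ) + 4 +
        Fintype.card ((Fin 3 × Fin (numReps γ)) × Fin n × Coord γ r) ≤
        107 * sketchScale n r B γ (numReps γ) := by omega
    have h2 : ((100 * sketchScale n r B γ (numReps γ) + 4 +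
        Fintype.card ((Fin 3 × Fin (numReps γ)) × Fin n × Coord γ r) : ℕ) : ℝ) ≤
        107 * sketchScale n r B γ (numReps γ) := by exact_mod_cast h1
    linarith [(le_logFactor_mul hs0 γ).1, mul_nonneg
      (Nat.cast_nonneg (α := ℝ) (trialFactor (3 * numReps γ) γ)) hs0]
  · set x := n + p + (correlationSketch γ (numClasses γ) hsh
      (fun (ω : Fin M) (j : Fin p) => g ω (Fin.natAdd n j))
      (fun (ω : Fin M) (i : Fin n) => g ω (Fin.castAdd p i)) φ).size + 2 with hx
    have hx1 : x ≤ x ^ 8 := Nat.le_self_pow (by norm_num) x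
    have hx2 : x ^ 2 ≤ x ^ 8 := Nat.pow_le_pow_right (by omega) (by norm_num)
    refine correlationSketch_words_le _ _ _ _ (hM'.trans (Nat.pow_le_pow_left ?_ 8)) ?_ ?_
    · omega
    · omega
    · have : 2 * n ≤ x ^ 2 := by
        rw [pow_two]
        exact Nat.mul_le_mul (by omega) (by omega)
      omega
  · intro Mul us ω
    obtain ⟨s', t, h1, -, -, h2, h3⟩ := correlationSketch_run (C := numClasses γ) (γ := γ) hsh
      (fun (ω : Fin M) (j : Fin p) => g ω (Fin.natAdd n j))
      (fun (ω : Fin M) (i : Fin n) => g ω (Fin.castAdd p i)) φ Mul us ω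
    refine ⟨s', t, h1, h2, ?_⟩
    have h4 : 3 * numReps γ * (2 * γ + 1) ≤ trialFactor (3 * numReps γ) γ :=
      Nat.le_mul_of_pos_right _ (by omega)
    have h5 : (t : ℝ) ≤ 3200 * sketchScale n r B γ (numReps γ) +
        trialFactor (3 * numReps γ) γ * Mul B r := by
      exact_mod_cast h3.trans (Nat.add_le_add_left (Nat.mul_le_mul_right _ h4) _)
    have h6 := (le_logFactor_mul hs0 γ).1
    have h7 := (le_logFactor_mul (Nat.cast_nonneg (α := ℝ) (Mul B r)) γ).1
    have h8 : 0 ≤ (trialFactor (3 * numReps γ) γ : ℝ) * (Mul B r : ℝ) :=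
      mul_nonneg (Nat.cast_nonneg _) (Nat.cast_nonneg _)
    rw [mul_add]
    linarith
  · intro Mul us hA hlarge X hX hF
    exact correlationSketch_prob hsh hgp hgn hn2 hreg Mul us hA
      (tailBound_of_isTop hA hR hlarge hX hF)

end CorrOutliers

theorem mainTheorem1 :
    -- one query program and absolute constants, hence `Õ(f)` reads `≤ K (1 + log n)^c f`
    ∃ (Q : CorrOutliers.Program) (K : ℝ) (c : ℕ), 0 < K ∧
      ∀ (θ : ℝ), 0 ≤ θ → θ ≤ 1 →
      ∀ (n p k : ℕ) (φ R : ℝ), 0 < n → 0 < φ → φ ≤ 1 → 0 ≤ R → (0 < k ∨ 0 < R) →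
      ∃ S : CorrOutliers.LinearSketch n p,
        -- size of the sketch
        (S.size : ℝ) ≤ K * (1 + Real.log n) ^ c * CorrOutliers.sizeBound θ n k φ R ∧
        -- the stored integers have `O(log (n + p + size))` bits
        (∀ ω t, S.words ω t ≤ (n + p + S.size + 2) ^ c) ∧
        -- for every cost function of matrix multiplication, the query program always halts in time
        (∀ (Mul : ℕ → ℕ → ℕ) (us : List (CorrOutliers.Update n p)) (ω : Fin S.numSeeds),
          ∃ (s : CorrOutliers.State) (t : ℕ),
            CorrOutliers.Exec Mul Q (S.memory ω us) s t ∧ s.wreg 0 ≤ t ∧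
            (t : ℝ) ≤ K * (1 + Real.log n) ^ c *
              (CorrOutliers.sizeBound θ n k φ R +
                (Mul (CorrOutliers.outerDim θ n k φ R) (CorrOutliers.innerDim θ n k φ R) : ℝ))) ∧
        -- with high probability its output list contains all the large entries
        (∀ (Mul : ℕ → ℕ → ℕ) (us : List (CorrOutliers.Update n p)),
          (∀ i, CorrOutliers.sampleCov (CorrOutliers.streamMatrix us) i i ≠ 0) →
          (CorrOutliers.large (CorrOutliers.sampleCorr (CorrOutliers.streamMatrix us)) φ).card ≤ k →
          ∀ T : Finset (Fin n × Fin n),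
            CorrOutliers.IsTop (CorrOutliers.sampleCorr (CorrOutliers.streamMatrix us)) k T →
            CorrOutliers.frobenius (CorrOutliers.removeEntries
              (CorrOutliers.sampleCorr (CorrOutliers.streamMatrix us)) T) ≤ R →
            1 - 1 / (n : ℝ) ^ 3 ≤ S.prob fun ω =>
              ∃ (s : CorrOutliers.State) (t : ℕ),
                CorrOutliers.Exec Mul Q (S.memory ω us) s t ∧
                ∀ e ∈ CorrOutliers.large
                    (CorrOutliers.sampleCorr (CorrOutliers.streamMatrix us)) φ,
                  CorrOutliers.Outputs s e) := by
  obtain ⟨K, c, hK, hc, hbound⟩ := CorrOutliers.exists_logFactor_le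
  refine ⟨CorrOutliers.queryProg, K, c, hK, fun θ hθ _ n p k φ R hn hφ hφ1 hR hkR => ?_⟩
  have hs : 0 ≤ CorrOutliers.sizeBound θ n k φ R :=
    (Nat.cast_nonneg n).trans (CorrOutliers.outerDim_sq_le hθ hn hφ hφ1 hR hkR).1
  obtain ⟨S, hS⟩ : ∃ S : CorrOutliers.LinearSketch n p,
      CorrOutliers.IsGoodSketch S k φ R (CorrOutliers.sizeBound θ n k φ R)
        (CorrOutliers.logFactor (CorrOutliers.numBits n)) (CorrOutliers.outerDim θ n k φ R)
        (CorrOutliers.innerDim θ n k φ R) 8 := by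
    rcases le_or_gt ((100 * (CorrOutliers.testFactor (CorrOutliers.numBits n) : ℝ)) ^ 2 *
      CorrOutliers.sizeBound θ n k φ R) ((n : ℝ) ^ 2) with h | h
    · exact CorrOutliers.exists_isGoodSketch p hθ hn hφ hφ1 hR hkR h
    · exact ⟨_, CorrOutliers.isGoodSketch_allPairsSketch hn hs h⟩
  have hS' := hS.mono hs (hbound n hn) hc
  exact ⟨S, hS'.size_le, hS'.words_le, hS'.run, hS'.prob⟩
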